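/- Let $I=(0,1)$ and, for $\alpha\in[0,4)$, put $\theta_\alpha=\arccos(\alpha/4)$ and $m_\alpha=-(\alpha^2/8+1)$. For $n\ge1$ and angles $\theta^0,\dots,\theta^n\in[-\frac\pi2,\frac\pi2]$ let $$E_n^\alpha(\theta)=-\frac\alpha2\sum_{i=0}^{n-1}(\cos\theta^i+\cos\theta^{i+1})+\sum_{i=0}^{n-1}\cos(\theta^i+\theta^{i+1})-n\,m_\alpha ,$$ and let $$C_\alpha=\inf\Bigl\{\sum_{i\in\mathbb Z}\Bigl[\cos(\theta^i+\theta^{i+1})-\frac\alpha2(\cos\theta^i+\cos\theta^{i+1})-m_\alpha\Bigr]\Bigr\},$$ the infimum being over all $N\in\mathbb N$ and all $\theta:\mathbb Z\to[-\frac\pi2,\frac\pi2]$ with $\theta^i=\operatorname{sign}(i)\,\theta_\alpha$ for $|i|\ge N$ (where $\operatorname{sign}(0)=-1$). Set $\lambda_{n,\alpha}=2n\theta_\alpha^4$ and $M_\alpha=3C_\alpha/8$. Fix one of the two boundary conditions: (a) periodicity up to sign, $|x|=|y|$; (b) periodicity, $x=y$. Let $E_n^\alpha:L^1(I)\to[0,+\infty]$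 be the functional equal to $E_n^\alpha(\theta)$ as above if $\theta$ is the piecewise-constant interpolation ($\theta=\theta^i$ a.e. on $(\frac in,\frac{i+1}n)$, $0\le i<n$) of angles $\theta^0,\dots,\theta^n\in[-\frac\pi2,\frac\pi2]$ satisfying the boundary condition with $x=\theta^0$, $y=\theta^n$ (in case (a), where the sign of $\theta^n=\pm\theta^0$ is not determined by the interpolation, the smaller value is taken), and $+\infty$ otherwise. Let $H_n^\alpha:L^1(I)\to[0,+\infty]$ be $$H_n^\alpha(\theta)=\frac{\lambda_{n,\alpha}}{\theta_\alpha^4}\int_I(\theta^2-\theta_\alpha^2)^2\,dt+\frac{M_\alpha^2}{\lambda_{n,\alpha}\theta_\alpha^2}\int_I\dot\theta^2\,dt$$ if $\theta\in W^{1,2}(I)$ and the boundary values $x=\theta(0)$, $y=\theta(1)$ of its continuous representative satisfy the same boundary condition, and $+\infty$ otherwise. Then, for each of the two boundary conditions, the families $E_n^\alpha$ and $H_n^\alpha$ are uniformly equivalent by $\Gamma$-convergence on $[0,4)$ with respect to the $L^1(I)$ topology. That is, for every $\alpha_0\in[0,4)$ and every sequence $\alpha_n\in[0,4)$ with $\alpha_n\to\alpha_0$,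 every subsequence of indices has a further subsequence along which $E_n^{\alpha_n}$ and $H_n^{\alpha_n}$ both $\Gamma$-converge, to the same limit, and this limit is non-trivial (it takes some value in $(0,+\infty)$). -/

import Mathlib

open Filter Topology MeasureTheory Set
open scoped ContDiff

noncomputable section

namespace FrustratedChain

/-! ### Gamma-convergence and uniform equivalence -/

/-- (Sequential) `Γ`-convergence of `F k` to `L` on a (metric) space `X`: the liminf inequality
along every convergent sequence, and existence of recovery sequences. -/
def GammaTendsto {X : Type*} [TopologicalSpace X] (F : ℕ → X → EReal) (L : X → EReal) : Prop :=
  ∀ x : X,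
    (∀ u : ℕ → X, Tendsto u atTop (𝓝 x) → L x ≤ liminf (fun k => F k (u k)) atTop) ∧
    (∃ u : ℕ → X, Tendsto u atTop (𝓝 x) ∧ limsup (fun k => F k (u k)) atTop ≤ L x)

/-- A functional with values in `[0, +∞]` is non-trivial if it takes some value strictly
between `0` and `+∞` (so it is neither `0` nor `+∞` identically, nor a mere constraint). -/
def IsNontrivial {X : Type*} (L : X → EReal) : Prop :=
  ∃ x : X, 0 < L x ∧ L x < ⊤

/-- Uniform equivalence (at scale 1) at `a₀` of two families `F n a`, `G n a` with parameter
`a ∈ A`: for all `a n → a₀` in `A`, up to subsequences (every subsequence `ψ` has a further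
subsequence `ψ ∘ φ`), both `F n (a n)` and `G n (a n)` `Γ`-converge, to the same non-trivial
limit. -/
def UniformlyEquivalentAt {X : Type*} [TopologicalSpace X] (A : Set ℝ)
    (F G : ℕ → ℝ → X → EReal) (a₀ : ℝ) : Prop :=
  ∀ a : ℕ → ℝ, (∀ n, a n ∈ A) → Tendsto a atTop (𝓝 a₀) →
    ∀ ψ : ℕ → ℕ, StrictMono ψ →
      ∃ φ : ℕ → ℕ, StrictMono φ ∧ ∃ L : X → EReal,
        GammaTendsto (fun k => F (ψ (φ k)) (a (ψ (φ k)))) L ∧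
        GammaTendsto (fun k => G (ψ (φ k)) (a (ψ (φ k)))) L ∧
        IsNontrivial L

/-- Uniform equivalence on a set of parameters. -/
def UniformlyEquivalentOn {X : Type*} [TopologicalSpace X] (A : Set ℝ)
    (F G : ℕ → ℝ → X → EReal) : Prop :=
  ∀ a₀ ∈ A, UniformlyEquivalentAt A F G a₀

/-! ### The interval `I = (0,1)` and the space `L¹(I)` -/

/-- Lebesgue measure on `I = (0,1)`. -/
abbrev muI : Measure ℝ := volume.restrict (Ioo (0 : ℝ) 1)

/-- The space `L¹(I)` with its norm topology. -/
abbrev L1I : Type := Lp ℝ 1 muI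

/-! ### Boundary conditions: relations between the values at `0` and at `1` -/

/-- Periodicity up to sign, `|x| = |y|`. For the angles `x, y ∈ [-π/2, π/2]` of two pairs of
neighbouring spins it says that the two scalar products agree. -/
def AbsPeriodic (x y : ℝ) : Prop := |x| = |y|

/-- Periodicity, `x = y`. -/
def Periodic (x y : ℝ) : Prop := x = y

/-! ### The frustrated chain -/

/-- The minimal energy per site `m_α`. -/
def mMin (α : ℝ) : ℝ := if α ≤ 4 then -(α ^ 2 / 8 + 1) else -α + 1

/-- The minimal angle `θ_α = arccos (α / 4)`. -/
def thetaMin (α : ℝ) : ℝ := Real.arccos (α / 4)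

/-- The energy `E_n^α` of the angles `φ 0, …, φ n`. -/
def latticeEnergy (n : ℕ) (α : ℝ) (φ : ℕ → ℝ) : ℝ :=
  -(α / 2) * ∑ i ∈ Finset.range n, (Real.cos (φ i) + Real.cos (φ (i + 1)))
    + ∑ i ∈ Finset.range n, Real.cos (φ i + φ (i + 1)) - n * mMin α

/-- `φ` is a lattice function on `{0, 1/n, …, 1}` with values in `[-π/2, π/2]` and boundary
condition `R (φ 0) (φ n)`, and `θ` is its piecewise-constant interpolation on `I`. -/
def IsInterpolation (R : ℝ → ℝ → Prop) (n : ℕ) (φ : ℕ → ℝ) (θ : L1I) : Prop :=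
  (∀ i ≤ n, φ i ∈ Icc (-(Real.pi / 2)) (Real.pi / 2)) ∧ R (φ 0) (φ n) ∧
    ∀ i < n, ∀ᵐ t ∂muI, t ∈ Ioo ((i : ℝ) / n) (((i : ℝ) + 1) / n) → θ t = φ i

/-- The energy `E_n^α` on `L¹(I)`: the energy of the lattice function of which `θ` is the
interpolation, and `+∞` if there is none. The interpolation determines `φ 0, …, φ (n - 1)`;
when the boundary condition leaves the sign of `φ n = ± φ 0` free, the smaller of the two
energies is taken. -/
def chainEnergy (R : ℝ → ℝ → Prop) (n : ℕ) (α : ℝ) (θ : L1I) : EReal :=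
  ⨅ φ : ℕ → ℝ, ⨅ _ : IsInterpolation R n φ θ, ((latticeEnergy n α φ : ℝ) : EReal)

/-- The energy density of a pair of neighbouring angles. -/
def bondEnergy (α x y : ℝ) : ℝ :=
  Real.cos (x + y) - α / 2 * (Real.cos x + Real.cos y) - mMin α

/-- The crease transition energy `C_α` between `-θ_α` and `θ_α`: the infimum, over all `N` and
all `θ : ℤ → [-π/2, π/2]` with `θ i = sign i * θ_α` for `|i| ≥ N` (convention: `sign 0 = -1`),
of the total energy. Only finitely many terms of the sum are nonzero. -/
def creaseEnergy (α : ℝ) : ℝ :=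
  sInf {s : ℝ | ∃ (N : ℕ) (θ : ℤ → ℝ),
    (∀ i, θ i ∈ Icc (-(Real.pi / 2)) (Real.pi / 2)) ∧
    (∀ i : ℤ, (N : ℤ) ≤ |i| → θ i = if 0 < i then thetaMin α else -thetaMin α) ∧
    s = ∑' i : ℤ, bondEnergy α (θ i) (θ (i + 1))}

/-! ### Sobolev functions on `I` -/

/-- `g ∈ L²(I)` is the weak derivative of `u` on `I`. -/
def IsWeakDeriv (u g : ℝ → ℝ) : Prop :=
  MemLp g 2 muI ∧
  ∀ η : ℝ → ℝ, ContDiff ℝ ∞ η → HasCompactSupport η → tsupport η ⊆ Ioo (0 : ℝ) 1 →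
    ∫ t in Ioo (0 : ℝ) 1, u t * deriv η t = -∫ t in Ioo (0 : ℝ) 1, g t * η t

/-- Membership in `W^{1,2}(I)`. -/
def MemW12 (u : ℝ → ℝ) : Prop := MemLp u 2 muI ∧ ∃ g, IsWeakDeriv u g

open Classical in
/-- The weak derivative (unique up to null sets; `0` if there is none). -/
def weakDeriv (u : ℝ → ℝ) : ℝ → ℝ :=
  if h : ∃ g, IsWeakDeriv u g then h.choose else 0

/-- `u ∈ W^{1,2}(I)` with boundary condition `R (u 0) (u 1)`, where the boundary values are
those of the representative of `u` that is continuous on `[0,1]`. For `R = AbsPeriodic` this is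
the space `W^{1,2}_{|per|}(I)`. -/
def MemW12Bdry (R : ℝ → ℝ → Prop) (u : ℝ → ℝ) : Prop :=
  MemW12 u ∧ ∃ w : ℝ → ℝ, ContinuousOn w (Icc 0 1) ∧ u =ᵐ[muI] w ∧ R (w 0) (w 1)

/-! ### The Modica-Mortola functionals -/

/-- `λ_{n,α} = 2 n θ_α⁴`. -/
def lam (n : ℕ) (α : ℝ) : ℝ := 2 * n * thetaMin α ^ 4

/-- `M_α = 3 C_α / 8`. -/
def bigM (α : ℝ) : ℝ := 3 * creaseEnergy α / 8

open Classical in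
/-- The functionals `H_n^α` on `L¹(I)`. -/
def modicaMortola (R : ℝ → ℝ → Prop) (n : ℕ) (α : ℝ) (θ : L1I) : EReal :=
  if MemW12Bdry R θ then
    ((lam n α / thetaMin α ^ 4 * (∫ t in Ioo (0 : ℝ) 1, (θ t ^ 2 - thetaMin α ^ 2) ^ 2)
      + bigM α ^ 2 / (lam n α * thetaMin α ^ 2)
        * (∫ t in Ioo (0 : ℝ) 1, weakDeriv θ t ^ 2) : ℝ) : EReal)
  else ⊤

end FrustratedChain

end

/-!
Both families have the same `Γ`-limit along the full sequence of indices. For a parameter sequence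
converging to `β`, it is the functional `limitEnergy`: the closure in `L¹(I)` of "number of jumps
times `C_β`" on the functions with values `± θ_β`, where the parity of the number of jumps has to be
compatible with the boundary condition. As this limit is known, no compactness is needed:
`gammaTendsto_limitEnergy` reduces the convergence to a lower bound (a function of energy below `K`
is `L¹`-close to a step function with few jumps) and an upper bound (a step function with `m` jumps
is `L¹`-close to a function of energy at most `m C_β + ε`), each uniform for parameters near `β`.

*The chain.* Completing the square, the bond energy is a nonnegative function of two neighbouring
angles that vanishes only if both are equal to `θ_α` or both to `-θ_α`. So a chain of bounded energy
is close to `± θ_α` outside of boundedly many sites, and a change of sign between two such sites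
costs almost `C_β`: the piece in between, prolonged by the constants `± θ_α`, is a competitor for the
crease energy. The same cutting argument shows that `C_α` is positive and continuous in `α`. Adding
up over the changes of sign gives the lower bound `chainEnergy_lower`; for the upper bound
`chainEnergy_upper`, almost optimal creases of a fixed length are placed at the jumps by multiplying
their shapes.

*The Modica–Mortola functionals.* With `λ_{n,α} / θ_α⁴ = 2 n`, the product of the two coefficients
does not depend on `n`, and the inequality of Modica and Mortola bounds the energy on an interval
below by a multiple of the increment of `θ² w - w³ / 3`. Between the wells this is
`8 M_α / 3 = C_α`, which is how the constant `M_α` is chosen. The counting of the changes of sign is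
the same as for the chain (`exists_stepFn_eq`). Conversely, products of truncated `tanh` profiles at
scale `M_α / λ_{n,α}` have almost this energy per jump. Elements of `W^{1,2}(I)`, given by a weak
derivative, are identified with absolutely continuous functions by the lemma of du Bois-Reymond.
-/

namespace FrustratedChain

/-! ### The energy of a bond -/

lemma thetaMin_pos {α : ℝ} (h4 : α < 4) : 0 < thetaMin α := by
  unfold thetaMin
  exact Real.arccos_pos.2 (by linarith)

lemma thetaMin_le {α : ℝ} (h0 : 0 ≤ α) : thetaMin α ≤ Real.pi / 2 := by
  unfold thetaMin
  exact Real.arccos_le_pi_div_two.2 (by positivity)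

lemma thetaMin_mem {α : ℝ} (hα : α ∈ Ico (0 : ℝ) 4) :
    thetaMin α ∈ Icc (-(Real.pi / 2)) (Real.pi / 2) :=
  ⟨by linarith [thetaMin_pos hα.2, Real.pi_pos], thetaMin_le hα.1⟩

lemma neg_mem_angles {x : ℝ} (hx : x ∈ Icc (-(Real.pi / 2)) (Real.pi / 2)) :
    -x ∈ Icc (-(Real.pi / 2)) (Real.pi / 2) :=
  ⟨by linarith [hx.2], by linarith [hx.1]⟩

lemma cos_thetaMin {α : ℝ} (hα : α ∈ Ico (0 : ℝ) 4) : Real.cos (thetaMin α) = α / 4 :=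
  Real.cos_arccos (by linarith [hα.1]) (by linarith [hα.2])

lemma mMin_eq {α : ℝ} (h4 : α ≤ 4) : mMin α = -(α ^ 2 / 8 + 1) := if_pos h4

/-- The completed square behind the choice of `m_α`; all lower bounds rest on it. -/
lemma bondEnergy_eq_sq {α : ℝ} (h4 : α ≤ 4) (x y : ℝ) :
    bondEnergy α x y = 2 * (Real.cos ((x + y) / 2) - α / 4 * Real.cos ((x - y) / 2)) ^ 2
      + α ^ 2 / 8 * Real.sin ((x - y) / 2) ^ 2 := by
  obtain ⟨u, hu⟩ : ∃ u, u = (x + y) / 2 := ⟨_, rfl⟩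
  obtain ⟨v, hv⟩ : ∃ v, v = (x - y) / 2 := ⟨_, rfl⟩
  have hx : x = u + v := by rw [hu, hv]; ring
  have hy : y = u - v := by rw [hu, hv]; ring
  have hxy : x + y = 2 * u := by rw [hu]; ring
  rw [← hu, ← hv, bondEnergy, mMin_eq h4, hxy, hx, hy, Real.cos_two_mul, Real.cos_add, Real.cos_sub]
  have := Real.sin_sq_add_cos_sq v
  have h2 : Real.sin v ^ 2 = 1 - Real.cos v ^ 2 := by linarith
  rw [h2]; ring

lemma bondEnergy_nonneg {α : ℝ} (h4 : α ≤ 4) (x y : ℝ) : 0 ≤ bondEnergy α x y := by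
  rw [bondEnergy_eq_sq h4]; positivity

lemma bondEnergy_neg (α x y : ℝ) : bondEnergy α (-x) (-y) = bondEnergy α x y := by
  unfold bondEnergy
  rw [← neg_add, Real.cos_neg, Real.cos_neg, Real.cos_neg]

lemma bondEnergy_sign_mul (α x y : ℝ) {s : ℝ} (hs : s = 1 ∨ s = -1) :
    bondEnergy α (s * x) (s * y) = bondEnergy α x y := by
  rcases hs with rfl | rfl
  · simp
  · simpa using bondEnergy_neg α x y

lemma bondEnergy_thetaMin {α : ℝ} (hα : α ∈ Ico (0 : ℝ) 4) :
    bondEnergy α (thetaMin α) (thetaMin α) = 0 := by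
  rw [bondEnergy, mMin_eq hα.2.le, ← two_mul, Real.cos_two_mul, cos_thetaMin hα]; ring

lemma bondEnergy_neg_thetaMin {α : ℝ} (hα : α ∈ Ico (0 : ℝ) 4) :
    bondEnergy α (-thetaMin α) (-thetaMin α) = 0 := by
  rw [bondEnergy_neg, bondEnergy_thetaMin hα]

lemma eq_thetaMin_of_cos_eq {α x : ℝ} (hx : x ∈ Icc (-(Real.pi / 2)) (Real.pi / 2))
    (h : Real.cos x = α / 4) : x = thetaMin α ∨ x = -thetaMin α := by
  have hpi := Real.pi_pos
  rcases le_total 0 x with h0 | h0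
  · left
    rw [thetaMin, ← h, Real.arccos_cos h0 (by linarith [hx.2])]
  · right
    rw [thetaMin, ← h, ← Real.cos_neg, Real.arccos_cos (by linarith) (by linarith [hx.1]), neg_neg]

/-- A bond without energy consists of two equal minimal angles. For `α > 0` the sine term forces
`x = y`; for `α = 0` only `x + y = ± π` is forced, which in `[-π/2, π/2]` is the same. -/
lemma eq_of_bondEnergy_eq_zero {α x y : ℝ} (hα : α ∈ Ico (0 : ℝ) 4)
    (hx : x ∈ Icc (-(Real.pi / 2)) (Real.pi / 2)) (hy : y ∈ Icc (-(Real.pi / 2)) (Real.pi / 2))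
    (h : bondEnergy α x y = 0) : x = y ∧ (x = thetaMin α ∨ x = -thetaMin α) := by
  have hpi := Real.pi_pos
  rw [bondEnergy_eq_sq hα.2.le] at h
  have h1 : (Real.cos ((x + y) / 2) - α / 4 * Real.cos ((x - y) / 2)) ^ 2 = 0 := by
    nlinarith [sq_nonneg (Real.cos ((x + y) / 2) - α / 4 * Real.cos ((x - y) / 2)),
      mul_nonneg (by positivity : (0 : ℝ) ≤ α ^ 2 / 8) (sq_nonneg (Real.sin ((x - y) / 2)))]
  have h2 : α ^ 2 / 8 * Real.sin ((x - y) / 2) ^ 2 = 0 := by rw [h1] at h; linarith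
  have h1' : Real.cos ((x + y) / 2) = α / 4 * Real.cos ((x - y) / 2) := by
    have := pow_eq_zero_iff (two_ne_zero) |>.1 h1
    linarith
  have hxy : x = y := by
    rcases eq_or_lt_of_le hα.1 with h0 | h0
    · rw [← h0] at h1'
      simp only [zero_div, zero_mul] at h1'
      by_contra hne
      have hlt : (x + y) / 2 < Real.pi / 2 := by
        rcases lt_or_gt_of_ne hne with h | h <;> linarith [hx.2, hy.2]
      have hgt : -(Real.pi / 2) < (x + y) / 2 := by
        rcases lt_or_gt_of_ne hne with h | h <;> linarith [hx.1, hy.1]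
      exact (Real.cos_pos_of_mem_Ioo ⟨hgt, hlt⟩).ne' h1'
    · have h3 : Real.sin ((x - y) / 2) = 0 := by
        rcases mul_eq_zero.1 h2 with h | h
        · exact absurd h (by positivity)
        · exact pow_eq_zero_iff (two_ne_zero) |>.1 h
      have := (Real.sin_eq_zero_iff_of_lt_of_lt (by linarith [hx.1, hy.2])
        (by linarith [hx.2, hy.1])).1 h3
      linarith
  refine ⟨hxy, eq_thetaMin_of_cos_eq hx ?_⟩
  subst hxy
  simpa using h1'

lemma continuous_bondEnergy (α : ℝ) : Continuous fun q : ℝ × ℝ => bondEnergy α q.1 q.2 := by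
  unfold bondEnergy; fun_prop

/-- Away from the two wells the energy of a bond is bounded below. -/
lemma exists_pos_le_bondEnergy {β : ℝ} (hβ : β ∈ Ico (0 : ℝ) 4) {K : Set (ℝ × ℝ)} (hK : IsClosed K)
    (hp : ((thetaMin β, thetaMin β) : ℝ × ℝ) ∉ K)
    (hn : ((-thetaMin β, -thetaMin β) : ℝ × ℝ) ∉ K) :
    ∃ c > 0, ∀ x ∈ Icc (-(Real.pi / 2)) (Real.pi / 2), ∀ y ∈ Icc (-(Real.pi / 2)) (Real.pi / 2),
      (x, y) ∈ K → c ≤ bondEnergy β x y := by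
  set B := Icc (-(Real.pi / 2)) (Real.pi / 2)
  have hc : IsCompact ((B ×ˢ B) ∩ K) := (isCompact_Icc.prod isCompact_Icc).inter_right hK
  rcases ((B ×ˢ B) ∩ K).eq_empty_or_nonempty with he | hne
  · refine ⟨1, one_pos, fun x hx y hy h => ?_⟩
    have : (x, y) ∈ (B ×ˢ B) ∩ K := ⟨⟨hx, hy⟩, h⟩
    rw [he] at this
    exact this.elim
  · obtain ⟨q, hq, hmin⟩ := hc.exists_isMinOn hne (continuous_bondEnergy β).continuousOn
    refine ⟨bondEnergy β q.1 q.2, ?_,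
      fun x hx y hy h => isMinOn_iff.1 hmin (x, y) ⟨mk_mem_prod hx hy, h⟩⟩
    refine lt_of_le_of_ne (bondEnergy_nonneg hβ.2.le _ _) fun h0 => ?_
    obtain ⟨h1, h2⟩ := eq_of_bondEnergy_eq_zero hβ hq.1.1 hq.1.2 h0.symm
    rcases h2 with h2 | h2
    · apply hp
      rw [← h2]; nth_rewrite 2 [h1]; exact hq.2
    · apply hn
      rw [← h2]; nth_rewrite 2 [h1]; exact hq.2

lemma abs_bondEnergy_sub_le {α : ℝ} (hα : α ∈ Ico (0 : ℝ) 4) (x y x' y' : ℝ) :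
    |bondEnergy α x y - bondEnergy α x' y'| ≤ 3 * (|x - x'| + |y - y'|) := by
  have h1 := Real.abs_cos_sub_cos_le (x + y) (x' + y')
  have h2 := Real.abs_cos_sub_cos_le x x'
  have h3 := Real.abs_cos_sub_cos_le y y'
  have h4 : |x + y - (x' + y')| ≤ |x - x'| + |y - y'| := by
    rw [show x + y - (x' + y') = (x - x') + (y - y') by ring]; exact abs_add_le _ _
  have e : bondEnergy α x y - bondEnergy α x' y' = (Real.cos (x + y) - Real.cos (x' + y'))
      - α / 2 * ((Real.cos x - Real.cos x') + (Real.cos y - Real.cos y')) := by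
    unfold bondEnergy; ring
  rw [e]
  refine (abs_sub _ _).trans ?_
  rw [abs_mul, abs_of_nonneg (by linarith [hα.1] : 0 ≤ α / 2)]
  have h5 := abs_add_le (Real.cos x - Real.cos x') (Real.cos y - Real.cos y')
  have h6 : α / 2 * |(Real.cos x - Real.cos x') + (Real.cos y - Real.cos y')|
      ≤ 2 * (|x - x'| + |y - y'|) := by
    apply mul_le_mul (by linarith [hα.2]) (by linarith) (abs_nonneg _) (by norm_num)
  linarith

lemma abs_bondEnergy_sub_param_le {α β : ℝ} (hα : α ∈ Ico (0 : ℝ) 4) (hβ : β ∈ Ico (0 : ℝ) 4)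
    (x y : ℝ) : |bondEnergy α x y - bondEnergy β x y| ≤ 2 * |α - β| := by
  have e : bondEnergy α x y - bondEnergy β x y
      = (α - β) * ((α + β) / 8 - (Real.cos x + Real.cos y) / 2) := by
    unfold bondEnergy; rw [mMin_eq hα.2.le, mMin_eq hβ.2.le]; ring
  rw [e, abs_mul, mul_comm]
  apply mul_le_mul_of_nonneg_right _ (abs_nonneg _)
  rw [abs_le]
  constructor <;> linarith [hα.1, hα.2, hβ.1, hβ.2, Real.cos_le_one x, Real.cos_le_one y,
    Real.neg_one_le_cos x, Real.neg_one_le_cos y]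

lemma exists_thetaMin_near (β : ℝ) {ε : ℝ} (hε : 0 < ε) :
    ∃ η > 0, ∀ α, |α - β| < η → |thetaMin α - thetaMin β| ≤ ε := by
  have hc : Continuous thetaMin := by
    unfold thetaMin
    exact Real.continuous_arccos.comp (continuous_id.div_const 4)
  obtain ⟨η, hη, h⟩ := Metric.continuous_iff.1 hc β ε hε
  exact ⟨η, hη, fun α hα => by simpa [Real.dist_eq] using (h α (by simpa [Real.dist_eq] using hα)).le⟩

lemma latticeEnergy_eq_sum (n : ℕ) (α : ℝ) (φ : ℕ → ℝ) :
    latticeEnergy n α φ = ∑ i ∈ Finset.range n, bondEnergy α (φ i) (φ (i + 1)) := by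
  unfold latticeEnergy bondEnergy
  rw [Finset.sum_sub_distrib, Finset.sum_sub_distrib, ← Finset.mul_sum]
  simp
  ring

/-! ### The crease transition energy -/

/-- The competitors in the definition of `creaseEnergy`. -/
def IsCrease (α : ℝ) (N : ℕ) (θ : ℤ → ℝ) : Prop :=
  (∀ i, θ i ∈ Icc (-(Real.pi / 2)) (Real.pi / 2)) ∧
    ∀ i : ℤ, (N : ℤ) ≤ |i| → θ i = if 0 < i then thetaMin α else -thetaMin α

lemma IsCrease.eq_pos {α : ℝ} {N : ℕ} {θ : ℤ → ℝ} (h : IsCrease α N θ) {i : ℤ} (hi : (N : ℤ) ≤ i)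
    (h0 : 0 < i) : θ i = thetaMin α := by
  rw [h.2 i (hi.trans (le_abs_self i)), if_pos h0]

lemma IsCrease.eq_neg {α : ℝ} {N : ℕ} {θ : ℤ → ℝ} (h : IsCrease α N θ) {i : ℤ} (hi : i ≤ -(N : ℤ)) :
    θ i = -thetaMin α := by
  have : ¬ (0 < i) := by omega
  rw [h.2 i ((by omega : (N : ℤ) ≤ -i).trans (neg_le_abs i)), if_neg this]

/-- The bonds carrying energy lie in `[-N - 1, N]`; bond `0` need not vanish even for `N = 0`. -/
lemma IsCrease.bond_eq_zero {α : ℝ} (hα : α ∈ Ico (0 : ℝ) 4) {N : ℕ} {θ : ℤ → ℝ}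
    (h : IsCrease α N θ) {i : ℤ} (hi : i ∉ Finset.Ico (-(N : ℤ) - 1) (N + 1)) :
    bondEnergy α (θ i) (θ (i + 1)) = 0 := by
  rw [Finset.mem_Ico, not_and_or, not_le, not_lt] at hi
  rcases hi with hi | hi
  · rw [h.eq_neg (by omega), h.eq_neg (by omega), bondEnergy_neg_thetaMin hα]
  · rw [h.eq_pos (by omega) (by omega), h.eq_pos (by omega) (by omega), bondEnergy_thetaMin hα]

lemma IsCrease.tsum_eq {α : ℝ} (hα : α ∈ Ico (0 : ℝ) 4) {N : ℕ} {θ : ℤ → ℝ} (h : IsCrease α N θ) :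
    ∑' i : ℤ, bondEnergy α (θ i) (θ (i + 1))
      = ∑ i ∈ Finset.Ico (-(N : ℤ) - 1) (N + 1), bondEnergy α (θ i) (θ (i + 1)) :=
  tsum_eq_sum fun _ hi => h.bond_eq_zero hα hi

lemma IsCrease.summable {α : ℝ} (hα : α ∈ Ico (0 : ℝ) 4) {N : ℕ} {θ : ℤ → ℝ} (h : IsCrease α N θ) :
    Summable fun i : ℤ => bondEnergy α (θ i) (θ (i + 1)) :=
  summable_of_ne_finset_zero fun _ hi => h.bond_eq_zero hα hi

/-- Finitely many consecutive bonds have at most the total energy. -/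
lemma IsCrease.sum_range_le {α : ℝ} (hα : α ∈ Ico (0 : ℝ) 4) {N : ℕ} {θ : ℤ → ℝ}
    (h : IsCrease α N θ) (L : ℕ) (k : ℤ) :
    ∑ l ∈ Finset.range L, bondEnergy α (θ (l + k)) (θ (l + 1 + k))
      ≤ ∑' i : ℤ, bondEnergy α (θ i) (θ (i + 1)) := by
  have hinj : Function.Injective fun l : ℕ => (l : ℤ) + k := fun a b hab => by
    simpa using hab
  have e : ∑ l ∈ Finset.range L, bondEnergy α (θ (l + k)) (θ (l + 1 + k))
      = ∑ i ∈ (Finset.range L).map ⟨_, hinj⟩, bondEnergy α (θ i) (θ (i + 1)) := by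
    rw [Finset.sum_map]
    refine Finset.sum_congr rfl fun l _ => ?_
    simp only [Function.Embedding.coeFn_mk]
    rw [add_right_comm]
  rw [e]
  exact (h.summable hα).sum_le_tsum _ fun i _ => bondEnergy_nonneg hα.2.le _ _

lemma creaseEnergy_le {α : ℝ} (hα : α ∈ Ico (0 : ℝ) 4) {N : ℕ} {θ : ℤ → ℝ} (h : IsCrease α N θ) :
    creaseEnergy α ≤ ∑' i : ℤ, bondEnergy α (θ i) (θ (i + 1)) := by
  refine csInf_le ⟨0, ?_⟩ ⟨N, θ, h.1, h.2, rfl⟩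
  rintro s ⟨N, θ, -, -, rfl⟩
  exact tsum_nonneg fun i => bondEnergy_nonneg hα.2.le _ _

lemma exists_isCrease {α : ℝ} (hα : α ∈ Ico (0 : ℝ) 4) {c : ℝ} (hc : creaseEnergy α < c) :
    ∃ N θ, IsCrease α N θ ∧ ∑' i : ℤ, bondEnergy α (θ i) (θ (i + 1)) < c := by
  have hne : {s : ℝ | ∃ (N : ℕ) (θ : ℤ → ℝ),
      (∀ i, θ i ∈ Icc (-(Real.pi / 2)) (Real.pi / 2)) ∧
      (∀ i : ℤ, (N : ℤ) ≤ |i| → θ i = if 0 < i then thetaMin α else -thetaMin α) ∧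
      s = ∑' i : ℤ, bondEnergy α (θ i) (θ (i + 1))}.Nonempty := by
    refine ⟨_, 0, fun i => if 0 < i then thetaMin α else -thetaMin α, fun i => ?_,
      fun i _ => rfl, rfl⟩
    dsimp only
    split_ifs
    · exact thetaMin_mem hα
    · exact neg_mem_angles (thetaMin_mem hα)
  obtain ⟨s, ⟨N, θ, h1, h2, rfl⟩, hlt⟩ := exists_lt_of_csInf_lt hne hc
  exact ⟨N, θ, ⟨h1, h2⟩, hlt⟩

/-- A finite chain, completed by the two wells at its ends, is a competitor. -/
lemma creaseEnergy_le_chain {α : ℝ} (hα : α ∈ Ico (0 : ℝ) 4) (L : ℕ) (ψ : ℕ → ℝ)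
    (hψ : ∀ l ≤ L, ψ l ∈ Icc (-(Real.pi / 2)) (Real.pi / 2)) :
    creaseEnergy α ≤ bondEnergy α (-thetaMin α) (ψ 0)
      + ∑ l ∈ Finset.range L, bondEnergy α (ψ l) (ψ (l + 1)) + bondEnergy α (ψ L) (thetaMin α) := by
  set ζ : ℤ → ℝ := fun i => if i < 0 then -thetaMin α else
    if i ≤ L then ψ i.toNat else thetaMin α with hζ
  have hneg : ∀ i : ℤ, i < 0 → ζ i = -thetaMin α := fun i hi => if_pos hi
  have hbig : ∀ i : ℤ, (L : ℤ) < i → ζ i = thetaMin α := fun i hi => by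
    simp only [hζ]; rw [if_neg (by omega), if_neg (by omega)]
  have hmid : ∀ l : ℕ, l ≤ L → ζ l = ψ l := fun l hl => by
    simp only [hζ]; rw [if_neg (by omega), if_pos (by omega)]; simp
  have hcr : IsCrease α (L + 1) ζ := by
    refine ⟨fun i => ?_, fun i hi => ?_⟩
    · rcases lt_or_ge i 0 with h | h
      · rw [hneg i h]; exact neg_mem_angles (thetaMin_mem hα)
      · lift i to ℕ using h
        rcases le_or_gt i L with h' | h'
        · rw [hmid i h']; exact hψ i h'
        · rw [hbig i (by omega)]; exact thetaMin_mem hα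
    · rcases lt_or_ge 0 i with h | h
      · rw [if_pos h]
        rw [abs_of_pos h] at hi
        exact hbig i (by push_cast at hi; omega)
      · rw [if_neg (by omega)]
        rw [abs_of_nonpos h] at hi
        exact hneg i (by push_cast at hi; omega)
  refine (creaseEnergy_le hα hcr).trans ?_
  have hinj : Function.Injective fun l : ℕ => (l : ℤ) - 1 := fun a b hab => by
    simpa using hab
  have e : ∑' i : ℤ, bondEnergy α (ζ i) (ζ (i + 1))
      = ∑ i ∈ (Finset.range (L + 2)).map ⟨_, hinj⟩, bondEnergy α (ζ i) (ζ (i + 1)) := by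
    refine tsum_eq_sum fun i hi => ?_
    have hi' : i < -1 ∨ (L : ℤ) < i := by
      by_contra hcon
      push Not at hcon
      refine hi (Finset.mem_map.2 ⟨(i + 1).toNat, Finset.mem_range.2 (by omega), ?_⟩)
      simp only [Function.Embedding.coeFn_mk]
      omega
    rcases hi' with h | h
    · rw [hneg i (by omega), hneg (i + 1) (by omega), bondEnergy_neg_thetaMin hα]
    · rw [hbig i (by omega), hbig (i + 1) (by omega), bondEnergy_thetaMin hα]
  rw [e, Finset.sum_map, Finset.sum_range_succ']
  simp only [Function.Embedding.coeFn_mk, Nat.cast_zero, zero_sub, Nat.cast_add, Nat.cast_one,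
    add_sub_cancel_right, neg_add_cancel]
  rw [Finset.sum_range_succ, hneg (-1) (by norm_num), hmid L le_rfl, hbig (L + 1) (by omega)]
  have h0 := hmid 0 (Nat.zero_le _)
  rw [Nat.cast_zero] at h0
  rw [h0]
  have : ∑ x ∈ Finset.range L, bondEnergy α (ζ x) (ζ (x + 1))
      = ∑ l ∈ Finset.range L, bondEnergy α (ψ l) (ψ (l + 1)) := by
    refine Finset.sum_congr rfl fun l hl => ?_
    have hl' := Finset.mem_range.1 hl
    rw [hmid l hl'.le]
    have := hmid (l + 1) hl'
    push_cast at this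
    rw [this]
  rw [this]
  linarith

/-- An angle at distance at least `δ` from both wells costs a fixed amount of energy. -/
lemma exists_pos_le_bondEnergy_of_far {β : ℝ} (hβ : β ∈ Ico (0 : ℝ) 4) {δ : ℝ} (hδ : 0 < δ) :
    ∃ c > 0, ∀ x ∈ Icc (-(Real.pi / 2)) (Real.pi / 2), ∀ y ∈ Icc (-(Real.pi / 2)) (Real.pi / 2),
      δ ≤ |x - thetaMin β| → δ ≤ |x + thetaMin β| → c ≤ bondEnergy β x y := by
  have hcl : IsClosed {q : ℝ × ℝ | δ ≤ |q.1 - thetaMin β| ∧ δ ≤ |q.1 + thetaMin β|} := by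
    have c1 : Continuous fun q : ℝ × ℝ => |q.1 - thetaMin β| := by fun_prop
    have c2 : Continuous fun q : ℝ × ℝ => |q.1 + thetaMin β| := by fun_prop
    exact (isClosed_le continuous_const c1).inter (isClosed_le continuous_const c2)
  obtain ⟨c, hc, h⟩ := exists_pos_le_bondEnergy hβ hcl
    (fun h => by have h1 := h.1; simp only [sub_self, abs_zero] at h1; linarith)
    (fun h => by have h1 := h.2; simp only [neg_add_cancel, abs_zero] at h1; linarith)
  exact ⟨c, hc, fun x hx y hy h1 h2 => h x hx y hy ⟨h1, h2⟩⟩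

/-- Every competitor contains a bond whose angles have opposite signs, and such a bond has energy
bounded below. -/
lemma creaseEnergy_pos {β : ℝ} (hβ : β ∈ Ico (0 : ℝ) 4) : 0 < creaseEnergy β := by
  have hth := thetaMin_pos hβ.2
  obtain ⟨c, hc, h⟩ := exists_pos_le_bondEnergy hβ (K := {q : ℝ × ℝ | q.1 ≤ 0 ∧ 0 ≤ q.2})
    ((isClosed_le continuous_fst continuous_const).inter
      (isClosed_le continuous_const continuous_snd))
    (fun h => by have h1 : thetaMin β ≤ 0 := h.1; linarith)
    (fun h => by have h1 : 0 ≤ -thetaMin β := h.2; linarith)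
  by_contra hcon
  obtain ⟨N, θ, hθ, hlt⟩ := exists_isCrease hβ (lt_of_le_of_lt (not_lt.1 hcon) hc)
  have hex : ∃ l : ℕ, 0 ≤ θ (l + 1 + (-(N : ℤ) - 1)) := by
    refine ⟨2 * N + 2, ?_⟩
    rw [hθ.eq_pos (by push_cast; omega) (by push_cast; omega)]
    exact hth.le
  classical
  obtain ⟨l, hl, hmin⟩ : ∃ l : ℕ, 0 ≤ θ (l + 1 + (-(N : ℤ) - 1)) ∧ θ (l + (-(N : ℤ) - 1)) ≤ 0 := by
    refine ⟨Nat.find hex, Nat.find_spec hex, ?_⟩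
    rcases Nat.eq_zero_or_pos (Nat.find hex) with h0 | h0
    · rw [h0, hθ.eq_neg (by push_cast; omega)]
      linarith
    · obtain ⟨k, hk⟩ := Nat.exists_eq_succ_of_ne_zero h0.ne'
      have := Nat.find_min hex (m := k) (by omega)
      rw [hk]
      push_cast
      exact (not_le.1 this).le
  have h1 := h _ (hθ.1 _) _ (hθ.1 _) ⟨hmin, hl⟩
  have h2 := (hθ.summable hβ).sum_le_tsum {(l : ℤ) + (-(N : ℤ) - 1)}
    fun i _ => bondEnergy_nonneg hβ.2.le _ _
  rw [Finset.sum_singleton, add_right_comm] at h2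
  linarith

/-- Lower bound for one transition, uniform in the parameter near `β`: a chain from near `-θ_β` to
near `θ_β` costs at least `C_β - ε`. If an interior angle is near one of the wells, the chain is
cut there; otherwise every interior bond has a fixed energy, so either the chain is expensive, or
it is so short that the parameter may be replaced by `β`. -/
lemma exists_creaseEnergy_sub_le_sum {β : ℝ} (hβ : β ∈ Ico (0 : ℝ) 4) {ε : ℝ} (hε : 0 < ε) :
    ∃ δ > 0, ∃ η > 0, ∀ α ∈ Ico (0 : ℝ) 4, |α - β| < η → ∀ (L : ℕ) (ψ : ℕ → ℝ),
      (∀ l ≤ L, ψ l ∈ Icc (-(Real.pi / 2)) (Real.pi / 2)) →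
      |ψ 0 + thetaMin β| ≤ δ → |ψ L - thetaMin β| ≤ δ →
      creaseEnergy β - ε ≤ ∑ l ∈ Finset.range L, bondEnergy α (ψ l) (ψ (l + 1)) := by
  set δ : ℝ := ε / 12 with hδdef
  have hδ : 0 < δ := by positivity
  obtain ⟨c, hc, hfar⟩ := exists_pos_le_bondEnergy_of_far hβ hδ
  obtain ⟨K, hK⟩ := exists_nat_ge (creaseEnergy β / (c / 2))
  rw [div_le_iff₀ (by positivity)] at hK
  set η : ℝ := min (c / 4) (ε / (4 * (K + 1))) with hηdef
  have hη : 0 < η := lt_min (by positivity) (by positivity)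
  refine ⟨δ, hδ, η, hη, fun α hα hαβ L => ?_⟩
  have hη1 : |α - β| ≤ c / 4 := hαβ.le.trans (min_le_left _ _)
  have hη2 : |α - β| * (4 * (K + 1)) ≤ ε := by
    have := hαβ.le.trans (min_le_right _ _)
    rwa [le_div_iff₀ (by positivity)] at this
  induction L using Nat.strong_induction_on with
  | _ L ih =>
    intro ψ hψ h0 hL
    have hnn : ∀ l, 0 ≤ bondEnergy α (ψ l) (ψ (l + 1)) := fun l => bondEnergy_nonneg hα.2.le _ _
    by_cases hneg : ∃ l, 0 < l ∧ l < L ∧ |ψ l + thetaMin β| ≤ δ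
    · obtain ⟨l, hl0, hlL, hl⟩ := hneg
      have := ih (L - l) (by omega) (fun k => ψ (l + k)) (fun k hk => hψ _ (by omega))
        (by simpa using hl) (by rwa [Nat.add_sub_cancel' hlL.le])
      refine this.trans ?_
      obtain ⟨d, rfl⟩ := Nat.exists_eq_add_of_le hlL.le
      rw [Finset.sum_range_add, Nat.add_sub_cancel_left]
      simp only [← add_assoc]
      exact le_add_of_nonneg_left (Finset.sum_nonneg fun i _ => hnn i)
    by_cases hpos : ∃ l, 0 < l ∧ l < L ∧ |ψ l - thetaMin β| ≤ δ
    · obtain ⟨l, hl0, hlL, hl⟩ := hpos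
      refine (ih l hlL ψ (fun k hk => hψ _ (by omega)) h0 hl).trans ?_
      exact Finset.sum_le_sum_of_subset_of_nonneg (Finset.range_subset_range.2 hlL.le)
        fun i _ _ => hnn i
    push Not at hneg hpos
    have hcmp : ∀ l, bondEnergy β (ψ l) (ψ (l + 1)) - 2 * |α - β|
        ≤ bondEnergy α (ψ l) (ψ (l + 1)) := fun l => by
      have := (abs_le.1 (abs_bondEnergy_sub_param_le hα hβ (ψ l) (ψ (l + 1)))).1
      linarith
    rcases le_or_gt L K with hLK | hLK
    · have h1 := creaseEnergy_le_chain hβ L ψ hψ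
      have h2 := (abs_le.1 (abs_bondEnergy_sub_le hβ (-thetaMin β) (ψ 0) (-thetaMin β)
        (-thetaMin β))).2
      have h3 := (abs_le.1 (abs_bondEnergy_sub_le hβ (ψ L) (thetaMin β) (thetaMin β)
        (thetaMin β))).2
      rw [bondEnergy_neg_thetaMin hβ] at h2
      rw [bondEnergy_thetaMin hβ] at h3
      simp only [sub_self, abs_zero, sub_neg_eq_add, zero_add, add_zero] at h2 h3
      have h4 := Finset.sum_le_sum fun l (_ : l ∈ Finset.range L) => hcmp l
      rw [Finset.sum_sub_distrib, Finset.sum_const, Finset.card_range, nsmul_eq_mul] at h4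
      have h5 : (L : ℝ) * (2 * |α - β|) ≤ ε / 2 := by
        have : (L : ℝ) ≤ K := by exact_mod_cast hLK
        nlinarith [abs_nonneg (α - β)]
      linarith
    · obtain ⟨M, rfl⟩ : ∃ M, L = M + 1 := ⟨L - 1, by omega⟩
      rw [Finset.sum_range_succ']
      have h1 : ∀ l ∈ Finset.range M, c / 2 ≤ bondEnergy α (ψ (l + 1)) (ψ (l + 1 + 1)) :=
        fun l hl => by
          have hl' := Finset.mem_range.1 hl
          have := hfar _ (hψ (l + 1) (by omega)) _ (hψ (l + 1 + 1) (by omega))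
            (hpos (l + 1) (by omega) (by omega)).le (hneg (l + 1) (by omega) (by omega)).le
          linarith [hcmp (l + 1)]
      have h2 := Finset.sum_le_sum h1
      rw [Finset.sum_const, Finset.card_range, nsmul_eq_mul] at h2
      have h3 : (K : ℝ) * (c / 2) ≤ M * (c / 2) := by
        have : (K : ℝ) ≤ M := by exact_mod_cast (by omega : K ≤ M)
        gcongr
      linarith [hnn 0]

/-- Replacing the ends of a competitor for `β` gives competitors for all nearby parameters, with
the same `N` and almost the same energy. -/
lemma exists_isCrease_near {β : ℝ} (hβ : β ∈ Ico (0 : ℝ) 4) {ε : ℝ} (hε : 0 < ε) :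
    ∃ N : ℕ, ∃ η > 0, ∀ α ∈ Ico (0 : ℝ) 4, |α - β| < η → ∃ ζ, IsCrease α N ζ ∧
      ∑' i : ℤ, bondEnergy α (ζ i) (ζ (i + 1)) ≤ creaseEnergy β + ε := by
  obtain ⟨N, θ, hθ, hlt⟩ := exists_isCrease hβ (lt_add_of_pos_right (creaseEnergy β) (half_pos hε))
  set D : ℝ := 2 * N + 2 with hD
  have hD0 : 0 < D := by positivity
  obtain ⟨η, hη, hth⟩ := exists_thetaMin_near β (ε := ε / (24 * D)) (by positivity)
  refine ⟨N, min η (ε / (8 * D)), lt_min hη (by positivity), fun α hα hαβ => ?_⟩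
  have h1 := hth α (hαβ.trans_le (min_le_left _ _))
  have h2 : |α - β| ≤ ε / (8 * D) := hαβ.le.trans (min_le_right _ _)
  rw [le_div_iff₀ (by positivity)] at h1 h2
  set ζ : ℤ → ℝ := fun i => if (N : ℤ) ≤ |i| then
    (if 0 < i then thetaMin α else -thetaMin α) else θ i with hζ
  have hcr : IsCrease α N ζ := by
    refine ⟨fun i => ?_, fun i hi => if_pos hi⟩
    simp only [hζ]
    split_ifs
    · exact thetaMin_mem hα
    · exact neg_mem_angles (thetaMin_mem hα)
    · exact hθ.1 i
  have hclose : ∀ i, |ζ i - θ i| ≤ |thetaMin α - thetaMin β| := fun i => by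
    simp only [hζ]
    split_ifs with ha hb
    · rw [hθ.2 i ha, if_pos hb]
    · rw [hθ.2 i ha, if_neg hb, ← abs_neg]; apply le_of_eq; congr 1; ring
    · simp
  refine ⟨ζ, hcr, ?_⟩
  rw [hcr.tsum_eq hα]
  rw [hθ.tsum_eq hβ] at hlt
  have hbd : ∀ i ∈ Finset.Ico (-(N : ℤ) - 1) (N + 1), bondEnergy α (ζ i) (ζ (i + 1))
      ≤ bondEnergy β (θ i) (θ (i + 1)) + (6 * |thetaMin α - thetaMin β| + 2 * |α - β|) :=
    fun i _ => by
      have e1 := (abs_le.1 (abs_bondEnergy_sub_le hα (ζ i) (ζ (i + 1)) (θ i) (θ (i + 1)))).2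
      have e2 := (abs_le.1 (abs_bondEnergy_sub_param_le hα hβ (θ i) (θ (i + 1)))).2
      linarith [hclose i, hclose (i + 1)]
  have h3 := Finset.sum_le_sum hbd
  rw [Finset.sum_add_distrib, Finset.sum_const, nsmul_eq_mul, Int.card_Ico] at h3
  have h4 : (((N : ℤ) + 1 - (-(N : ℤ) - 1)).toNat : ℝ) = D := by
    rw [show ((N : ℤ) + 1 - (-(N : ℤ) - 1)) = ((2 * N + 2 : ℕ) : ℤ) by push_cast; ring]
    rw [Int.toNat_natCast, hD]; push_cast; ring
  rw [h4] at h3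
  nlinarith

/-- The crease transition energy is continuous on `[0, 4)`. -/
lemma exists_creaseEnergy_near {β : ℝ} (hβ : β ∈ Ico (0 : ℝ) 4) {ε : ℝ} (hε : 0 < ε) :
    ∃ η > 0, ∀ α ∈ Ico (0 : ℝ) 4, |α - β| < η → |creaseEnergy α - creaseEnergy β| ≤ ε := by
  obtain ⟨δ, hδ, η₁, hη₁, hlow⟩ := exists_creaseEnergy_sub_le_sum hβ hε
  obtain ⟨N, η₂, hη₂, hup⟩ := exists_isCrease_near hβ hε
  obtain ⟨η₃, hη₃, hth⟩ := exists_thetaMin_near β hδ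
  refine ⟨min η₁ (min η₂ η₃), lt_min hη₁ (lt_min hη₂ hη₃), fun α hα hαβ => ?_⟩
  rw [lt_min_iff, lt_min_iff] at hαβ
  rw [abs_le]
  constructor
  · suffices h : creaseEnergy β - ε ≤ creaseEnergy α by linarith
    refine le_of_forall_gt_imp_ge_of_dense fun c hc => ?_
    obtain ⟨M, θ, hθ, hlt⟩ := exists_isCrease hα hc
    have hth' := hth α hαβ.2.2
    have h := hlow α hα hαβ.1 (2 * M + 2) (fun l => θ (l + (-(M : ℤ) - 1))) (fun l _ => hθ.1 _)
      (by
        rw [hθ.eq_neg (by push_cast; omega), ← abs_neg]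
        convert hth' using 2; ring)
      (by
        rw [hθ.eq_pos (by push_cast; omega) (by push_cast; omega)]
        exact hth')
    have h' := hθ.sum_range_le hα (2 * M + 2) (-(M : ℤ) - 1)
    push_cast at h
    linarith
  · obtain ⟨ζ, hζ, hle⟩ := hup α hα hαβ.2.1
    linarith [creaseEnergy_le hα hζ]

/-! ### Counting sign changes -/

/-- The function which jumps between `s` and `-s` at the points `p 0, …, p (m - 1)`, and equals `s`
to their left. It does not depend on the order of the points. -/
noncomputable def stepFn (s : ℝ) (m : ℕ) (p : ℕ → ℝ) (t : ℝ) : ℝ :=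
  s * ∏ j ∈ Finset.range m, if t < p j then 1 else -1

/-- `t` is the last point of an alternating chain `t₀ < ⋯ < t_j = t` in `A`, along which `s` takes
the values `σ, -σ, σ, …`. -/
def Alternates (A : Set ℝ) (s : ℝ → ℝ) (σ : ℝ) : ℕ → ℝ → Prop
  | 0, t => t ∈ A ∧ s t = σ
  | j + 1, t => t ∈ A ∧ s t = σ * (-1) ^ (j + 1) ∧ ∃ t' < t, Alternates A s σ j t'

namespace Alternates

variable {A : Set ℝ} {s : ℝ → ℝ} {σ : ℝ}

lemma mem : ∀ {j : ℕ} {t : ℝ}, Alternates A s σ j t → t ∈ A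
  | 0, _, h => h.1
  | _ + 1, _, h => h.1

lemma sign_eq : ∀ {j : ℕ} {t : ℝ}, Alternates A s σ j t → s t = σ * (-1) ^ j
  | 0, _, h => by simpa using h.2
  | _ + 1, _, h => h.2.1

lemma exists_le {i j : ℕ} (hij : i ≤ j) {t : ℝ} (h : Alternates A s σ j t) :
    ∃ t' ≤ t, Alternates A s σ i t' := by
  induction j generalizing t with
  | zero => obtain rfl : i = 0 := by omega
            exact ⟨t, le_rfl, h⟩
  | succ j ih =>
    rcases Nat.lt_or_ge j i with h' | h'
    · obtain rfl : i = j + 1 := by omega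
      exact ⟨t, le_rfl, h⟩
    · obtain ⟨t', ht', h1⟩ := h.2.2
      obtain ⟨t'', ht'', h2⟩ := ih h' h1
      exact ⟨t'', ht''.trans ht'.le, h2⟩

/-- Every sign change along the chain contributes at least `c` to the increase of `F`. -/
lemma exists_mul_le {F : ℝ → ℝ} {c : ℝ} (hσ : σ ≠ 0)
    (hF : ∀ a ∈ A, ∀ b ∈ A, a < b → s a ≠ s b → c ≤ F b - F a)
    {j : ℕ} {t : ℝ} (h : Alternates A s σ j t) :
    ∃ a ∈ A, a ≤ t ∧ s a = σ ∧ j * c ≤ F t - F a := by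
  induction j generalizing t with
  | zero => exact ⟨t, h.1, le_rfl, h.2, by simp⟩
  | succ j ih =>
    obtain ⟨t', ht', h1⟩ := h.2.2
    obtain ⟨a, ha, hat, hs, hc⟩ := ih h1
    refine ⟨a, ha, hat.trans ht'.le, hs, ?_⟩
    have hne : s t' ≠ s t := by
      rw [h1.sign_eq, h.sign_eq, pow_succ, ← mul_assoc]
      have : σ * (-1) ^ j ≠ 0 := mul_ne_zero hσ (by simp)
      intro hcon
      apply this
      linarith
    have := hF t' h1.mem t h.mem ht' hne
    push_cast
    linarith

/-- A point of the opposite sign before all points of sign `σ` can be put in front of the chain. -/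
lemma cons {t₀ : ℝ} (h₀ : t₀ ∈ A) (hs : s t₀ = -σ) (hno : ∀ t ≤ t₀, ¬ Alternates A s σ 0 t)
    {j : ℕ} {t : ℝ} (h : Alternates A s σ j t) : Alternates A s (-σ) (j + 1) t := by
  induction j generalizing t with
  | zero => exact ⟨h.1, by simpa using h.2, t₀, not_le.1 fun hle => hno t hle h, h₀, hs⟩
  | succ j ih =>
    obtain ⟨t', ht', h1⟩ := h.2.2
    exact ⟨h.1, by rw [h.2.1, pow_succ _ (j + 1)]; ring, t', ht', ih h1⟩

end Alternates

lemma prod_range_ite_le {j m : ℕ} (hjm : j ≤ m) :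
    ∏ i ∈ Finset.range m, (if j ≤ i then (1 : ℝ) else -1) = (-1) ^ j := by
  obtain ⟨d, rfl⟩ := Nat.exists_eq_add_of_le hjm
  rw [Finset.prod_range_add]
  have h1 : ∏ i ∈ Finset.range j, (if j ≤ i then (1 : ℝ) else -1) = (-1) ^ j := by
    rw [Finset.prod_congr rfl fun i hi => if_neg (not_le.2 (Finset.mem_range.1 hi))]
    simp
  rw [h1]
  simp

lemma exists_and_not_succ {P : ℕ → Prop} (h0 : P 0) (h : ∃ n, ¬ P n) : ∃ n, P n ∧ ¬ P (n + 1) := by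
  by_contra! hcon
  obtain ⟨n, hn⟩ := h
  exact hn (Nat.rec h0 (fun k hk => hcon k hk) n)

/-- If every sign change of `s` on `A` costs at least `c`, then `s` agrees on `A` with a step
function, up to its jump points, the number `m` of which is controlled by the increase of `F`.
The `j`-th jump point is the infimum of the last points of alternating chains with `j` changes,
where the sign of the first point is chosen so that the longest chains start with it. -/
theorem exists_stepFn_eq {A : Set ℝ} (hA : A ⊆ Ioo 0 1) (hne : A.Nonempty) {s : ℝ → ℝ}
    (hs : ∀ t ∈ A, s t = 1 ∨ s t = -1) {F : ℝ → ℝ} {c E : ℝ} (hc : 0 < c)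
    (hF : ∀ a ∈ A, ∀ b ∈ A, a < b → s a ≠ s b → c ≤ F b - F a)
    (hE : ∀ a ∈ A, ∀ b ∈ A, a ≤ b → F b - F a ≤ E) :
    ∃ (m : ℕ) (σ : ℝ) (p : ℕ → ℝ), (σ = 1 ∨ σ = -1) ∧ (∀ j < m, p j ∈ Icc (0 : ℝ) 1) ∧
      (∀ i j, i ≤ j → j < m → p i ≤ p j) ∧
      (∀ t ∈ A, (∀ j < m, t ≠ p j) → s t = stepFn σ m p t) ∧
      ∃ a ∈ A, ∃ b ∈ A, a ≤ b ∧ s b = s a * (-1) ^ m ∧ m * c ≤ F b - F a := by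
  have hne0 : ∀ {σ : ℝ}, σ = 1 ∨ σ = -1 → σ ≠ 0 := by rintro σ (rfl | rfl) <;> norm_num
  obtain ⟨m, ⟨σ, T, hσ, hT⟩, hmax⟩ := exists_and_not_succ
    (P := fun m => ∃ σ t, (σ = 1 ∨ σ = -1) ∧ Alternates A s σ m t)
    (by obtain ⟨t, ht⟩ := hne; exact ⟨s t, t, hs t ht, ht, rfl⟩)
    (by
      obtain ⟨n, hn⟩ := exists_nat_gt (E / c)
      refine ⟨n, ?_⟩
      rintro ⟨σ, t, hσ, ht⟩
      obtain ⟨a, ha, hat, -, h⟩ := ht.exists_mul_le (hne0 hσ) hF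
      rw [div_lt_iff₀ hc] at hn
      linarith [hE a ha t ht.mem hat])
  set p : ℕ → ℝ := fun j => sInf {t | Alternates A s σ (j + 1) t} with hp
  have hbdd : ∀ j, BddBelow {t | Alternates A s σ (j + 1) t} :=
    fun j => ⟨0, fun t ht => (hA (Alternates.mem ht)).1.le⟩
  have hnonempty : ∀ j < m, {t | Alternates A s σ (j + 1) t}.Nonempty := fun j hj => by
    obtain ⟨t, -, ht⟩ := hT.exists_le (show j + 1 ≤ m by omega)
    exact ⟨t, ht⟩
  have hp_le : ∀ {j t}, Alternates A s σ (j + 1) t → p j ≤ t := fun ht => csInf_le (hbdd _) ht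
  have hstart : ∀ t ∈ A, ∃ t' ≤ t, Alternates A s σ 0 t' := by
    intro t ht
    by_contra! hcon
    have h1 : s t = -σ := by
      have h2 : s t ≠ σ := fun h => hcon t le_rfl ⟨ht, h⟩
      rcases hs t ht with h | h <;> rcases hσ with h' | h' <;> rw [h, h'] at h2 ⊢ <;>
        first | exact (h2 rfl).elim | norm_num
    refine hmax ⟨-σ, T, ?_, hT.cons ht h1 hcon⟩
    rcases hσ with rfl | rfl <;> norm_num
  obtain ⟨a, ha, haT, hsa, hca⟩ := hT.exists_mul_le (hne0 hσ) hF
  refine ⟨m, σ, p, hσ, fun j hj => ?_, fun i j hij hj => ?_, fun t ht htp => ?_,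
    a, ha, T, hT.mem, haT, by rw [hT.sign_eq, hsa], hca⟩
  · obtain ⟨t, ht⟩ := hnonempty j hj
    exact ⟨le_csInf (hnonempty j hj) fun t ht => (hA (Alternates.mem ht)).1.le,
      (hp_le ht).trans (hA (Alternates.mem ht)).2.le⟩
  · refine le_csInf (hnonempty j hj) fun t ht => ?_
    obtain ⟨t', ht', h'⟩ := Alternates.exists_le (show i + 1 ≤ j + 1 by omega) ht
    exact (hp_le h').trans ht'
  · have hdown : ∀ {i j}, i ≤ j → (∃ t' ≤ t, Alternates A s σ j t') →
        ∃ t' ≤ t, Alternates A s σ i t' := by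
      rintro i j hij ⟨t', ht', h'⟩
      obtain ⟨t'', ht'', h''⟩ := h'.exists_le hij
      exact ⟨t'', ht''.trans ht', h''⟩
    have hle : ∀ {j}, (∃ t' ≤ t, Alternates A s σ j t') → j ≤ m := by
      rintro j ⟨t', -, h'⟩
      by_contra hcon
      obtain ⟨t'', -, h''⟩ := h'.exists_le (show m + 1 ≤ j by omega)
      exact hmax ⟨σ, t'', hσ, h''⟩
    obtain ⟨j, hj, hj1⟩ := exists_and_not_succ (P := fun j => ∃ t' ≤ t, Alternates A s σ j t')
      (hstart t ht) ⟨m + 1, fun h => absurd (hle h) (by omega)⟩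
    have hjm := hle hj
    obtain ⟨t', ht', h'⟩ := hj
    have hst : s t = σ * (-1) ^ j := by
      by_contra hcon
      have hst' : s t = σ * (-1) ^ (j + 1) := by
        rw [pow_succ]
        rcases neg_one_pow_eq_or ℝ j with h1 | h1 <;> rw [h1] at hcon ⊢ <;>
        rcases hs t ht with h2 | h2 <;> rcases hσ with h3 | h3 <;> rw [h2, h3] at hcon ⊢ <;>
          first | (norm_num; done) | norm_num at hcon
      have hne' : t' ≠ t := fun h => hcon (by rw [← h]; exact h'.sign_eq)
      exact hj1 ⟨t, le_rfl, ht, hst', t', lt_of_le_of_ne ht' hne', h'⟩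
    rw [hst, stepFn, ← prod_range_ite_le hjm]
    congr 1
    refine Finset.prod_congr rfl fun i hi => ?_
    have him := Finset.mem_range.1 hi
    by_cases hji : j ≤ i
    · rw [if_pos hji, if_pos]
      refine lt_of_le_of_ne (le_csInf (hnonempty i him) fun t'' h'' => ?_) (htp i him)
      by_contra! hcon
      exact hj1 (hdown (by omega) ⟨t'', hcon.le, h''⟩)
    · rw [if_neg hji, if_neg]
      rw [not_lt]
      obtain ⟨t'', ht'', h''⟩ := h'.exists_le (show i + 1 ≤ j by omega)
      exact (hp_le h'').trans (ht''.trans ht')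

/-! ### Step functions in `L¹(I)` -/

lemma abs_stepFn {s : ℝ} (hs : s = 1 ∨ s = -1) (m : ℕ) (p : ℕ → ℝ) (t : ℝ) :
    |stepFn s m p t| = 1 := by
  have h1 : |s| = 1 := by rcases hs with rfl | rfl <;> simp
  rw [stepFn, abs_mul, h1, Finset.abs_prod, one_mul]
  exact Finset.prod_eq_one fun j _ => by split_ifs <;> simp

lemma measurable_stepFn (s : ℝ) (m : ℕ) (p : ℕ → ℝ) : Measurable (stepFn s m p) := by
  unfold stepFn
  refine (Finset.measurable_fun_prod _ fun j _ => ?_).const_mul s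
  exact Measurable.ite measurableSet_Iio measurable_const measurable_const

/-- The functions on `I` with values `± θ` and exactly `m` jumps. -/
def stepSet (θ : ℝ) (m : ℕ) : Set L1I :=
  {x | ∃ (s : ℝ) (p : ℕ → ℝ), (s = 1 ∨ s = -1) ∧ (∀ j < m, p j ∈ Ioo (0 : ℝ) 1) ∧
    (∀ i j, i < j → j < m → p i < p j) ∧ x =ᵐ[muI] fun t => θ * stepFn s m p t}

lemma integrable_muI_of_abs_le {f : ℝ → ℝ} (hf : AEStronglyMeasurable f muI) {C : ℝ}
    (hC : ∀ t ∈ Ioo (0 : ℝ) 1, |f t| ≤ C) : Integrable f muI :=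
  Integrable.of_bound hf C ((ae_restrict_iff' measurableSet_Ioo).2 (Eventually.of_forall hC))

lemma exists_mem_stepSet {θ s : ℝ} (hs : s = 1 ∨ s = -1) {m : ℕ} {p : ℕ → ℝ}
    (hp : ∀ j < m, p j ∈ Ioo (0 : ℝ) 1) (hp' : ∀ i j, i < j → j < m → p i < p j) :
    ∃ y ∈ stepSet θ m, y =ᵐ[muI] fun t => θ * stepFn s m p t := by
  have hint : Integrable (fun t => θ * stepFn s m p t) muI :=
    integrable_muI_of_abs_le ((measurable_stepFn s m p).const_mul θ).aestronglyMeasurable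
      (C := |θ|) fun t _ => by rw [abs_mul, abs_stepFn hs, mul_one]
  exact ⟨hint.toL1 _, ⟨s, p, hs, hp, hp', hint.coeFn_toL1⟩, hint.coeFn_toL1⟩

lemma dist_le_integral {u y : L1I} {f : ℝ → ℝ} (hf : Integrable f muI)
    (h : ∀ᵐ t ∂muI, |u t - y t| ≤ f t) : dist u y ≤ ∫ t, f t ∂muI := by
  rw [L1.dist_eq_integral_dist]
  refine integral_mono_ae ?_ hf ?_
  · simp only [Real.dist_eq]
    exact ((L1.integrable_coeFn u).sub (L1.integrable_coeFn y)).abs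
  · filter_upwards [h] with t ht
    rwa [Real.dist_eq]

lemma abs_prod_sub_prod_le {m : ℕ} {a b : ℕ → ℝ} (ha : ∀ j < m, |a j| ≤ 1)
    (hb : ∀ j < m, |b j| ≤ 1) :
    |∏ j ∈ Finset.range m, a j - ∏ j ∈ Finset.range m, b j|
      ≤ ∑ j ∈ Finset.range m, |a j - b j| := by
  induction m with
  | zero => simp
  | succ m ih =>
    rw [Finset.prod_range_succ, Finset.prod_range_succ, Finset.sum_range_succ]
    have h1 := ih (fun j hj => ha j (by omega)) (fun j hj => hb j (by omega))
    have h2 : |∏ j ∈ Finset.range m, b j| ≤ 1 := by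
      rw [Finset.abs_prod]
      exact Finset.prod_le_one (fun _ _ => abs_nonneg _)
        fun j hj => hb j (by have := Finset.mem_range.1 hj; omega)
    rw [show (∏ j ∈ Finset.range m, a j) * a m - (∏ j ∈ Finset.range m, b j) * b m
      = (∏ j ∈ Finset.range m, a j - ∏ j ∈ Finset.range m, b j) * a m
        + (∏ j ∈ Finset.range m, b j) * (a m - b m) by ring]
    refine (abs_add_le _ _).trans (add_le_add ?_ ?_)
    · rw [abs_mul]
      exact (mul_le_of_le_one_right (abs_nonneg _) (ha m (by omega))).trans h1
    · rw [abs_mul]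
      exact mul_le_of_le_one_left (abs_nonneg _) h2

/-- A function which differs from a step function by at most `e`, and by at most `e + D` at
distance at most `r` from the jumps, is close to it in `L¹(I)`. -/
lemma dist_le_of_near_jumps {u y : L1I} {e D r : ℝ} {m : ℕ} {p : ℕ → ℝ} (hr : 0 ≤ r)
    (h : ∀ᵐ t ∂muI, |u t - y t| ≤
      e + ∑ j ∈ Finset.range m, (Icc (p j - r) (p j + r)).indicator (fun _ => D) t) (hD : 0 ≤ D) :
    dist u y ≤ e + m * (2 * r * D) := by
  have hint : ∀ j ∈ Finset.range m,
      Integrable ((Icc (p j - r) (p j + r)).indicator fun _ => D) muI := fun j _ =>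
    (integrable_const D).indicator measurableSet_Icc
  have hint' : Integrable (fun t => e + ∑ j ∈ Finset.range m,
      (Icc (p j - r) (p j + r)).indicator (fun _ => D) t) muI :=
    (integrable_const e).add (integrable_finsetSum _ hint)
  refine (dist_le_integral hint' h).trans ?_
  rw [integral_add (integrable_const e) (integrable_finsetSum _ hint), integral_finsetSum _ hint]
  have h1 : ∫ _, e ∂muI = e := by simp
  rw [h1]
  gcongr
  refine (Finset.sum_le_card_nsmul _ _ (2 * r * D) fun j _ => ?_).trans (by simp)
  rw [integral_indicator_const D measurableSet_Icc, smul_eq_mul]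
  refine mul_le_mul_of_nonneg_right ?_ hD
  have h2 : muI.real (Icc (p j - r) (p j + r)) ≤ volume.real (Icc (p j - r) (p j + r)) :=
    ENNReal.toReal_mono (by simp) (Measure.restrict_apply_le _ _)
  refine h2.trans ?_
  rw [Real.volume_real_Icc_of_le (by linarith)]
  linarith

/-- Monotone jump points in `[0, 1]` can be moved to distinct points of `(0, 1)`. -/
lemma exists_mem_stepSet_near {θ s ε : ℝ} (hθ : 0 ≤ θ) (hs : s = 1 ∨ s = -1) {m : ℕ} {p : ℕ → ℝ}
    (hp : ∀ j < m, p j ∈ Icc (0 : ℝ) 1) (hp' : ∀ i j, i ≤ j → j < m → p i ≤ p j) (hε : 0 < ε)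
    {u : L1I} (hu : u =ᵐ[muI] fun t => θ * stepFn s m p t) :
    ∃ y ∈ stepSet θ m, dist u y ≤ ε := by
  obtain ⟨τ, hτ0, hτ1, hτε⟩ : ∃ τ : ℝ, 0 < τ ∧ τ < 1 ∧ m * (2 * τ * (2 * θ)) ≤ ε := by
    refine ⟨min (1 / 2) (ε / (4 * (m + 1) * (θ + 1))), lt_min (by norm_num) (by positivity),
      (min_le_left _ _).trans_lt (by norm_num), ?_⟩
    have h1 : min (1 / 2) (ε / (4 * (m + 1) * (θ + 1))) * (4 * (m + 1) * (θ + 1)) ≤ ε := by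
      rw [← le_div_iff₀ (by positivity)]; exact min_le_right _ _
    refine le_trans ?_ h1
    have h0 : 0 ≤ min (1 / 2) (ε / (4 * (m + 1) * (θ + 1))) := le_min (by norm_num) (by positivity)
    have h2 : (m : ℝ) * θ ≤ (m + 1) * (θ + 1) := by
      have : (0 : ℝ) ≤ m := Nat.cast_nonneg m
      nlinarith
    nlinarith
  set q : ℕ → ℝ := fun j => (1 - τ) * p j + τ * ((j + 1) / (m + 1)) with hq
  have hfrac : ∀ j < m, 0 < ((j : ℝ) + 1) / (m + 1) ∧ ((j : ℝ) + 1) / (m + 1) < 1 := by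
    intro j hj
    have : (j : ℝ) < m := by exact_mod_cast hj
    refine ⟨by positivity, ?_⟩
    rw [div_lt_one (by positivity)]
    linarith
  have hq01 : ∀ j < m, q j ∈ Ioo (0 : ℝ) 1 := by
    intro j hj
    obtain ⟨h1, h2⟩ := hfrac j hj
    obtain ⟨h3, h4⟩ := hp j hj
    constructor
    · have := mul_nonneg (sub_nonneg.2 hτ1.le) h3
      have := mul_pos hτ0 h1
      simp only [hq]; linarith
    · have := mul_le_mul_of_nonneg_left h4 (sub_nonneg.2 hτ1.le)
      have := mul_lt_mul_of_pos_left h2 hτ0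
      simp only [hq]; linarith
  have hqlt : ∀ i j, i < j → j < m → q i < q j := by
    intro i j hij hj
    have h1 := mul_le_mul_of_nonneg_left (hp' i j hij.le hj) (sub_nonneg.2 hτ1.le)
    have h2 : ((i : ℝ) + 1) / (m + 1) < (j + 1) / (m + 1) := by
      have : (i : ℝ) < j := by exact_mod_cast hij
      gcongr
    have := mul_lt_mul_of_pos_left h2 hτ0
    simp only [hq]; linarith
  have hdist : ∀ j < m, |q j - p j| ≤ τ := by
    intro j hj
    obtain ⟨h1, h2⟩ := hfrac j hj
    obtain ⟨h3, h4⟩ := hp j hj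
    have : q j - p j = τ * ((j + 1) / (m + 1) - p j) := by simp only [hq]; ring
    rw [this, abs_mul, abs_of_pos hτ0]
    refine mul_le_of_le_one_right hτ0.le ?_
    rw [abs_le]
    constructor <;> linarith
  obtain ⟨y, hy, hyq⟩ := exists_mem_stepSet (θ := θ) hs hq01 hqlt
  refine ⟨y, hy, ?_⟩
  have := dist_le_of_near_jumps (u := u) (y := y) (e := 0) (D := 2 * θ) (r := τ) (m := m) (p := p)
    hτ0.le ?_ (by positivity)
  · linarith
  filter_upwards [hu, hyq] with t hut hyt
  rw [hut, hyt, ← mul_sub, abs_mul, abs_of_nonneg hθ, stepFn, stepFn, ← mul_sub, abs_mul, zero_add]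
  have hs1 : |s| = 1 := by rcases hs with rfl | rfl <;> simp
  rw [hs1, one_mul]
  refine (mul_le_mul_of_nonneg_left (abs_prod_sub_prod_le
    (fun j _ => by split_ifs <;> simp) (fun j _ => by split_ifs <;> simp)) hθ).trans ?_
  rw [Finset.mul_sum]
  refine Finset.sum_le_sum fun j hj => ?_
  have hd := abs_le.1 (hdist j (Finset.mem_range.1 hj))
  by_cases ht : t ∈ Icc (p j - τ) (p j + τ)
  · rw [indicator_of_mem ht, mul_comm]
    refine mul_le_mul_of_nonneg_right ?_ hθ
    split_ifs <;> norm_num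
  · rw [indicator_of_notMem ht]
    rw [mem_Icc, not_and_or, not_le, not_le] at ht
    rcases ht with ht | ht
    · rw [if_pos (by linarith), if_pos (by linarith)]; simp
    · rw [if_neg (by linarith), if_neg (by linarith)]; simp

/-! ### From energy bounds to step functions -/

/-- Pointwise, replacing `x` by the nearer of `± θ` (or by either of them, if `|x|` is not close
to `θ`) is controlled by `||x| - θ|`. -/
lemma abs_sub_mul_sign_le {θ δ x s : ℝ} (hθ : 0 < θ) (hδ : 0 < δ) (hs : s = 1 ∨ s = -1)
    (h : |(|x| - θ)| < δ → s = if 0 < x then 1 else -1) :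
    |x - θ * s| ≤ (1 + 2 * θ / δ) * |(|x| - θ)| := by
  have hexp : (1 + 2 * θ / δ) * |(|x| - θ)| = |(|x| - θ)| + 2 * θ * (|(|x| - θ)| / δ) := by ring
  rw [hexp]
  rcases lt_or_ge |(|x| - θ)| δ with hlt | hge
  · have h1 : |x - θ * s| = |(|x| - θ)| := by
      rw [h hlt]
      split_ifs with h0
      · rw [abs_of_pos h0, mul_one]
      · rw [abs_of_nonpos (not_lt.1 h0), ← abs_neg]; congr 1; ring
    rw [h1]
    have : 0 ≤ 2 * θ * (|(|x| - θ)| / δ) := by positivity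
    linarith
  · have h1 : 1 ≤ |(|x| - θ)| / δ := (one_le_div hδ).2 hge
    have h2 : |x - θ * s| ≤ |x| + θ := by
      refine (abs_sub _ _).trans ?_
      rw [abs_mul, abs_of_pos hθ]
      rcases hs with rfl | rfl <;> simp
    have h3 : |x| - θ ≤ |(|x| - θ)| := le_abs_self _
    nlinarith

/-- If every transition of `w` between neighbourhoods of `θ` and `-θ` increases `F` by at least
`c`, where `E` bounds the total increase, then `w` is close to a step function with at most `E / c`
jumps. For boundary conditions which exclude an odd number of jumps, a transition must also be paid
for outside of each interval with end values of opposite sign. -/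
lemma exists_mem_stepSet_of_transitions {θ δ c E : ℝ} (hδ : 0 < δ) (hδθ : δ < θ)
    (hc : 0 < c) (hE0 : 0 ≤ E) {R : ℝ → ℝ → Prop} (hR : R 1 1) {u : L1I} {w : ℝ → ℝ}
    (huw : u =ᵐ[muI] w) {F : ℝ → ℝ}
    (hF : ∀ a ∈ Ioo (0 : ℝ) 1, ∀ b ∈ Ioo (0 : ℝ) 1, a < b → |(|w a| - θ)| < δ →
      |(|w b| - θ)| < δ → w a * w b < 0 → c ≤ F b - F a)
    (hE : ∀ a ∈ Ioo (0 : ℝ) 1, ∀ b ∈ Ioo (0 : ℝ) 1, a ≤ b → F b - F a ≤ E)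
    (hwrap : R 1 (-1) ∨ ∀ a ∈ Ioo (0 : ℝ) 1, ∀ b ∈ Ioo (0 : ℝ) 1, a ≤ b → |(|w a| - θ)| < δ →
      |(|w b| - θ)| < δ → w a * w b < 0 → F b - F a + c ≤ E)
    {ε : ℝ} (hε : 0 < ε) :
    ∃ m : ℕ, R 1 ((-1) ^ m) ∧ m * c ≤ E ∧ ∃ y ∈ stepSet θ m,
      dist u y ≤ (1 + 2 * θ / δ) * (∫ t, |(|u t| - θ)| ∂muI) + ε := by
  have hθ : 0 < θ := hδ.trans hδθ
  have hint : Integrable (fun t => (1 + 2 * θ / δ) * |(|u t| - θ)|) muI :=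
    (((L1.integrable_coeFn u).abs.sub (integrable_const θ)).abs).const_mul _
  set A : Set ℝ := {t | t ∈ Ioo (0 : ℝ) 1 ∧ |(|w t| - θ)| < δ} with hA
  set s : ℝ → ℝ := fun t => if 0 < w t then 1 else -1 with hs
  have hs1 : ∀ t, s t = 1 ∨ s t = -1 := fun t => by
    simp only [hs]; split_ifs <;> simp
  have hw0 : ∀ t ∈ A, w t ≠ 0 := by
    rintro t ⟨-, ht⟩ h0
    rw [h0, abs_zero, zero_sub, abs_neg, abs_of_pos hθ] at ht
    linarith
  have hopp : ∀ a ∈ A, ∀ b ∈ A, s a ≠ s b → w a * w b < 0 := by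
    intro a ha b hb hab
    simp only [hs] at hab
    rcases lt_or_gt_of_ne (hw0 a ha) with h1 | h1 <;> rcases lt_or_gt_of_ne (hw0 b hb) with h2 | h2
    · rw [if_neg h1.not_gt, if_neg h2.not_gt] at hab; exact (hab rfl).elim
    · exact mul_neg_of_neg_of_pos h1 h2
    · exact mul_neg_of_pos_of_neg h1 h2
    · rw [if_pos h1, if_pos h2] at hab; exact (hab rfl).elim
  -- It suffices to find monotone jump points in `[0, 1]`.
  suffices h : ∃ (m : ℕ) (σ : ℝ) (p : ℕ → ℝ), R 1 ((-1) ^ m) ∧ m * c ≤ E ∧ (σ = 1 ∨ σ = -1) ∧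
      (∀ j < m, p j ∈ Icc (0 : ℝ) 1) ∧ (∀ i j, i ≤ j → j < m → p i ≤ p j) ∧
      (∀ t ∈ A, (∀ j < m, t ≠ p j) → s t = stepFn σ m p t) by
    obtain ⟨m, σ, p, hRm, hmE, hσ, hp, hp', hst⟩ := h
    have hv : Integrable (fun t => θ * stepFn σ m p t) muI :=
      integrable_muI_of_abs_le ((measurable_stepFn σ m p).const_mul θ).aestronglyMeasurable
        (C := |θ|) fun t _ => by rw [abs_mul, abs_stepFn hσ, mul_one]
    obtain ⟨y, hy, hdy⟩ := exists_mem_stepSet_near hθ.le hσ hp hp' hε hv.coeFn_toL1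
    refine ⟨m, hRm, hmE, y, hy, (dist_triangle u (hv.toL1 _) y).trans (add_le_add ?_ hdy)⟩
    rw [← integral_const_mul]
    refine dist_le_integral hint ?_
    have hnull : ∀ᵐ t ∂muI, ∀ j < m, t ≠ p j := by
      rw [ae_all_iff]
      intro j
      filter_upwards [ae_restrict_of_ae (Measure.ae_ne volume (p j))] with t ht _ using ht
    filter_upwards [huw, hv.coeFn_toL1, hnull, ae_restrict_mem measurableSet_Ioo] with t h1 h2 h3 h4
    rw [h2, h1]
    refine abs_sub_mul_sign_le hθ hδ ?_ fun h => (hst t ⟨h4, h⟩ h3).symm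
    have := abs_stepFn hσ m p t
    rwa [abs_eq zero_le_one] at this
  rcases A.eq_empty_or_nonempty with hAe | hAne
  · refine ⟨0, 1, fun _ => 0, by simpa using hR, by simpa using hE0, Or.inl rfl, by simp, by simp,
      fun t ht => ?_⟩
    rw [hAe] at ht
    exact ht.elim
  obtain ⟨m, σ, p, hσ, hp, hp', hst, a, ha, b, hb, hab, hsab, hmc⟩ := exists_stepFn_eq
    (fun t ht => ht.1) hAne (fun t _ => hs1 t) hc
    (fun a ha b hb hab h => hF a ha.1 b hb.1 hab ha.2 hb.2 (hopp a ha b hb h))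
    (fun a ha b hb hab => hE a ha.1 b hb.1 hab)
  by_cases hRm : R 1 ((-1) ^ m)
  · exact ⟨m, σ, p, hRm, hmc.trans (hE a ha.1 b hb.1 hab), hσ, hp, hp', hst⟩
  -- The number of jumps is odd, which is not allowed; a further jump is placed at `1`.
  have hodd : (-1 : ℝ) ^ m = -1 := by
    rcases neg_one_pow_eq_or ℝ m with h | h
    · rw [h] at hRm; exact (hRm hR).elim
    · exact h
  have hwrap' := hwrap.resolve_left fun h => hRm (by rwa [hodd])
  have hne : s a ≠ s b := by
    rw [hsab, hodd]
    rcases hs1 a with h | h <;> rw [h] <;> norm_num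
  refine ⟨m + 1, σ, fun j => if j < m then p j else 1, ?_, ?_, hσ, fun j _ => ?_,
    fun i j hij hj => ?_, fun t ht htp => ?_⟩
  · rw [pow_succ, hodd]; simpa using hR
  · have := hwrap' a ha.1 b hb.1 hab ha.2 hb.2 (hopp a ha b hb hne)
    push_cast
    linarith
  · dsimp only
    split_ifs with h
    · exact hp j h
    · simp
  · dsimp only
    split_ifs with h1 h2 h2
    · exact hp' i j hij h2
    · exact (hp i h1).2
    · omega
    · exact le_rfl
  · rw [hst t ht fun j hj => by simpa [hj] using htp j (by omega), stepFn, stepFn,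
      Finset.prod_range_succ, if_neg (lt_irrefl m), if_pos ht.1.2, mul_one]
    congr 1
    refine Finset.prod_congr rfl fun j hj => ?_
    rw [if_pos (Finset.mem_range.1 hj)]

/-! ### The `Γ`-limit -/

/-- The common `Γ`-limit: `C` times the least number of jumps, compatible with the boundary
condition, of a step function with values `± θ`. Taking the closure of the set of step functions
with exactly `m` jumps accounts for jumps lost at the end points of `I`. -/
noncomputable def limitEnergy (R : ℝ → ℝ → Prop) (θ C : ℝ) (x : L1I) : EReal :=
  ⨅ m : ℕ, ⨅ _ : R 1 ((-1) ^ m) ∧ x ∈ closure (stepSet θ m), ((m * C : ℝ) : EReal)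

lemma limitEnergy_le {R : ℝ → ℝ → Prop} {θ C : ℝ} {x : L1I} {m : ℕ} (hR : R 1 ((-1) ^ m))
    (hx : x ∈ closure (stepSet θ m)) : limitEnergy R θ C x ≤ ((m * C : ℝ) : EReal) :=
  iInf₂_le (f := fun (m : ℕ) (_ : R 1 ((-1) ^ m) ∧ x ∈ closure (stepSet θ m)) =>
    ((m * C : ℝ) : EReal)) m ⟨hR, hx⟩

lemma exists_of_limitEnergy_lt {R : ℝ → ℝ → Prop} {θ C : ℝ} {x : L1I} {K : EReal}
    (h : limitEnergy R θ C x < K) :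
    ∃ m : ℕ, R 1 ((-1) ^ m) ∧ x ∈ closure (stepSet θ m) ∧ ((m * C : ℝ) : EReal) < K := by
  obtain ⟨m, hm, hlt⟩ : ∃ m : ℕ, ∃ _ : R 1 ((-1) ^ m) ∧ x ∈ closure (stepSet θ m),
      ((m * C : ℝ) : EReal) < K := by
    simpa only [limitEnergy, iInf_lt_iff] using h
  exact ⟨m, hm.1, hm.2, hlt⟩

lemma limitEnergy_nonneg {R : ℝ → ℝ → Prop} {θ C : ℝ} (hC : 0 ≤ C) (x : L1I) :
    0 ≤ limitEnergy R θ C x :=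
  le_iInf₂ fun m _ => EReal.coe_nonneg.2 (by positivity)

/-- Recovery sequences exist as soon as approximate ones do, by a diagonal argument. -/
lemma exists_recovery_sequence {X : Type*} [PseudoMetricSpace X] {G : ℕ → X → EReal} {x : X}
    {L : EReal}
    (h : ∀ ε : ℝ, 0 < ε → ∀ᶠ k in atTop, ∃ u, dist u x ≤ ε ∧ G k u ≤ L + (ε : EReal)) :
    ∃ u : ℕ → X, Tendsto u atTop (𝓝 x) ∧ limsup (fun k => G k (u k)) atTop ≤ L := by
  have h' : ∀ j : ℕ, ∃ n : ℕ, ∀ k ≥ n, ∃ u, dist u x ≤ 1 / ((j : ℝ) + 1) ∧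
      G k u ≤ L + ((1 / ((j : ℝ) + 1) : ℝ) : EReal) :=
    fun j => eventually_atTop.1 (h _ (by positivity))
  choose n hn using h'
  -- `J k` is the best accuracy available at the index `k`.
  classical
  set J : ℕ → ℕ := fun k => Nat.findGreatest (fun j => n j ≤ k) k with hJ
  have hJspec : ∀ j k, n j ≤ k → j ≤ k → j ≤ J k ∧ n (J k) ≤ k := fun j k h1 h2 =>
    ⟨Nat.le_findGreatest h2 h1, Nat.findGreatest_spec (P := fun j => n j ≤ k) h2 h1⟩
  have hJev : ∀ j : ℕ, ∀ᶠ k in atTop, j ≤ J k ∧ n (J k) ≤ k := fun j => by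
    filter_upwards [eventually_ge_atTop (max (n j) j)] with k hk
    exact hJspec j k ((le_max_left _ _).trans hk) ((le_max_right _ _).trans hk)
  have hu : ∀ k, ∃ u, n (J k) ≤ k → dist u x ≤ 1 / ((J k : ℝ) + 1) ∧
      G k u ≤ L + ((1 / ((J k : ℝ) + 1) : ℝ) : EReal) := fun k => by
    by_cases hk : n (J k) ≤ k
    · obtain ⟨u, hu⟩ := hn (J k) k hk
      exact ⟨u, fun _ => hu⟩
    · exact ⟨x, fun h => (hk h).elim⟩
  choose u hu using hu
  have key : ∀ ε : ℝ, 0 < ε → ∀ᶠ k in atTop, dist (u k) x ≤ ε ∧ G k (u k) ≤ L + (ε : EReal) := by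
    intro ε hε
    obtain ⟨j, hj⟩ := exists_nat_one_div_lt hε
    filter_upwards [hJev j] with k hk
    obtain ⟨h1, h2⟩ := hu k hk.2
    have h3 : 1 / ((J k : ℝ) + 1) ≤ ε := by
      refine le_trans ?_ hj.le
      have : (j : ℝ) ≤ J k := by exact_mod_cast hk.1
      gcongr
    exact ⟨h1.trans h3, h2.trans (add_le_add_right (EReal.coe_le_coe_iff.2 h3) L)⟩
  refine ⟨u, ?_, ?_⟩
  · rw [Metric.tendsto_nhds]
    intro ε hε
    filter_upwards [key (ε / 2) (by positivity)] with k hk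
    linarith [hk.1]
  · refine EReal.le_of_forall_lt_iff_le.1 fun z hz => ?_
    rcases eq_or_ne L ⊥ with hbot | hbot
    · refine limsup_le_of_le (h := ?_)
      filter_upwards [key 1 one_pos] with k hk
      rw [hbot, EReal.bot_add] at hk
      exact hk.2.trans bot_le
    · lift L to ℝ using ⟨hz.ne_top, hbot⟩
      have hz' : L < z := EReal.coe_lt_coe_iff.1 hz
      refine limsup_le_of_le (h := ?_)
      filter_upwards [key (z - L) (by linarith)] with k hk
      refine hk.2.trans ?_
      rw [← EReal.coe_add]
      exact EReal.coe_le_coe_iff.2 (by linarith)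

/-- Lower bounds by numbers of jumps and approximate recovery of step functions give
`Γ`-convergence to `limitEnergy`. -/
theorem gammaTendsto_limitEnergy {R : ℝ → ℝ → Prop} {θ C : ℝ} (hC : 0 < C) {G : ℕ → L1I → EReal}
    (hlow : ∀ ε : ℝ, 0 < ε → ∀ K : ℝ, ∀ᶠ k in atTop, ∀ u, G k u < K →
      ∃ m : ℕ, R 1 ((-1) ^ m) ∧ m * (C - ε) ≤ K ∧ ∃ y ∈ stepSet θ m, dist u y ≤ ε)
    (hup : ∀ m : ℕ, R 1 ((-1) ^ m) → ∀ y ∈ stepSet θ m, ∀ ε : ℝ, 0 < ε → ∀ᶠ k in atTop,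
      ∃ u, dist u y ≤ ε ∧ G k u ≤ ((m * C + ε : ℝ) : EReal)) :
    GammaTendsto G (limitEnergy R θ C) := by
  refine fun x => ⟨fun u hu => ?_, ?_⟩
  · by_contra! hcon
    obtain ⟨K, hK1, hK2⟩ := EReal.lt_iff_exists_real_btwn.1 hcon
    obtain ⟨K', hK'1, hK'2⟩ := EReal.lt_iff_exists_real_btwn.1 hK2
    have hKK' : K < K' := EReal.coe_lt_coe_iff.1 hK'1
    -- For small `ε`, the number of jumps satisfies `m * C ≤ K'`.
    obtain ⟨ε₀, hε₀, hε₀'⟩ : ∃ ε₀ : ℝ, 0 < ε₀ ∧ ∀ ε : ℝ, 0 < ε → ε ≤ ε₀ → ∀ m : ℕ,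
        (m : ℝ) * (C - ε) ≤ K → (m : ℝ) * C ≤ K' := by
      refine ⟨min (C / 2) (C * (K' - K) / (2 * (|K| + 1))), lt_min (by positivity)
        (div_pos (mul_pos hC (by linarith)) (by positivity)), fun ε hε hle m hm => ?_⟩
      have h1 := hle.trans (min_le_left _ _)
      have h2 := hle.trans (min_le_right _ _)
      rw [le_div_iff₀ (by positivity)] at h2
      have hm0 : (0 : ℝ) ≤ m := Nat.cast_nonneg m
      have h3 : (m : ℝ) * C ≤ 2 * |K| := by nlinarith [le_abs_self K]
      have h4 : (m : ℝ) * C * ε ≤ 2 * (|K| + 1) * ε := by nlinarith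
      have h5 : C * (m * ε) ≤ C * (K' - K) := by linarith
      have h6 := le_of_mul_le_mul_left h5 hC
      linarith
    set S : Set ℕ := {m | R 1 ((-1) ^ m) ∧ (m : ℝ) * C ≤ K'} with hS
    have hSfin : S.Finite := by
      obtain ⟨n, hn⟩ := exists_nat_gt (K' / C)
      refine (Set.finite_lt_nat n).subset fun m hm => ?_
      rw [div_lt_iff₀ hC] at hn
      have : (m : ℝ) < n := lt_of_mul_lt_mul_right (hm.2.trans_lt hn) hC.le
      exact_mod_cast this
    have hx : x ∈ closure (⋃ m ∈ S, stepSet θ m) := by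
      rw [Metric.mem_closure_iff]
      intro r hr
      set ε : ℝ := min ε₀ (r / 3) with hεdef
      have hε : 0 < ε := lt_min hε₀ (by positivity)
      have h1 : ∃ᶠ k in atTop, G k (u k) < K := frequently_lt_of_liminf_lt (h := hK1)
      have h2 : ∀ᶠ k in atTop, dist (u k) x < r / 3 :=
        Metric.tendsto_nhds.1 hu _ (by positivity)
      obtain ⟨k, hk1, hk2, hk3⟩ := (h1.and_eventually ((hlow ε hε K).and h2)).exists
      obtain ⟨m, hRm, hmK, y, hy, hdy⟩ := hk2 _ hk1
      refine ⟨y, mem_biUnion (show m ∈ S from ⟨hRm, hε₀' ε hε (min_le_left _ _) m hmK⟩) hy, ?_⟩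
      have := dist_triangle_left x y (u k)
      have h3 : ε ≤ r / 3 := min_le_right _ _
      linarith
    rw [hSfin.closure_biUnion] at hx
    obtain ⟨m, hm, hxm⟩ := mem_iUnion₂.1 hx
    have := (limitEnergy_le (C := C) hm.1 hxm).trans (EReal.coe_le_coe_iff.2 hm.2)
    exact absurd hK'2 (not_lt.2 this)
  · refine exists_recovery_sequence fun ε hε => ?_
    rcases eq_or_ne (limitEnergy R θ C x) ⊤ with htop | htop
    · refine Eventually.of_forall fun k => ⟨x, by simp [hε.le], ?_⟩
      rw [htop, EReal.top_add_coe]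
      exact le_top
    obtain ⟨l, hl⟩ : ∃ l : ℝ, (l : EReal) = limitEnergy R θ C x := by
      have hbot : limitEnergy R θ C x ≠ ⊥ :=
        ne_of_gt (lt_of_lt_of_le EReal.bot_lt_zero (limitEnergy_nonneg hC.le x))
      exact ⟨_, EReal.coe_toReal htop hbot⟩
    rw [← hl, ← EReal.coe_add]
    obtain ⟨m, hRm, hxm, hlt⟩ := exists_of_limitEnergy_lt (R := R) (θ := θ) (C := C) (x := x)
      (K := ((l + ε / 2 : ℝ) : EReal)) (by
        rw [← hl]; exact EReal.coe_lt_coe_iff.2 (by linarith))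
    have hlt' : m * C < l + ε / 2 := EReal.coe_lt_coe_iff.1 hlt
    obtain ⟨y, hy, hdy⟩ := Metric.mem_closure_iff.1 hxm (ε / 2) (by positivity)
    filter_upwards [hup m hRm y hy (ε / 2) (by positivity)] with k hk
    obtain ⟨v, hv, hGv⟩ := hk
    refine ⟨v, ?_, hGv.trans (EReal.coe_le_coe_iff.2 (by linarith))⟩
    have := dist_triangle_right v x y
    linarith

/-- A step function with two jumps has positive finite limit energy: it is not a limit of
constants `± θ`. -/
lemma isNontrivial_limitEnergy {R : ℝ → ℝ → Prop} (hR : R 1 1) {θ C : ℝ} (hθ : 0 < θ) (hC : 0 < C) :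
    IsNontrivial (limitEnergy R θ C) := by
  obtain ⟨x, hx, hxeq⟩ := exists_mem_stepSet (θ := θ) (s := 1) (Or.inl rfl) (m := 2)
    (p := fun j => ((j : ℝ) + 1) / 3)
    (fun j hj => by interval_cases j <;> norm_num)
    (fun i j hij _ => by
      have : (i : ℝ) < j := by exact_mod_cast hij
      gcongr)
  refine ⟨x, ?_, lt_of_le_of_lt (limitEnergy_le (m := 2) (by simpa using hR) (subset_closure hx))
    (EReal.coe_lt_top _)⟩
  by_contra hcon
  obtain ⟨m, -, hxm, hlt⟩ := exists_of_limitEnergy_lt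
    (lt_of_le_of_lt (not_lt.1 hcon) (EReal.coe_pos.2 hC))
  have hm0 : m = 0 := by
    have h1 : (m : ℝ) * C < C := EReal.coe_lt_coe_iff.1 hlt
    have h2 : (m : ℝ) < 1 := by
      by_contra! h3
      nlinarith
    have : m < 1 := by exact_mod_cast h2
    omega
  subst hm0
  obtain ⟨y, ⟨s, p, hs, -, -, hys⟩, hd⟩ := Metric.mem_closure_iff.1 hxm (θ / 2) (by positivity)
  -- `x` differs from the constant by `2 θ` on `(0, 1/3)` or on `(1/3, 2/3)`.
  have hlow : ∀ (a : ℝ), 0 ≤ a → a + 1 / 3 ≤ 1 →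
      (∀ t ∈ Ioo a (a + 1 / 3), |θ * stepFn 1 2 (fun j => ((j : ℝ) + 1) / 3) t
        - θ * stepFn s 0 p t| = 2 * θ) → 2 * θ / 3 ≤ dist x y := by
    intro a ha0 ha1 ha
    rw [L1.dist_eq_integral_dist]
    have hi : Integrable (fun t => dist (x t) (y t)) muI := by
      simp only [Real.dist_eq]
      exact ((L1.integrable_coeFn x).sub (L1.integrable_coeFn y)).abs
    have h1 : ∫ t, (Ioo a (a + 1 / 3)).indicator (fun _ => 2 * θ) t ∂muI
        ≤ ∫ t, dist (x t) (y t) ∂muI := by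
      refine integral_mono_ae ((integrable_const _).indicator measurableSet_Ioo) hi ?_
      filter_upwards [hxeq, hys] with t h1 h2
      by_cases ht : t ∈ Ioo a (a + 1 / 3)
      · rw [indicator_of_mem ht, Real.dist_eq, h1, h2, ha t ht]
      · rw [indicator_of_notMem ht]; exact dist_nonneg
    refine le_trans (le_of_eq ?_) h1
    rw [integral_indicator_const _ measurableSet_Ioo, smul_eq_mul, Measure.real,
      Measure.restrict_apply measurableSet_Ioo,
      inter_eq_left.2 (Ioo_subset_Ioo ha0 ha1), Real.volume_Ioo, add_sub_cancel_left,
      ENNReal.toReal_ofReal (by norm_num)]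
    ring
  have hbd : 2 * θ / 3 ≤ dist x y := by
    rcases hs with rfl | rfl
    · refine hlow (1 / 3) (by norm_num) (by norm_num) fun t ht => ?_
      have h1 : ¬ t < (((0 : ℕ) : ℝ) + 1) / 3 := by
        push_cast; linarith [ht.1]
      have h2 : t < (((1 : ℕ) : ℝ) + 1) / 3 := by
        push_cast; linarith [ht.2]
      simp only [stepFn, Finset.prod_range_succ, Finset.prod_range_zero, if_neg h1, if_pos h2]
      rw [show θ * (1 * (1 * -1 * 1)) - θ * (1 * 1) = -(2 * θ) by ring, abs_neg,
        abs_of_pos (by positivity)]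
    · refine hlow 0 le_rfl (by norm_num) fun t ht => ?_
      have h1 : t < (((0 : ℕ) : ℝ) + 1) / 3 := by
        push_cast; linarith [ht.2]
      have h2 : t < (((1 : ℕ) : ℝ) + 1) / 3 := by
        push_cast; linarith [ht.2]
      simp only [stepFn, Finset.prod_range_succ, Finset.prod_range_zero, if_pos h1, if_pos h2]
      rw [show θ * (1 * (1 * 1 * 1)) - θ * (-1 * 1) = 2 * θ by ring, abs_of_pos (by positivity)]
  linarith

/-! ### Lower bound for the chain -/

/-- The lower bound for one transition, in either direction. -/
lemma exists_creaseEnergy_sub_le_sum_of_mul_neg {β : ℝ} (hβ : β ∈ Ico (0 : ℝ) 4) {ε : ℝ}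
    (hε : 0 < ε) :
    ∃ δ > 0, δ < thetaMin β ∧ ∃ η > 0, ∀ α ∈ Ico (0 : ℝ) 4, |α - β| < η → ∀ (L : ℕ) (ψ : ℕ → ℝ),
      (∀ l ≤ L, ψ l ∈ Icc (-(Real.pi / 2)) (Real.pi / 2)) →
      |(|ψ 0| - thetaMin β)| < δ → |(|ψ L| - thetaMin β)| < δ → ψ 0 * ψ L < 0 →
      creaseEnergy β - ε ≤ ∑ l ∈ Finset.range L, bondEnergy α (ψ l) (ψ (l + 1)) := by
  obtain ⟨δ, hδ, η, hη, h⟩ := exists_creaseEnergy_sub_le_sum hβ hε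
  have hθ := thetaMin_pos hβ.2
  refine ⟨min δ (thetaMin β / 2), lt_min hδ (by positivity),
    (min_le_right _ _).trans_lt (by linarith), η, hη, fun α hα hαβ L ψ hψ h0 hL hneg => ?_⟩
  have h0' := h0.le.trans (min_le_left _ _)
  have hL' := hL.le.trans (min_le_left _ _)
  rcases mul_neg_iff.1 hneg with ⟨h1, h2⟩ | ⟨h1, h2⟩
  · rw [abs_of_pos h1] at h0'
    rw [abs_of_neg h2] at hL'
    have := h α hα hαβ L (fun l => -ψ l) (fun l hl => neg_mem_angles (hψ l hl))
      (by rw [neg_add_eq_sub, abs_sub_comm]; exact h0') hL'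
    simpa only [bondEnergy_neg] using this
  · rw [abs_of_neg h1] at h0'
    rw [abs_of_pos h2] at hL'
    exact h α hα hαβ L ψ hψ (by rw [← abs_neg, neg_add']; exact h0') hL'

lemma floor_lt_of_mem_Ioo {n : ℕ} (hn : 0 < n) {t : ℝ} (ht : t ∈ Ioo (0 : ℝ) 1) :
    ⌊(n : ℝ) * t⌋₊ < n := by
  have hn' : (0 : ℝ) < n := by exact_mod_cast hn
  rw [Nat.floor_lt (by have := ht.1; positivity)]
  exact mul_lt_of_lt_one_right hn' ht.2

lemma integral_comp_floor_le {n : ℕ} (hn : 0 < n) {h : ℕ → ℝ} (hh : ∀ i, 0 ≤ h i) :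
    ∫ t, h ⌊(n : ℝ) * t⌋₊ ∂muI ≤ (∑ i ∈ Finset.range n, h i) / n := by
  have hn' : (0 : ℝ) < n := by exact_mod_cast hn
  have e : (fun t : ℝ => h ⌊(n : ℝ) * t⌋₊) =ᵐ[muI] fun t => ∑ i ∈ Finset.range n,
      (Ico ((i : ℝ) / n) ((i + 1) / n)).indicator (fun _ => h i) t := by
    filter_upwards [ae_restrict_mem measurableSet_Ioo] with t ht
    have hmem : ∀ i : ℕ, t ∈ Ico ((i : ℝ) / n) ((i + 1) / n) ↔ i = ⌊(n : ℝ) * t⌋₊ := by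
      intro i
      rw [eq_comm, Nat.floor_eq_iff (by have := ht.1; positivity), mem_Ico, div_le_iff₀ hn',
        lt_div_iff₀ hn', mul_comm t]
    rw [Finset.sum_eq_single ⌊(n : ℝ) * t⌋₊]
    · rw [indicator_of_mem ((hmem _).2 rfl)]
    · intro i _ hi
      rw [indicator_of_notMem fun hm => hi ((hmem i).1 hm)]
    · intro hi
      exact (hi (Finset.mem_range.2 (floor_lt_of_mem_Ioo hn ht))).elim
  rw [integral_congr_ae e, integral_finsetSum _ fun i _ =>
    (integrable_const (h i)).indicator measurableSet_Ico, Finset.sum_div]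
  refine Finset.sum_le_sum fun i _ => ?_
  rw [integral_indicator_const _ measurableSet_Ico, smul_eq_mul]
  have h2 : muI.real (Ico ((i : ℝ) / n) ((i + 1) / n)) ≤ 1 / n := by
    refine (ENNReal.toReal_mono (by simp) (Measure.restrict_apply_le _ _)).trans ?_
    rw [Real.volume_Ico, ENNReal.toReal_ofReal (by rw [← sub_div]; simp)]
    rw [← sub_div]; simp
  calc _ ≤ 1 / n * h i := mul_le_mul_of_nonneg_right h2 (hh i)
    _ = h i / n := by ring

lemma IsInterpolation.ae_eq {R : ℝ → ℝ → Prop} {n : ℕ} (hn : 0 < n) {φ : ℕ → ℝ} {u : L1I}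
    (h : IsInterpolation R n φ u) : u =ᵐ[muI] fun t => φ ⌊(n : ℝ) * t⌋₊ := by
  have hn' : (0 : ℝ) < n := by exact_mod_cast hn
  have h1 : ∀ᵐ t ∂muI, ∀ i : ℕ, i < n →
      t ∈ Ioo ((i : ℝ) / n) (((i : ℝ) + 1) / n) → u t = φ i := by
    rw [ae_all_iff]
    intro i
    by_cases hi : i < n
    · filter_upwards [h.2.2 i hi] with t ht _ using ht
    · exact Eventually.of_forall fun t h => (hi h).elim
  have h2 : ∀ᵐ t ∂muI, ∀ i : ℕ, t ≠ (i : ℝ) / n := by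
    rw [ae_all_iff]
    exact fun i => ae_restrict_of_ae (Measure.ae_ne volume _)
  filter_upwards [h1, h2, ae_restrict_mem measurableSet_Ioo] with t h1 h2 ht
  refine h1 _ (floor_lt_of_mem_Ioo hn ht) ⟨lt_of_le_of_ne ?_ (h2 _).symm, ?_⟩
  · rw [div_le_iff₀ hn', mul_comm t]
    exact Nat.floor_le (by have := ht.1; positivity)
  · rw [lt_div_iff₀ hn', mul_comm t]
    exact Nat.lt_floor_add_one _

lemma abs_abs_sub_thetaMin_le {β x : ℝ} (hβ : β ∈ Ico (0 : ℝ) 4)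
    (hx : x ∈ Icc (-(Real.pi / 2)) (Real.pi / 2)) : |(|x| - thetaMin β)| ≤ 2 := by
  have h1 : |x| ≤ Real.pi / 2 := abs_le.2 hx
  have h2 := thetaMin_le hβ.1
  have h3 := thetaMin_pos hβ.2
  rw [abs_le]
  constructor <;> linarith [abs_nonneg x, Real.pi_le_four]

/-- The distance to the wells is controlled by the energy, up to a small constant. -/
lemma exists_abs_abs_sub_le {β : ℝ} (hβ : β ∈ Ico (0 : ℝ) 4) {ρ : ℝ} (hρ : 0 < ρ) :
    ∃ B > 0, ∀ α ∈ Ico (0 : ℝ) 4, ∀ x ∈ Icc (-(Real.pi / 2)) (Real.pi / 2),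
      ∀ y ∈ Icc (-(Real.pi / 2)) (Real.pi / 2),
      |(|x| - thetaMin β)| ≤ ρ + B * (bondEnergy α x y + 2 * |α - β|) := by
  obtain ⟨c, hc, h⟩ := exists_pos_le_bondEnergy_of_far hβ hρ
  refine ⟨2 / c, by positivity, fun α hα x hx y hy => ?_⟩
  have h1 : bondEnergy β x y ≤ bondEnergy α x y + 2 * |α - β| := by
    linarith [(abs_le.1 (abs_bondEnergy_sub_param_le hα hβ x y)).1]
  have h2 : 2 / c * bondEnergy β x y ≤ 2 / c * (bondEnergy α x y + 2 * |α - β|) := by gcongr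
  have h3 : 0 ≤ 2 / c * bondEnergy β x y :=
    mul_nonneg (by positivity) (bondEnergy_nonneg hβ.2.le _ _)
  by_cases hfar : ρ ≤ |x - thetaMin β| ∧ ρ ≤ |x + thetaMin β|
  · have h4 := h x hx y hy hfar.1 hfar.2
    have h5 : 2 ≤ 2 / c * bondEnergy β x y := by
      rw [div_mul_eq_mul_div, le_div_iff₀ hc]; linarith
    linarith [abs_abs_sub_thetaMin_le hβ hx]
  · have hθ := thetaMin_pos hβ.2
    have : |(|x| - thetaMin β)| ≤ ρ := by
      rw [not_and_or, not_le, not_le] at hfar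
      rcases hfar with h | h
      · have := abs_abs_sub_abs_le x (thetaMin β)
        rw [abs_of_pos hθ] at this
        linarith
      · have := abs_abs_sub_abs_le x (-thetaMin β)
        rw [abs_neg, abs_of_pos hθ, sub_neg_eq_add] at this
        linarith
    linarith

/-- Chains with bounded energy are close to step functions, with no more jumps than the energy
allows, uniformly in the parameter near `β`. -/
theorem chainEnergy_lower {β : ℝ} (hβ : β ∈ Ico (0 : ℝ) 4) {R : ℝ → ℝ → Prop} (hR : R 1 1)
    (hR' : R 1 (-1) ∨ ∀ x y, R x y → x = y) {ε : ℝ} (hε : 0 < ε) (K : ℝ) :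
    ∃ n₀ : ℕ, ∃ η > 0, ∀ n ≥ n₀, ∀ α ∈ Ico (0 : ℝ) 4, |α - β| < η → ∀ u : L1I,
      chainEnergy R n α u < K → ∃ m : ℕ, R 1 ((-1) ^ m) ∧ m * (creaseEnergy β - ε) ≤ K ∧
        ∃ y ∈ stepSet (thetaMin β) m, dist u y ≤ ε := by
  have hθ := thetaMin_pos hβ.2
  have hC := creaseEnergy_pos hβ
  obtain ⟨δ, hδ, hδθ, η₁, hη₁, hseg⟩ := exists_creaseEnergy_sub_le_sum_of_mul_neg hβ
    (ε := min ε (creaseEnergy β / 2)) (lt_min hε (by positivity))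
  set c := creaseEnergy β - min ε (creaseEnergy β / 2) with hcdef
  have hc : 0 < c := by
    have := min_le_right ε (creaseEnergy β / 2)
    rw [hcdef]; linarith
  have hcε : creaseEnergy β - ε ≤ c := by
    have := min_le_left ε (creaseEnergy β / 2)
    rw [hcdef]; linarith
  set D := 1 + 2 * thetaMin β / δ with hD
  have hD0 : 0 < D := by positivity
  set ρ := ε / (4 * D) with hρdef
  have hρ : 0 < ρ := by positivity
  have hDρ : D * (2 * ρ) = ε / 2 := by rw [hρdef]; field_simp; norm_num
  obtain ⟨B, hB, hwell⟩ := exists_abs_abs_sub_le hβ (ρ := ρ) hρ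
  obtain ⟨n₀, hn₀⟩ := exists_nat_gt (2 * B * |K| / ρ)
  rw [div_lt_iff₀ hρ] at hn₀
  refine ⟨n₀ + 1, min η₁ (ρ / (4 * B)), lt_min hη₁ (by positivity),
    fun n hn α hα hαβ u hu => ?_⟩
  have hn0 : 0 < n := by omega
  have hn' : (0 : ℝ) < n := by exact_mod_cast hn0
  rw [lt_min_iff] at hαβ
  have hαβ2 := hαβ.2.le
  rw [le_div_iff₀ (by positivity)] at hαβ2
  obtain ⟨φ, hφ, hφK⟩ : ∃ φ, ∃ _ : IsInterpolation R n φ u, ((latticeEnergy n α φ : ℝ) : EReal) < K := by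
    simpa only [chainEnergy, iInf_lt_iff] using hu
  rw [EReal.coe_lt_coe_iff, latticeEnergy_eq_sum] at hφK
  set e : ℕ → ℝ := fun i => bondEnergy α (φ i) (φ (i + 1)) with he
  have he0 : ∀ i, 0 ≤ e i := fun i => bondEnergy_nonneg hα.2.le _ _
  set E := ∑ i ∈ Finset.range n, e i with hEdef
  have hE0 : 0 ≤ E := Finset.sum_nonneg fun i _ => he0 i
  set F : ℝ → ℝ := fun t => ∑ i ∈ Finset.range ⌊(n : ℝ) * t⌋₊, e i with hFdef
  have hfl : ∀ {t}, t ∈ Ioo (0 : ℝ) 1 → ⌊(n : ℝ) * t⌋₊ < n := fun ht => floor_lt_of_mem_Ioo hn0 ht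
  have hmono : ∀ {a b : ℝ}, a ≤ b → ⌊(n : ℝ) * a⌋₊ ≤ ⌊(n : ℝ) * b⌋₊ := fun hab =>
    Nat.floor_mono (mul_le_mul_of_nonneg_left hab hn'.le)
  have hFsub : ∀ {a b : ℝ}, a ≤ b → ∃ d, ⌊(n : ℝ) * b⌋₊ = ⌊(n : ℝ) * a⌋₊ + d ∧
      F b - F a = ∑ k ∈ Finset.range d, e (⌊(n : ℝ) * a⌋₊ + k) := fun {a b} hab => by
    obtain ⟨d, hd⟩ := Nat.exists_eq_add_of_le (hmono hab)
    refine ⟨d, hd, ?_⟩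
    simp only [hFdef]
    rw [hd, Finset.sum_range_add, add_sub_cancel_left]
  have htrans : ∀ a ∈ Ioo (0 : ℝ) 1, ∀ b ∈ Ioo (0 : ℝ) 1, a < b →
      |(|φ ⌊(n : ℝ) * a⌋₊| - thetaMin β)| < δ →
      |(|φ ⌊(n : ℝ) * b⌋₊| - thetaMin β)| < δ → φ ⌊(n : ℝ) * a⌋₊ * φ ⌊(n : ℝ) * b⌋₊ < 0 → c ≤ F b - F a := by
    intro a ha b hb hab hwa hwb hneg
    obtain ⟨d, hd, hFd⟩ := hFsub hab.le
    rw [hFd]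
    have hb' := hfl hb
    exact hseg α hα hαβ.1 d (fun k => φ (⌊(n : ℝ) * a⌋₊ + k)) (fun k hk => hφ.1 _ (by omega))
      hwa (by rw [hd] at hwb; exact hwb) (by rw [hd] at hneg; exact hneg)
  have htotal : ∀ a ∈ Ioo (0 : ℝ) 1, ∀ b ∈ Ioo (0 : ℝ) 1, a ≤ b → F b - F a ≤ E := by
    intro a ha b hb hab
    have h1 : F b ≤ E := Finset.sum_le_sum_of_subset_of_nonneg
      (Finset.range_subset_range.2 (hfl hb).le) fun i _ _ => he0 i
    have h2 : 0 ≤ F a := Finset.sum_nonneg fun i _ => he0 i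
    linarith
  have hwrap : R 1 (-1) ∨ ∀ a ∈ Ioo (0 : ℝ) 1, ∀ b ∈ Ioo (0 : ℝ) 1, a ≤ b →
      |(|φ ⌊(n : ℝ) * a⌋₊| - thetaMin β)| < δ →
      |(|φ ⌊(n : ℝ) * b⌋₊| - thetaMin β)| < δ → φ ⌊(n : ℝ) * a⌋₊ * φ ⌊(n : ℝ) * b⌋₊ < 0 → 
      F b - F a + c ≤ E := by
    refine hR'.imp_right fun hper a ha b hb hab hwa hwb hneg => ?_
    obtain ⟨d, hd, hFd⟩ := hFsub hab
    have hper' : φ 0 = φ n := hper _ _ hφ.2.1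
    rw [hFd]
    set i := ⌊(n : ℝ) * a⌋₊ with hi
    have hb' := hfl hb
    obtain ⟨r, hr⟩ := Nat.exists_eq_add_of_le hb'.le
    rw [hd] at hr hwb hneg
    -- The chain from `b` through `1 = 0` to `a`.
    set ψ : ℕ → ℝ := fun k => if k ≤ r then φ (i + d + k) else φ (k - r) with hψ
    have hψ1 : ∀ k ≤ r, ψ k = φ (i + d + k) := fun k hk => if_pos hk
    have hψ2 : ∀ k, ψ (r + k) = φ k := fun k => by
      rcases Nat.eq_zero_or_pos k with rfl | hk
      · rw [add_zero, hψ1 r le_rfl, ← hr, hper']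
      · simp only [hψ]
        rw [if_neg (by omega), Nat.add_sub_cancel_left]
    have h1 := hseg α hα hαβ.1 (r + i) ψ
      (fun k hk => by
        rcases le_or_gt k r with h | h
        · rw [hψ1 k h]; exact hφ.1 _ (by omega)
        · obtain ⟨k', rfl⟩ := Nat.exists_eq_add_of_le h.le
          rw [hψ2]; exact hφ.1 _ (by omega))
      (by rw [hψ1 0 (Nat.zero_le _)]; exact hwb) (by rw [hψ2]; exact hwa)
      (by rw [hψ1 0 (Nat.zero_le _), hψ2, mul_comm]; exact hneg)
    have h2 : ∑ k ∈ Finset.range (r + i), bondEnergy α (ψ k) (ψ (k + 1))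
        = ∑ k ∈ Finset.range r, e (i + d + k) + ∑ k ∈ Finset.range i, e k := by
      rw [Finset.sum_range_add]
      congr 1
      · refine Finset.sum_congr rfl fun k hk => ?_
        have := Finset.mem_range.1 hk
        rw [hψ1 k (by omega), hψ1 (k + 1) (by omega)]
        rfl
      · refine Finset.sum_congr rfl fun k _ => ?_
        rw [add_assoc, hψ2, hψ2]
    have h3 : E = ∑ k ∈ Finset.range i, e k + ∑ k ∈ Finset.range d, e (i + k)
        + ∑ k ∈ Finset.range r, e (i + d + k) := by
      rw [hEdef, hr, Finset.sum_range_add, Finset.sum_range_add]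
    linarith
  obtain ⟨m, hRm, hmE, y, hy, hdy⟩ := exists_mem_stepSet_of_transitions (E := E) (R := R) (F := F)
    hδ hδθ hc hE0 hR (hφ.ae_eq hn0) htrans htotal hwrap (half_pos hε)
  refine ⟨m, hRm, ?_, y, hy, hdy.trans ?_⟩
  · have : (m : ℝ) * (creaseEnergy β - ε) ≤ m * c := by gcongr
    linarith
  have hint : ∫ t, |(|u t| - thetaMin β)| ∂muI ≤ 2 * ρ := by
    have h1 : (fun t => |(|u t| - thetaMin β)|) =ᵐ[muI] fun t =>
        (fun i => |(|φ i| - thetaMin β)|) ⌊(n : ℝ) * t⌋₊ := by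
      filter_upwards [hφ.ae_eq hn0] with t ht
      rw [ht]
    rw [integral_congr_ae h1]
    refine (integral_comp_floor_le (h := fun i => |(|φ i| - thetaMin β)|) hn0
      fun i => abs_nonneg _).trans ?_
    have h2 : ∑ i ∈ Finset.range n, |(|φ i| - thetaMin β)|
        ≤ ∑ i ∈ Finset.range n, (ρ + B * (e i + 2 * |α - β|)) :=
      Finset.sum_le_sum fun i hi => by
        have := Finset.mem_range.1 hi
        exact hwell α hα _ (hφ.1 i (by omega)) _ (hφ.1 (i + 1) (by omega))
    rw [Finset.sum_add_distrib, ← Finset.mul_sum, Finset.sum_add_distrib, Finset.sum_const,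
      Finset.sum_const, Finset.card_range, nsmul_eq_mul, nsmul_eq_mul] at h2
    rw [div_le_iff₀ hn']
    have h3 : (n₀ : ℝ) ≤ n := by exact_mod_cast (by omega : n₀ ≤ n)
    have h4 : E ≤ |K| := hφK.le.trans (le_abs_self K)
    have h5 : B * E ≤ B * |K| := by gcongr
    have h6 : (n₀ : ℝ) * ρ ≤ n * ρ := by gcongr
    have h7 : (n : ℝ) * (|α - β| * (4 * B)) ≤ n * ρ := by gcongr
    linarith
  calc D * ∫ t, |(|u t| - thetaMin β)| ∂muI + ε / 2 ≤ D * (2 * ρ) + ε / 2 := by gcongr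
    _ = ε := by rw [hDρ]; ring

/-! ### Upper bound for the chain -/

/-- After magnification, the jumps are far from each other and from the end points. -/
lemma exists_jumps_separated {m : ℕ} {p : ℕ → ℝ} (hp : ∀ j < m, p j ∈ Ioo (0 : ℝ) 1)
    (hp' : ∀ i j, i < j → j < m → p i < p j) (K : ℝ) :
    ∃ n₀ : ℕ, ∀ n : ℕ, n₀ ≤ n → (∀ j < m, K ≤ n * p j ∧ n * p j + K ≤ n) ∧
      ∀ i j, i < j → j < m → n * p i + K ≤ n * p j := by
  have hlim : ∀ x : ℝ, 0 < x → ∀ᶠ n : ℕ in atTop, K ≤ n * x := fun x hx =>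
    (tendsto_natCast_atTop_atTop.atTop_mul_const hx).eventually_ge_atTop K
  have h1 : ∀ᶠ n : ℕ in atTop, ∀ j ∈ Finset.range m, K ≤ n * p j ∧ K ≤ n * (1 - p j) := by
    rw [Filter.eventually_all_finset]
    intro j hj
    have := hp j (Finset.mem_range.1 hj)
    exact (hlim _ this.1).and (hlim _ (by linarith [this.2]))
  have h2 : ∀ᶠ n : ℕ in atTop, ∀ j ∈ Finset.range m, ∀ i ∈ Finset.range j,
      K ≤ n * (p j - p i) := by
    rw [Filter.eventually_all_finset]
    intro j hj
    rw [Filter.eventually_all_finset]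
    intro i hi
    exact hlim _ (sub_pos.2 (hp' i j (Finset.mem_range.1 hi) (Finset.mem_range.1 hj)))
  obtain ⟨n₀, h⟩ := eventually_atTop.1 (h1.and h2)
  refine ⟨n₀, fun n hn => ⟨fun j hj => ?_, fun i j hij hj => ?_⟩⟩
  · have := (h n hn).1 j (Finset.mem_range.2 hj)
    exact ⟨this.1, by linarith [this.2]⟩
  · have := (h n hn).2 j (Finset.mem_range.2 hj) i (Finset.mem_range.2 hij)
    linarith

lemma prod_eq_one_or_neg_one {S : Finset ℕ} {f : ℕ → ℝ} (h : ∀ j ∈ S, f j = 1 ∨ f j = -1) :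
    ∏ j ∈ S, f j = 1 ∨ ∏ j ∈ S, f j = -1 := by
  refine Finset.prod_induction f (fun x => x = 1 ∨ x = -1) ?_ (Or.inl rfl) h
  rintro a b (rfl | rfl) (rfl | rfl) <;> norm_num

/-- The angles of a crease `ζ` divided by `- θ_α` and translated by `k`; away from the crease the
value is `1` on the left and `-1` on the right. -/
noncomputable def creaseFactor (α : ℝ) (ζ : ℤ → ℝ) (k : ℤ) (i : ℤ) : ℝ :=
  -(ζ (i + k) / thetaMin α)

lemma IsCrease.creaseFactor_left {α : ℝ} (hα : α ∈ Ico (0 : ℝ) 4) {N : ℕ} {ζ : ℤ → ℝ}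
    (h : IsCrease α N ζ) {k i : ℤ} (hi : i + k ≤ -(N : ℤ)) : creaseFactor α ζ k i = 1 := by
  rw [creaseFactor, h.eq_neg hi, neg_div, neg_neg, div_self (thetaMin_pos hα.2).ne']

lemma IsCrease.creaseFactor_right {α : ℝ} (hα : α ∈ Ico (0 : ℝ) 4) {N : ℕ} {ζ : ℤ → ℝ}
    (h : IsCrease α N ζ) {k i : ℤ} (hi : (N : ℤ) ≤ i + k) (h0 : 0 < i + k) :
    creaseFactor α ζ k i = -1 := by
  rw [creaseFactor, h.eq_pos hi h0, div_self (thetaMin_pos hα.2).ne']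

/-- Chain with creases at the sites `-k j`. As at most one factor differs from `± 1`, it
coincides, up to the sign, with one of the creases or with a well. -/
noncomputable def multiCrease (α : ℝ) (ζ : ℤ → ℝ) (s : ℝ) (m : ℕ) (k : ℕ → ℤ) (i : ℤ) : ℝ :=
  thetaMin α * (s * ∏ j ∈ Finset.range m, creaseFactor α ζ (k j) i)

lemma multiCrease_bond {α : ℝ} (hα : α ∈ Ico (0 : ℝ) 4) {N : ℕ} {ζ : ℤ → ℝ}
    (h : IsCrease α N ζ) {s : ℝ} (hs : s = 1 ∨ s = -1) {m : ℕ} {k : ℕ → ℤ}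
    (hk : ∀ i j, i < j → j < m → k j + (2 * N + 2) ≤ k i) (i : ℤ) :
    ∃ σ x y : ℝ, (σ = 1 ∨ σ = -1) ∧ multiCrease α ζ s m k i = σ * x ∧
      multiCrease α ζ s m k (i + 1) = σ * y ∧ ((x = thetaMin α ∧ y = thetaMin α) ∨
        ∃ j < m, x = ζ (i + k j) ∧ y = ζ (i + 1 + k j)) := by
  have hθ := thetaMin_pos hα.2
  have hfar : ∀ j, ¬ (-(N : ℤ) - 1 ≤ i + k j ∧ i + k j ≤ N) →
      creaseFactor α ζ (k j) (i + 1) = creaseFactor α ζ (k j) i ∧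
        (creaseFactor α ζ (k j) i = 1 ∨ creaseFactor α ζ (k j) i = -1) := by
    intro j hj
    rw [not_and_or, not_le, not_le] at hj
    rcases hj with hj | hj
    · rw [h.creaseFactor_left hα (by omega), h.creaseFactor_left hα (by omega)]
      simp
    · rw [h.creaseFactor_right hα (by omega) (by omega),
        h.creaseFactor_right hα (by omega) (by omega)]
      simp
  by_cases hex : ∃ j < m, -(N : ℤ) - 1 ≤ i + k j ∧ i + k j ≤ N
  · obtain ⟨j, hj, h1, h2⟩ := hex
    have hother : ∀ l ∈ (Finset.range m).erase j, ¬ (-(N : ℤ) - 1 ≤ i + k l ∧ i + k l ≤ N) := by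
      intro l hl
      rw [Finset.mem_erase, Finset.mem_range] at hl
      rcases lt_or_gt_of_ne hl.1 with h' | h'
      · have := hk l j h' hj; omega
      · have := hk j l h' hl.2; omega
    have e : ∀ i', multiCrease α ζ s m k i' = (-s * ∏ l ∈ (Finset.range m).erase j,
        creaseFactor α ζ (k l) i') * ζ (i' + k j) := by
      intro i'
      rw [multiCrease, ← Finset.mul_prod_erase _ _ (Finset.mem_range.2 hj)]
      simp only [creaseFactor]
      field_simp
    have e' : ∏ l ∈ (Finset.range m).erase j, creaseFactor α ζ (k l) (i + 1)
        = ∏ l ∈ (Finset.range m).erase j, creaseFactor α ζ (k l) i :=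
      Finset.prod_congr rfl fun l hl => (hfar l (hother l hl)).1
    refine ⟨_, _, _, ?_, e i, by rw [e (i + 1), e'], Or.inr ⟨j, hj, rfl, rfl⟩⟩
    rcases prod_eq_one_or_neg_one fun l hl => (hfar l (hother l hl)).2 with h3 | h3 <;>
      rcases hs with rfl | rfl <;> rw [h3] <;> norm_num
  · push Not at hex
    have hex' : ∀ j ∈ Finset.range m, ¬ (-(N : ℤ) - 1 ≤ i + k j ∧ i + k j ≤ N) :=
      fun j hj hcon => absurd hcon.2 (not_le.2 (hex j (Finset.mem_range.1 hj) hcon.1))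
    refine ⟨s * ∏ j ∈ Finset.range m, creaseFactor α ζ (k j) i, thetaMin α, thetaMin α, ?_,
      mul_comm _ _, ?_, Or.inl ⟨rfl, rfl⟩⟩
    · rcases prod_eq_one_or_neg_one fun l hl => (hfar l (hex' l hl)).2 with h3 | h3 <;>
        rcases hs with rfl | rfl <;> rw [h3] <;> norm_num
    · rw [multiCrease, Finset.prod_congr rfl fun l hl => (hfar l (hex' l hl)).1, mul_comm]

lemma sign_mul_mem_angles {s x : ℝ} (hs : s = 1 ∨ s = -1)
    (hx : x ∈ Icc (-(Real.pi / 2)) (Real.pi / 2)) :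
    s * x ∈ Icc (-(Real.pi / 2)) (Real.pi / 2) := by
  rcases hs with rfl | rfl
  · simpa using hx
  · simpa using neg_mem_angles hx

lemma multiCrease_mem {α : ℝ} (hα : α ∈ Ico (0 : ℝ) 4) {N : ℕ} {ζ : ℤ → ℝ}
    (h : IsCrease α N ζ) {s : ℝ} (hs : s = 1 ∨ s = -1) {m : ℕ} {k : ℕ → ℤ}
    (hk : ∀ i j, i < j → j < m → k j + (2 * N + 2) ≤ k i) (i : ℤ) :
    multiCrease α ζ s m k i ∈ Icc (-(Real.pi / 2)) (Real.pi / 2) := by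
  obtain ⟨σ, x, y, hσ, hx, -, hxy⟩ := multiCrease_bond hα h hs hk i
  rw [hx]
  rcases hxy with ⟨rfl, -⟩ | ⟨j, -, rfl, -⟩
  · exact sign_mul_mem_angles hσ (thetaMin_mem hα)
  · exact sign_mul_mem_angles hσ (h.1 _)

/-- The energy of a chain with `m` creases is at most `m` times the energy of one crease. -/
lemma sum_multiCrease_le {α : ℝ} (hα : α ∈ Ico (0 : ℝ) 4) {N : ℕ} {ζ : ℤ → ℝ}
    (h : IsCrease α N ζ) {s : ℝ} (hs : s = 1 ∨ s = -1) {m : ℕ} {k : ℕ → ℤ}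
    (hk : ∀ i j, i < j → j < m → k j + (2 * N + 2) ≤ k i) (n : ℕ) :
    ∑ i ∈ Finset.range n, bondEnergy α (multiCrease α ζ s m k i) (multiCrease α ζ s m k (i + 1))
      ≤ m * ∑' i : ℤ, bondEnergy α (ζ i) (ζ (i + 1)) := by
  have hnn : ∀ x y, 0 ≤ bondEnergy α x y := fun x y => bondEnergy_nonneg hα.2.le x y
  calc ∑ i ∈ Finset.range n, bondEnergy α (multiCrease α ζ s m k i) (multiCrease α ζ s m k (i + 1))
      ≤ ∑ i ∈ Finset.range n, ∑ j ∈ Finset.range m,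
          bondEnergy α (ζ (i + k j)) (ζ (i + 1 + k j)) := by
        refine Finset.sum_le_sum fun i _ => ?_
        obtain ⟨σ, x, y, hσ, hx, hy, hxy⟩ := multiCrease_bond hα h hs hk i
        rw [hx, hy, bondEnergy_sign_mul α x y hσ]
        rcases hxy with ⟨rfl, rfl⟩ | ⟨j, hj, rfl, rfl⟩
        · rw [bondEnergy_thetaMin hα]
          exact Finset.sum_nonneg fun j _ => hnn _ _
        · exact Finset.single_le_sum
            (f := fun j => bondEnergy α (ζ (i + k j)) (ζ (i + 1 + k j)))
            (fun j _ => hnn _ _) (Finset.mem_range.2 hj)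
    _ = ∑ j ∈ Finset.range m, ∑ i ∈ Finset.range n,
          bondEnergy α (ζ (i + k j)) (ζ (i + 1 + k j)) := Finset.sum_comm
    _ ≤ ∑ _j ∈ Finset.range m, ∑' i : ℤ, bondEnergy α (ζ i) (ζ (i + 1)) :=
        Finset.sum_le_sum fun j _ => h.sum_range_le hα n (k j)
    _ = m * ∑' i : ℤ, bondEnergy α (ζ i) (ζ (i + 1)) := by simp

lemma stepFn_of_far {α : ℝ} (hα : α ∈ Ico (0 : ℝ) 4) {N : ℕ} {ζ : ℤ → ℝ}
    (h : IsCrease α N ζ) {s : ℝ} {m : ℕ} {p : ℕ → ℝ} {n : ℕ} {t : ℝ} (ht : 0 ≤ t)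
    (hfar : ∀ j < m, n * t < n * p j - (N + 2) ∨ n * p j + (N + 2) < n * t) :
    multiCrease α ζ s m (fun j => -⌊(n : ℝ) * p j⌋) ⌊(n : ℝ) * t⌋₊ = thetaMin α * stepFn s m p t := by
  have hfl : ((⌊(n : ℝ) * t⌋₊ : ℕ) : ℤ) = ⌊(n : ℝ) * t⌋ :=
    Int.natCast_floor_eq_floor (by positivity)
  have hn : (0 : ℝ) ≤ n := Nat.cast_nonneg n
  rw [multiCrease, stepFn, hfl]
  congr 2
  refine Finset.prod_congr rfl fun j hj => ?_
  have hf1 := Int.floor_le ((n : ℝ) * t)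
  have hf2 := Int.lt_floor_add_one ((n : ℝ) * t)
  have hf3 := Int.floor_le ((n : ℝ) * p j)
  have hf4 := Int.lt_floor_add_one ((n : ℝ) * p j)
  have hN : (0 : ℝ) ≤ N := Nat.cast_nonneg N
  rcases hfar j (Finset.mem_range.1 hj) with h1 | h1
  · rw [if_pos (by by_contra! hcon; nlinarith), h.creaseFactor_left hα]
    have : ((⌊(n : ℝ) * t⌋ + -⌊(n : ℝ) * p j⌋ : ℤ) : ℝ) ≤ ((-(N : ℤ) : ℤ) : ℝ) := by
      push_cast; linarith
    exact_mod_cast this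
  · rw [if_neg (by intro hcon; nlinarith)]
    have : ((N + 1 : ℤ) : ℝ) ≤ ((⌊(n : ℝ) * t⌋ + -⌊(n : ℝ) * p j⌋ : ℤ) : ℝ) := by
      push_cast; linarith
    have this' : (N + 1 : ℤ) ≤ ⌊(n : ℝ) * t⌋ + -⌊(n : ℝ) * p j⌋ := by exact_mod_cast this
    rw [h.creaseFactor_right hα (by omega) (by omega)]

/-- Step functions are approximated by chains with almost optimal creases, with a fixed number of
angles in each crease, uniformly in the parameter near `β`. -/
theorem chainEnergy_upper {β : ℝ} (hβ : β ∈ Ico (0 : ℝ) 4) {R : ℝ → ℝ → Prop}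
    (hR : ∀ c x y, R x y → R (c * x) (c * y)) {m : ℕ} (hm : R 1 ((-1) ^ m)) {y : L1I}
    (hy : y ∈ stepSet (thetaMin β) m) {ε : ℝ} (hε : 0 < ε) :
    ∃ n₀ : ℕ, ∃ η > 0, ∀ n ≥ n₀, ∀ α ∈ Ico (0 : ℝ) 4, |α - β| < η → ∃ u : L1I,
      dist u y ≤ ε ∧ chainEnergy R n α u ≤ ((m * creaseEnergy β + ε : ℝ) : EReal) := by
  obtain ⟨s, p, hs, hp, hp', hys⟩ := hy
  obtain ⟨N, η₁, hη₁, hcrease⟩ := exists_isCrease_near hβ (ε := ε / (m + 1)) (by positivity)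
  obtain ⟨η₂, hη₂, hth⟩ := exists_thetaMin_near β (half_pos hε)
  obtain ⟨n₁, hsep⟩ := exists_jumps_separated hp hp' (2 * N + 4)
  obtain ⟨n₂, hn₂⟩ := exists_nat_gt (m * (2 * (N + 2) * Real.pi) / (ε / 2))
  rw [div_lt_iff₀ (by positivity)] at hn₂
  refine ⟨n₁ + n₂ + 1, min η₁ η₂, lt_min hη₁ hη₂, fun n hn α hα hαβ => ?_⟩
  rw [lt_min_iff] at hαβ
  have hn0 : 0 < n := by omega
  have hn' : (0 : ℝ) < n := by exact_mod_cast hn0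
  have hN : (0 : ℝ) ≤ N := Nat.cast_nonneg N
  obtain ⟨hsep1, hsep2⟩ := hsep n (by omega)
  obtain ⟨ζ, hζ, hζE⟩ := hcrease α hα hαβ.1
  have hθ := thetaMin_pos hα.2
  set k : ℕ → ℤ := fun j => -⌊(n : ℝ) * p j⌋ with hkdef
  have hk : ∀ i j, i < j → j < m → k j + (2 * N + 2) ≤ k i := by
    intro i j hij hj
    have h1 := hsep2 i j hij hj
    have h2 := Int.floor_le ((n : ℝ) * p i)
    have h3 := Int.lt_floor_add_one ((n : ℝ) * p j)
    have : ((k j + (2 * N + 2) : ℤ) : ℝ) ≤ ((k i : ℤ) : ℝ) := by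
      simp only [hkdef]; push_cast; linarith
    exact_mod_cast this
  set φ : ℕ → ℝ := fun i => multiCrease α ζ s m k i with hφ
  have hφmem : ∀ i, φ i ∈ Icc (-(Real.pi / 2)) (Real.pi / 2) := fun i =>
    multiCrease_mem hα hζ hs hk i
  have hint : Integrable (fun t => φ ⌊(n : ℝ) * t⌋₊) muI := by
    refine integrable_muI_of_abs_le (C := Real.pi / 2) ?_ fun t _ => abs_le.2 (hφmem _)
    exact ((measurable_from_nat (f := φ)).comp
      (Nat.measurable_floor.comp (measurable_const_mul _))).aestronglyMeasurable
  refine ⟨hint.toL1 _, ?_, ?_⟩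
  · have hpi := Real.pi_pos
    have h := dist_le_of_near_jumps (u := hint.toL1 _) (y := y) (e := ε / 2) (D := Real.pi)
      (r := (N + 2) / n) (m := m) (p := p) (by positivity) (by
        filter_upwards [hint.coeFn_toL1, hys, ae_restrict_mem measurableSet_Ioo] with t h1 h2 ht
        rw [h1, h2]
        have hnn : ∀ j, 0 ≤ (Icc (p j - (N + 2) / n) (p j + (N + 2) / n)).indicator
            (fun _ => Real.pi) t := fun j => indicator_nonneg (fun _ _ => hpi.le) _
        by_cases hfar : ∀ j < m, n * t < n * p j - (N + 2) ∨ n * p j + (N + 2) < n * t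
        · have h3 : φ ⌊(n : ℝ) * t⌋₊ = thetaMin α * stepFn s m p t :=
            stepFn_of_far hα hζ ht.1.le hfar
          rw [h3, ← sub_mul, abs_mul, abs_stepFn hs, mul_one]
          exact le_add_of_le_of_nonneg (hth α hαβ.2) (Finset.sum_nonneg fun j _ => hnn j)
        · push Not at hfar
          obtain ⟨j, hj, hj1, hj2⟩ := hfar
          have h4 : t ∈ Icc (p j - (N + 2) / n) (p j + (N + 2) / n) := by
            have h41 : p j - t ≤ (N + 2) / n := (le_div_iff₀ hn').2 (by linarith)
            have h42 : t - p j ≤ (N + 2) / n := (le_div_iff₀ hn').2 (by linarith)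
            exact ⟨by linarith, by linarith⟩
          have h5 := Finset.single_le_sum (f := fun j => (Icc (p j - (N + 2) / n)
            (p j + (N + 2) / n)).indicator (fun _ => Real.pi) t)
            (fun j _ => hnn j) (Finset.mem_range.2 hj)
          rw [indicator_of_mem h4] at h5
          have h6 : |φ ⌊(n : ℝ) * t⌋₊| ≤ Real.pi / 2 := abs_le.2 (hφmem _)
          have h7 : |thetaMin β * stepFn s m p t| ≤ Real.pi / 2 := by
            rw [abs_mul, abs_stepFn hs, mul_one, abs_of_pos (thetaMin_pos hβ.2)]
            exact thetaMin_le hβ.1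
          have h8 := abs_sub (φ ⌊(n : ℝ) * t⌋₊) (thetaMin β * stepFn s m p t)
          linarith) hpi.le
    refine h.trans ?_
    have h9 : m * (2 * ((N + 2) / n) * Real.pi) ≤ ε / 2 := by
      have e : m * (2 * ((N + 2) / n) * Real.pi) = m * (2 * (N + 2) * Real.pi) / n := by ring
      rw [e, div_le_iff₀ hn']
      have h10 : (n₂ : ℝ) ≤ n := by exact_mod_cast (by omega : n₂ ≤ n)
      nlinarith
    linarith
  · have hinterp : IsInterpolation R n φ (hint.toL1 _) := by
      refine ⟨fun i _ => hφmem i, ?_, fun i hi => ?_⟩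
      · have h0 : φ 0 = thetaMin α * s * 1 := by
          simp only [hφ, multiCrease]
          rw [Finset.prod_eq_one, mul_assoc]
          intro j hj
          refine hζ.creaseFactor_left hα ?_
          have h1 := (hsep1 j (Finset.mem_range.1 hj)).1
          have h2 := Int.lt_floor_add_one ((n : ℝ) * p j)
          have : (((0 : ℕ) + k j : ℤ) : ℝ) ≤ ((-(N : ℤ) : ℤ) : ℝ) := by
            simp only [hkdef]; push_cast; linarith
          exact_mod_cast this
        have h1 : φ n = thetaMin α * s * (-1) ^ m := by
          simp only [hφ, multiCrease]
          rw [Finset.prod_congr rfl (g := fun _ => (-1 : ℝ)), Finset.prod_const, Finset.card_range,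
            mul_assoc]
          intro j hj
          have h1 := (hsep1 j (Finset.mem_range.1 hj)).2
          have h2 := Int.floor_le ((n : ℝ) * p j)
          have : ((N + 1 : ℤ) : ℝ) ≤ ((n + k j : ℤ) : ℝ) := by
            simp only [hkdef]; push_cast; linarith
          have this' : (N + 1 : ℤ) ≤ n + k j := by exact_mod_cast this
          exact hζ.creaseFactor_right hα (by omega) (by omega)
        rw [h0, h1]
        exact hR _ _ _ hm
      · filter_upwards [hint.coeFn_toL1] with t ht hti
        rw [ht]
        congr 1
        have h1 := (div_lt_iff₀ hn').1 hti.1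
        have h2 := (lt_div_iff₀ hn').1 hti.2
        have hi0 : (0 : ℝ) ≤ i := Nat.cast_nonneg i
        rw [Nat.floor_eq_iff (by linarith)]
        constructor <;> linarith
    refine (iInf₂_le (f := fun (φ : ℕ → ℝ) (_ : IsInterpolation R n φ (hint.toL1 _)) =>
      ((latticeEnergy n α φ : ℝ) : EReal)) φ hinterp).trans (EReal.coe_le_coe_iff.2 ?_)
    rw [latticeEnergy_eq_sum]
    have h1 := sum_multiCrease_le hα hζ hs hk n
    have h2 : (m : ℝ) * ∑' i : ℤ, bondEnergy α (ζ i) (ζ (i + 1))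
        ≤ m * (creaseEnergy β + ε / (m + 1)) := by gcongr
    have h3 : (m : ℝ) * (ε / (m + 1)) ≤ ε := by
      rw [mul_div_assoc', div_le_iff₀ (by positivity)]
      nlinarith
    simp only [hφ]
    push_cast
    linarith

/-! ### Sobolev functions and absolutely continuous representatives -/

lemma integral_muI_eq_intervalIntegral (f : ℝ → ℝ) : ∫ t, f t ∂muI = ∫ t in (0 : ℝ)..1, f t := by
  rw [intervalIntegral.integral_of_le zero_le_one, integral_Ioc_eq_integral_Ioo]

lemma integrable_muI_iff (f : ℝ → ℝ) : Integrable f muI ↔ IntervalIntegrable f volume 0 1 := by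
  rw [intervalIntegrable_iff_integrableOn_Ioo_of_le zero_le_one, IntegrableOn]

lemma eq_zero_of_tsupport_subset {η : ℝ → ℝ} (h : tsupport η ⊆ Ioo (0 : ℝ) 1) {t : ℝ}
    (ht : t ∉ Ioo (0 : ℝ) 1) : η t = 0 :=
  image_eq_zero_of_notMem_tsupport fun h' => ht (h h')

lemma integrable_mul_test {f η : ℝ → ℝ} (hf : Integrable f muI) (hη : Continuous η)
    (hc : HasCompactSupport η) : Integrable (fun t => f t * η t) muI := by
  obtain ⟨C, hC⟩ := hη.bounded_above_of_compact_support hc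
  exact hf.mul_bdd (c := C) hη.aestronglyMeasurable (Eventually.of_forall hC)

/-- The fundamental lemma of the calculus of variations on `I`. -/
lemma ae_eq_zero_of_integral_mul_test {f : ℝ → ℝ} (hf : Integrable f muI)
    (h : ∀ η : ℝ → ℝ, ContDiff ℝ ∞ η → HasCompactSupport η → tsupport η ⊆ Ioo (0 : ℝ) 1 →
      ∫ t in Ioo (0 : ℝ) 1, f t * η t = 0) : f =ᵐ[muI] 0 := by
  have hf' : IntegrableOn f (Ioo 0 1) volume := hf
  have := isOpen_Ioo.ae_eq_zero_of_integral_contDiff_smul_eq_zero hf'.locallyIntegrableOn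
    fun η h1 h2 h3 => by
      rw [← h η h1 h2 h3, ← setIntegral_eq_integral_of_forall_compl_eq_zero
        (s := Ioo (0 : ℝ) 1) fun t ht => by rw [eq_zero_of_tsupport_subset h3 ht, zero_smul]]
      simp only [smul_eq_mul, mul_comm]
  exact (ae_restrict_iff' measurableSet_Ioo).2 this

/-- The lemma of du Bois-Reymond. A test function `ψ` with integral `a` equals `η' + a ρ`, where `ρ`
is a fixed bump function with integral `1` and `η` is the primitive of `ψ - a ρ`. -/
lemma ae_eq_const_of_integral_mul_deriv_eq_zero {f : ℝ → ℝ} (hf : Integrable f muI)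
    (h : ∀ η : ℝ → ℝ, ContDiff ℝ ∞ η → HasCompactSupport η → tsupport η ⊆ Ioo (0 : ℝ) 1 →
      ∫ t in Ioo (0 : ℝ) 1, f t * deriv η t = 0) : ∃ c : ℝ, f =ᵐ[muI] fun _ => c := by
  obtain ⟨ρ, hρ, hρc, hρs, hρ1⟩ : ∃ ρ : ℝ → ℝ, ContDiff ℝ ∞ ρ ∧ HasCompactSupport ρ ∧
      tsupport ρ ⊆ Ioo (0 : ℝ) 1 ∧ ∫ t, ρ t = 1 := by
    let b : ContDiffBump (1 / 2 : ℝ) := ⟨1 / 8, 1 / 4, by norm_num, by norm_num⟩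
    refine ⟨b.normed volume, b.contDiff_normed, b.hasCompactSupport_normed, ?_, b.integral_normed⟩
    rw [b.tsupport_normed_eq, Real.closedBall_eq_Icc]
    exact Icc_subset_Ioo (by norm_num) (by norm_num)
  set c := ∫ t in Ioo (0 : ℝ) 1, f t * ρ t with hc
  refine ⟨c, ?_⟩
  have hfc : Integrable (fun t => f t - c) muI := hf.sub (integrable_const c)
  suffices hz : (fun t => f t - c) =ᵐ[muI] 0 by
    filter_upwards [hz] with t ht
    simpa [sub_eq_zero] using ht
  refine ae_eq_zero_of_integral_mul_test hfc fun ψ hψ hψc hψs => ?_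
  set a := ∫ t, ψ t with ha
  set κ : ℝ → ℝ := fun t => ψ t - a * ρ t with hκ
  have hκd : ContDiff ℝ ∞ κ := hψ.sub (contDiff_const.mul hρ)
  have hκcont := hκd.continuous
  have hψi : Integrable ψ := hψ.continuous.integrable_of_hasCompactSupport hψc
  have hρi : Integrable ρ := hρ.continuous.integrable_of_hasCompactSupport hρc
  have hκint : ∫ t, κ t = 0 := by
    rw [integral_sub hψi (hρi.const_mul a), integral_const_mul, hρ1]; ring
  -- Both supports lie in some `[l, r] ⊆ (0, 1)`.
  obtain ⟨l, r, hl, hr, hψ0, hρ0⟩ : ∃ l r : ℝ, 0 < l ∧ r < 1 ∧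
      (∀ t, t ∉ Icc l r → ψ t = 0) ∧ (∀ t, t ∉ Icc l r → ρ t = 0) := by
    have hK : IsCompact (tsupport ψ ∪ tsupport ρ) := hψc.isCompact.union hρc.isCompact
    have hKs : tsupport ψ ∪ tsupport ρ ⊆ Ioo 0 1 := union_subset hψs hρs
    have hKne : (tsupport ψ ∪ tsupport ρ).Nonempty := by
      rw [nonempty_iff_ne_empty]
      intro he
      have h0 : ρ = 0 := tsupport_eq_empty_iff.1 (union_empty_iff.1 he).2
      rw [h0] at hρ1
      simp at hρ1
    obtain ⟨l, hl, hl'⟩ := hK.exists_isLeast hKne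
    obtain ⟨r, hr, hr'⟩ := hK.exists_isGreatest hKne
    refine ⟨l, r, (hKs hl).1, (hKs hr).2, fun t ht => ?_, fun t ht => ?_⟩
    · exact image_eq_zero_of_notMem_tsupport fun h => ht ⟨hl' (Or.inl h), hr' (Or.inl h)⟩
    · exact image_eq_zero_of_notMem_tsupport fun h => ht ⟨hl' (Or.inr h), hr' (Or.inr h)⟩
  have hκ0 : ∀ t, t ∉ Icc l r → κ t = 0 := fun t ht => by
    simp only [hκ]; rw [hψ0 t ht, hρ0 t ht]; ring
  set η : ℝ → ℝ := fun x => ∫ t in (0 : ℝ)..x, κ t with hη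
  have hηd : ∀ x, HasDerivAt η (κ x) x := fun x =>
    intervalIntegral.integral_hasDerivAt_right (hκcont.intervalIntegrable _ _)
      (hκcont.stronglyMeasurableAtFilter _ _) hκcont.continuousAt
  have hηderiv : deriv η = κ := funext fun x => (hηd x).deriv
  have hηC : ContDiff ℝ ∞ η := by
    rw [contDiff_infty_iff_deriv, hηderiv]
    exact ⟨fun x => (hηd x).differentiableAt, hκd⟩
  have hη0 : ∀ x, x ∉ Icc l r → η x = 0 := by
    intro x hx
    rw [mem_Icc, not_and_or, not_le, not_le] at hx
    rcases hx with hx | hx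
    · refine intervalIntegral.integral_zero_ae (Eventually.of_forall fun t ht => hκ0 t fun h => ?_)
      have := ht.2
      rcases max_cases (0 : ℝ) x with ⟨h1, -⟩ | ⟨h1, -⟩ <;> rw [h1] at this <;> linarith [h.1]
    · rcases le_or_gt l r with hlr | hlr
      · simp only [hη]
        rw [intervalIntegral.integral_of_le (by linarith)]
        refine (setIntegral_eq_integral_of_forall_compl_eq_zero fun t ht =>
          hκ0 t fun h => ht ?_).trans hκint
        exact ⟨hl.trans_le h.1, h.2.trans hx.le⟩
      · refine intervalIntegral.integral_zero_ae (Eventually.of_forall fun t ht => hκ0 t fun h => ?_)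
        linarith [h.1, h.2]
  have hηs : tsupport η ⊆ Icc l r :=
    closure_minimal (fun x hx => by by_contra hcon; exact hx (hη0 x hcon)) isClosed_Icc
  have h1 := h η hηC (HasCompactSupport.of_support_subset_isCompact isCompact_Icc
    ((subset_tsupport η).trans hηs)) (hηs.trans (Icc_subset_Ioo hl hr))
  rw [hηderiv] at h1
  have h2 : ∫ t in Ioo (0 : ℝ) 1, ψ t = a :=
    setIntegral_eq_integral_of_forall_compl_eq_zero fun t ht => eq_zero_of_tsupport_subset hψs ht
  have i1 := integrable_mul_test hf hψ.continuous hψc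
  have i2 := integrable_mul_test hf hρ.continuous hρc
  have h3 : ∫ t in Ioo (0 : ℝ) 1, f t * κ t = (∫ t in Ioo (0 : ℝ) 1, f t * ψ t) - a * c := by
    rw [hc, ← integral_const_mul, ← integral_sub i1 (i2.const_mul a)]
    refine integral_congr_ae (Eventually.of_forall fun t => ?_)
    simp only [hκ]; ring
  have h4 : ∫ t in Ioo (0 : ℝ) 1, (f t - c) * ψ t = (∫ t in Ioo (0 : ℝ) 1, f t * ψ t) - c * a := by
    rw [← h2, ← integral_const_mul, ← integral_sub i1 (hψi.restrict.const_mul c)]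
    refine integral_congr_ae (Eventually.of_forall fun t => ?_)
    simp only; ring
  rw [h4]
  linarith

lemma IsWeakDeriv.congr_left {u v g : ℝ → ℝ} (h : IsWeakDeriv u g) (huv : u =ᵐ[muI] v) :
    IsWeakDeriv v g := by
  refine ⟨h.1, fun η h1 h2 h3 => ?_⟩
  rw [← h.2 η h1 h2 h3]
  refine integral_congr_ae ?_
  filter_upwards [huv] with t ht
  rw [ht]

lemma IsWeakDeriv.congr_right {u g g' : ℝ → ℝ} (h : IsWeakDeriv u g) (hg : g =ᵐ[muI] g') :
    IsWeakDeriv u g' := by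
  refine ⟨(memLp_congr_ae hg).1 h.1, fun η h1 h2 h3 => ?_⟩
  rw [h.2 η h1 h2 h3]
  congr 1
  refine integral_congr_ae ?_
  filter_upwards [hg] with t ht
  rw [ht]

lemma IsWeakDeriv.integrable {u g : ℝ → ℝ} (h : IsWeakDeriv u g) : Integrable g muI :=
  h.1.integrable (by norm_num)

lemma IsWeakDeriv.unique {u g g' : ℝ → ℝ} (h : IsWeakDeriv u g) (h' : IsWeakDeriv u g') :
    g =ᵐ[muI] g' := by
  have hz : (fun t => g t - g' t) =ᵐ[muI] 0 := by
    refine ae_eq_zero_of_integral_mul_test (h.integrable.sub h'.integrable) fun η h1 h2 h3 => ?_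
    have e1 := h.2 η h1 h2 h3
    have e2 := h'.2 η h1 h2 h3
    simp only [sub_mul]
    rw [integral_sub (integrable_mul_test h.integrable h1.continuous h2)
      (integrable_mul_test h'.integrable h1.continuous h2)]
    linarith
  filter_upwards [hz] with t ht
  simpa [sub_eq_zero] using ht

lemma IsWeakDeriv.weakDeriv_ae_eq {u g : ℝ → ℝ} (h : IsWeakDeriv u g) : weakDeriv u =ᵐ[muI] g := by
  have hex : ∃ g, IsWeakDeriv u g := ⟨g, h⟩
  rw [weakDeriv, dif_pos hex]
  exact hex.choose_spec.unique h

lemma isWeakDeriv_deriv {w : ℝ → ℝ} (hw : AbsolutelyContinuousOnInterval w 0 1)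
    (hw' : MemLp (deriv w) 2 muI) : IsWeakDeriv w (deriv w) := by
  refine ⟨hw', fun η h1 h2 h3 => ?_⟩
  have hη : AbsolutelyContinuousOnInterval η 0 1 :=
    (h1.of_le (by simp)).contDiffOn.absolutelyContinuousOnInterval
  have h := hw.integral_mul_deriv_eq_deriv_mul hη
  rw [eq_zero_of_tsupport_subset h3 (by simp : (1 : ℝ) ∉ Ioo (0 : ℝ) 1),
    eq_zero_of_tsupport_subset h3 (by simp : (0 : ℝ) ∉ Ioo (0 : ℝ) 1)] at h
  rw [integral_muI_eq_intervalIntegral, integral_muI_eq_intervalIntegral, h]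
  ring

/-- Functions in `W^{1,2}(I)` have absolutely continuous representatives. -/
lemma IsWeakDeriv.exists_absolutelyContinuous {u g : ℝ → ℝ} (hu : Integrable u muI)
    (h : IsWeakDeriv u g) :
    ∃ w : ℝ → ℝ, AbsolutelyContinuousOnInterval w 0 1 ∧ u =ᵐ[muI] w ∧ deriv w =ᵐ[muI] g := by
  have hg : IntervalIntegrable g volume 0 1 := (integrable_muI_iff g).1 h.integrable
  set v : ℝ → ℝ := fun x => ∫ t in (0 : ℝ)..x, g t with hv
  have hvac : AbsolutelyContinuousOnInterval v 0 1 :=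
    hg.absolutelyContinuousOnInterval_intervalIntegral (by simp)
  have hvd : ∀ᵐ x ∂muI, HasDerivAt v (g x) x := by
    filter_upwards [ae_restrict_of_ae hg.ae_hasDerivAt_integral,
      ae_restrict_mem measurableSet_Ioo] with x hx hx'
    rw [uIcc_of_le zero_le_one] at hx
    exact hx (Ioo_subset_Icc_self hx') 0 (by simp)
  have hvd' : deriv v =ᵐ[muI] g := hvd.mono fun x hx => hx.deriv
  have hvw : IsWeakDeriv v g :=
    (isWeakDeriv_deriv hvac ((memLp_congr_ae hvd').2 h.1)).congr_right hvd'
  have hvi : Integrable v muI :=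
    (integrable_muI_iff v).2 hvac.continuousOn.intervalIntegrable
  obtain ⟨c, hc⟩ := ae_eq_const_of_integral_mul_deriv_eq_zero (hu.sub hvi) fun η h1 h2 h3 => by
    have hd : Continuous (deriv η) := h1.continuous_deriv (by simp)
    simp only [Pi.sub_apply, sub_mul]
    rw [integral_sub (integrable_mul_test hu hd h2.deriv) (integrable_mul_test hvi hd h2.deriv),
      h.2 η h1 h2 h3, hvw.2 η h1 h2 h3, sub_self]
  refine ⟨fun x => v x + c, ?_, ?_, ?_⟩
  · exact hvac.add (LipschitzOnWith.absolutelyContinuousOnInterval (K := 0)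
      (LipschitzWith.const c).lipschitzOnWith)
  · filter_upwards [hc] with t ht
    simp only [Pi.sub_apply] at ht
    linarith
  · filter_upwards [hvd] with x hx
    exact (hx.add_const c).deriv

/-- The boundary condition is the one for the absolutely continuous representative. -/
lemma MemW12Bdry.exists_absolutelyContinuous {R : ℝ → ℝ → Prop} {u : ℝ → ℝ}
    (h : MemW12Bdry R u) :
    ∃ w : ℝ → ℝ, AbsolutelyContinuousOnInterval w 0 1 ∧ u =ᵐ[muI] w ∧
      weakDeriv u =ᵐ[muI] deriv w ∧ MemLp (deriv w) 2 muI ∧ R (w 0) (w 1) := by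
  obtain ⟨⟨hu2, g, hg⟩, w', hw', huw', hR⟩ := h
  obtain ⟨w, hw, huw, hwg⟩ := hg.exists_absolutelyContinuous (hu2.integrable (by norm_num))
  have hcont := hw.continuousOn
  rw [uIcc_of_le zero_le_one] at hcont
  have hae : w =ᵐ[volume.restrict (Icc (0 : ℝ) 1)] w' := by
    rw [← restrict_Ioo_eq_restrict_Icc]
    exact huw.symm.trans huw'
  have heq : EqOn w w' (Icc 0 1) :=
    Measure.eqOn_Icc_of_ae_eq volume zero_ne_one hae hcont hw'
  refine ⟨w, hw, huw, hg.weakDeriv_ae_eq.trans hwg.symm, (memLp_congr_ae hwg).2 hg.1, ?_⟩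
  rw [heq (by simp), heq (by simp)]
  exact hR

lemma memW12Bdry_of_absolutelyContinuous {R : ℝ → ℝ → Prop} {u w : ℝ → ℝ}
    (hw : AbsolutelyContinuousOnInterval w 0 1) (hw' : MemLp (deriv w) 2 muI)
    (huw : u =ᵐ[muI] w) (hR : R (w 0) (w 1)) :
    MemW12Bdry R u ∧ weakDeriv u =ᵐ[muI] deriv w := by
  have hcont := hw.continuousOn
  rw [uIcc_of_le zero_le_one] at hcont
  have hd := (isWeakDeriv_deriv hw hw').congr_left huw.symm
  refine ⟨⟨⟨(memLp_congr_ae huw).2 ?_, _, hd⟩, w, hcont, huw, hR⟩, hd.weakDeriv_ae_eq⟩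
  obtain ⟨C, hC⟩ := hw.exists_bound
  rw [uIcc_of_le zero_le_one] at hC
  refine MemLp.of_bound ?_ C ((ae_restrict_iff' measurableSet_Ioo).2
    (Eventually.of_forall fun t ht => hC t (Ioo_subset_Icc_self ht)))
  exact (hcont.mono Ioo_subset_Icc_self).aestronglyMeasurable measurableSet_Ioo

/-! ### Lower bound for the Modica–Mortola functionals -/

/-- The Modica–Mortola energy of an absolutely continuous representative on a subinterval. -/
noncomputable def mmEnergy (A B θ : ℝ) (w : ℝ → ℝ) (a b : ℝ) : ℝ :=
  ∫ t in a..b, (A * (w t ^ 2 - θ ^ 2) ^ 2 + B * deriv w t ^ 2)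

lemma intervalIntegrable_potential {w : ℝ → ℝ} (hw : AbsolutelyContinuousOnInterval w 0 1) (θ : ℝ) :
    IntervalIntegrable (fun t => (w t ^ 2 - θ ^ 2) ^ 2) volume 0 1 :=
  (((hw.continuousOn.pow 2).sub continuousOn_const).pow 2).intervalIntegrable

lemma intervalIntegrable_deriv_sq {w : ℝ → ℝ} (hw' : MemLp (deriv w) 2 muI) :
    IntervalIntegrable (fun t => deriv w t ^ 2) volume 0 1 :=
  (integrable_muI_iff _).1 hw'.integrable_sq

lemma intervalIntegrable_mmDensity {w : ℝ → ℝ} (hw : AbsolutelyContinuousOnInterval w 0 1)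
    (hw' : MemLp (deriv w) 2 muI) (A B θ : ℝ) {a b : ℝ} (ha : 0 ≤ a) (hab : a ≤ b) (hb : b ≤ 1) :
    IntervalIntegrable (fun t => A * (w t ^ 2 - θ ^ 2) ^ 2 + B * deriv w t ^ 2) volume a b := by
  refine IntervalIntegrable.mono_set (a := 0) (b := 1)
    (((intervalIntegrable_potential hw θ).const_mul A).add
      ((intervalIntegrable_deriv_sq hw').const_mul B)) ?_
  rw [uIcc_of_le hab, uIcc_of_le zero_le_one]
  exact Icc_subset_Icc ha hb

lemma mmEnergy_add {w : ℝ → ℝ} (hw : AbsolutelyContinuousOnInterval w 0 1)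
    (hw' : MemLp (deriv w) 2 muI) (A B θ : ℝ) {a b c : ℝ} (ha : 0 ≤ a) (hab : a ≤ b) (hbc : b ≤ c)
    (hc : c ≤ 1) : mmEnergy A B θ w a b + mmEnergy A B θ w b c = mmEnergy A B θ w a c :=
  intervalIntegral.integral_add_adjacent_intervals
    (intervalIntegrable_mmDensity hw hw' A B θ ha hab (hbc.trans hc))
    (intervalIntegrable_mmDensity hw hw' A B θ (ha.trans hab) hbc hc)

lemma mmEnergy_nonneg {A B : ℝ} (hA : 0 ≤ A) (hB : 0 ≤ B) (θ : ℝ) (w : ℝ → ℝ) {a b : ℝ}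
    (hab : a ≤ b) : 0 ≤ mmEnergy A B θ w a b :=
  intervalIntegral.integral_nonneg hab fun t _ => by positivity

/-- The inequality of Modica and Mortola: `2 √(AB) |(θ² - w²) w'|` is at most the energy density,
and `(θ² - w²) w'` is the derivative of `Φ(w)`, where `Φ(x) = θ² x - x³ / 3`. -/
lemma le_mmEnergy {w : ℝ → ℝ} (hw : AbsolutelyContinuousOnInterval w 0 1)
    (hw' : MemLp (deriv w) 2 muI) {A B κ : ℝ} (hA : 0 < A) (hκ : 0 ≤ κ) (hκ2 : κ ^ 2 = A * B)
    (θ : ℝ) {a b : ℝ} (ha : 0 ≤ a) (hab : a ≤ b) (hb : b ≤ 1) :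
    2 * κ * |(θ ^ 2 * w b - w b ^ 3 / 3) - (θ ^ 2 * w a - w a ^ 3 / 3)| ≤ mmEnergy A B θ w a b := by
  have hac : AbsolutelyContinuousOnInterval w a b := hw.mono (by
    rw [uIcc_of_le hab, uIcc_of_le zero_le_one]; exact Icc_subset_Icc ha hb)
  set Ψ : ℝ → ℝ := fun t => θ ^ 2 * w t - 1 / 3 * (w t * (w t * w t)) with hΨ
  have hΨac : AbsolutelyContinuousOnInterval Ψ a b :=
    (hac.const_mul (θ ^ 2)).sub ((hac.mul (hac.mul hac)).const_mul (1 / 3))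
  have hderiv : ∀ᵐ t, t ∈ uIcc a b → deriv Ψ t = (θ ^ 2 - w t ^ 2) * deriv w t := by
    filter_upwards [hac.ae_differentiableAt] with t ht htm
    have hd := (ht htm).hasDerivAt
    have := (hd.const_mul (θ ^ 2)).sub ((hd.mul (hd.mul hd)).const_mul (1 / 3))
    rw [HasDerivAt.deriv (f := Ψ) this]
    simp only [Pi.mul_apply]
    ring
  have e : (θ ^ 2 * w b - w b ^ 3 / 3) - (θ ^ 2 * w a - w a ^ 3 / 3) = ∫ t in a..b, deriv Ψ t := by
    rw [hΨac.integral_deriv_eq_sub]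
    simp only [hΨ]; ring
  rw [e]
  have hκ' : 0 ≤ 2 * κ := by linarith
  refine (mul_le_mul_of_nonneg_left (intervalIntegral.abs_integral_le_integral_abs hab) hκ').trans ?_
  rw [← intervalIntegral.integral_const_mul, mmEnergy]
  refine intervalIntegral.integral_mono_ae_restrict hab
    (hΨac.intervalIntegrable_deriv.abs.const_mul _)
    (intervalIntegrable_mmDensity hw hw' A B θ ha hab hb) ?_
  filter_upwards [ae_restrict_of_ae hderiv, ae_restrict_mem measurableSet_Icc] with t ht htm
  rw [uIcc_of_le hab] at ht
  rw [ht htm]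
  refine le_of_mul_le_mul_left ?_ hA
  obtain ⟨x, hx⟩ : ∃ x, x = w t ^ 2 - θ ^ 2 := ⟨_, rfl⟩
  obtain ⟨y, hy⟩ : ∃ y, y = deriv w t := ⟨_, rfl⟩
  rw [← neg_sub (w t ^ 2), ← hx, ← hy, abs_mul, abs_neg]
  have h1 : 0 ≤ (A * |x| - κ * |y|) ^ 2 := sq_nonneg _
  have h2 : A * (A * x ^ 2 + B * y ^ 2) = A ^ 2 * |x| ^ 2 + κ ^ 2 * |y| ^ 2 := by
    rw [sq_abs, sq_abs, hκ2]; ring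
  rw [h2]
  linarith

lemma modicaMortola_eq {R : ℝ → ℝ → Prop} {n : ℕ} {α : ℝ} {u : L1I} (h : MemW12Bdry R u)
    {w : ℝ → ℝ} (hw : AbsolutelyContinuousOnInterval w 0 1) (hw' : MemLp (deriv w) 2 muI)
    (huw : u =ᵐ[muI] w) (hd : weakDeriv u =ᵐ[muI] deriv w) :
    modicaMortola R n α u = ((mmEnergy (lam n α / thetaMin α ^ 4)
      (bigM α ^ 2 / (lam n α * thetaMin α ^ 2)) (thetaMin α) w 0 1 : ℝ) : EReal) := by
  rw [modicaMortola, if_pos h, mmEnergy, intervalIntegral.integral_add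
    ((intervalIntegrable_potential hw _).const_mul _)
    ((intervalIntegrable_deriv_sq hw').const_mul _), intervalIntegral.integral_const_mul,
    intervalIntegral.integral_const_mul]
  have e1 : ∫ t in Ioo (0 : ℝ) 1, (u t ^ 2 - thetaMin α ^ 2) ^ 2
      = ∫ t in (0 : ℝ)..1, (w t ^ 2 - thetaMin α ^ 2) ^ 2 := by
    rw [← integral_muI_eq_intervalIntegral]
    refine integral_congr_ae ?_
    filter_upwards [huw] with t ht
    rw [ht]
  have e2 : ∫ t in Ioo (0 : ℝ) 1, weakDeriv u t ^ 2 = ∫ t in (0 : ℝ)..1, deriv w t ^ 2 := by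
    rw [← integral_muI_eq_intervalIntegral]
    refine integral_congr_ae ?_
    filter_upwards [hd] with t ht
    rw [ht]
  rw [e1, e2]

/-- `Φ(x) = θ² x - x³ / 3` nearly has its extremal values `± 2 θ³ / 3` near the wells. -/
lemma le_abs_sub_of_near_wells {θ d x y : ℝ} (hθ2 : θ ≤ 2) (hd1 : d ≤ 1)
    (hx : |(|x| - θ)| ≤ d) (hy : |(|y| - θ)| ≤ d) (hxy : x * y < 0) :
    4 / 3 * θ ^ 3 - 6 * d ≤ |(θ ^ 2 * y - y ^ 3 / 3) - (θ ^ 2 * x - x ^ 3 / 3)| := by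
  have hd0 : 0 ≤ d := (abs_nonneg _).trans hx
  have key : ∀ z, |z - θ| ≤ d → 2 / 3 * θ ^ 3 - 3 * d ≤ θ ^ 2 * z - z ^ 3 / 3 := by
    intro z hz
    obtain ⟨h, rfl⟩ : ∃ h, z = θ + h := ⟨z - θ, by ring⟩
    rw [add_sub_cancel_left] at hz
    have h1 : h ^ 2 ≤ d := by
      rw [← sq_abs]; nlinarith [abs_nonneg h]
    have h2 : h ^ 3 ≤ d := by
      have : h ^ 3 ≤ |h| ^ 2 * |h| := by
        rw [sq_abs, pow_succ]
        exact mul_le_mul_of_nonneg_left (le_abs_self h) (sq_nonneg h)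
      rw [sq_abs] at this
      nlinarith [abs_nonneg h, sq_nonneg h]
    have h3 : θ * h ^ 2 ≤ 2 * d := by nlinarith [sq_nonneg h]
    nlinarith
  rcases mul_neg_iff.1 hxy with ⟨h1, h2⟩ | ⟨h1, h2⟩
  · rw [abs_of_pos h1] at hx
    rw [abs_of_neg h2] at hy
    have hx' := key x hx
    have hy' := key (-y) hy
    rw [abs_sub_comm]
    refine le_trans ?_ (le_abs_self _)
    linarith [(by ring : (-y) ^ 3 = -y ^ 3)]
  · rw [abs_of_neg h1] at hx
    rw [abs_of_pos h2] at hy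
    have hx' := key (-x) hx
    have hy' := key y hy
    refine le_trans ?_ (le_abs_self _)
    linarith [(by ring : (-x) ^ 3 = -x ^ 3)]

lemma bigM_pos {α : ℝ} (hα : α ∈ Ico (0 : ℝ) 4) : 0 < bigM α := by
  have := creaseEnergy_pos hα
  unfold bigM; positivity

lemma lam_pos {n : ℕ} (hn : 0 < n) {α : ℝ} (hα : α ∈ Ico (0 : ℝ) 4) : 0 < lam n α := by
  have := thetaMin_pos hα.2
  unfold lam; positivity

lemma lam_div {n : ℕ} {α : ℝ} (hα : α ∈ Ico (0 : ℝ) 4) : lam n α / thetaMin α ^ 4 = 2 * n := by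
  have := thetaMin_pos hα.2
  unfold lam; field_simp

/-- The cost of a transition between neighbourhoods of the wells, uniformly in the parameter. -/
lemma exists_creaseEnergy_sub_le_modica {β : ℝ} (hβ : β ∈ Ico (0 : ℝ) 4) {ε : ℝ} (hε : 0 < ε) :
    ∃ δ > 0, δ < thetaMin β ∧ ∃ η > 0, ∀ α ∈ Ico (0 : ℝ) 4, |α - β| < η → ∀ x y : ℝ,
      |(|x| - thetaMin β)| < δ → |(|y| - thetaMin β)| < δ → x * y < 0 →
      creaseEnergy β - ε ≤ 2 * (bigM α / thetaMin α ^ 3) *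
        |(thetaMin α ^ 2 * y - y ^ 3 / 3) - (thetaMin α ^ 2 * x - x ^ 3 / 3)| := by
  have hθ := thetaMin_pos hβ.2
  have hC := creaseEnergy_pos hβ
  set θ := thetaMin β with hθdef
  set C := creaseEnergy β with hCdef
  set d := min 1 (min θ (ε * θ ^ 3 / (144 * C))) with hd
  have hd0 : 0 < d := lt_min one_pos (lt_min hθ (by positivity))
  have hd1 : d ≤ 1 := min_le_left _ _
  have hd2 : d ≤ θ := (min_le_right _ _).trans (min_le_left _ _)
  have hd3 : d * (144 * C) ≤ ε * θ ^ 3 := by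
    rw [← le_div_iff₀ (by positivity)]
    exact (min_le_right _ _).trans (min_le_right _ _)
  obtain ⟨η₁, hη₁, hth⟩ := exists_thetaMin_near β (half_pos hd0)
  obtain ⟨η₂, hη₂, hcr⟩ := exists_creaseEnergy_near hβ (ε := min (ε / 2) C)
    (lt_min (half_pos hε) hC)
  refine ⟨d / 2, by positivity, by linarith, min η₁ η₂, lt_min hη₁ hη₂,
    fun α hα hαβ x y hx hy hxy => ?_⟩
  rw [lt_min_iff] at hαβ
  have h1 := hth α hαβ.1
  have h2 := hcr α hα hαβ.2
  have h2a := abs_le.1 (h2.trans (min_le_left _ _))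
  have h2b := abs_le.1 (h2.trans (min_le_right _ _))
  have hθα := thetaMin_pos hα.2
  have hnear : ∀ z, |(|z| - θ)| < d / 2 → |(|z| - thetaMin α)| ≤ d := fun z hz => by
    have := abs_sub_le |z| θ (thetaMin α)
    rw [abs_sub_comm θ] at this
    linarith
  have h3 := le_abs_sub_of_near_wells (by linarith [thetaMin_le hα.1, Real.pi_le_four]) hd1
    (hnear x hx) (hnear y hy) hxy
  have hhalf : θ / 2 ≤ thetaMin α := by linarith [(abs_le.1 h1).1]
  have h4 : θ ^ 3 / 8 ≤ thetaMin α ^ 3 := by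
    calc θ ^ 3 / 8 = (θ / 2) ^ 3 := by ring
      _ ≤ _ := by gcongr
  have hMα := bigM_pos hα
  refine le_trans ?_ (mul_le_mul_of_nonneg_left h3 (by positivity))
  have e : 2 * (bigM α / thetaMin α ^ 3) * (4 / 3 * thetaMin α ^ 3 - 6 * d)
      = creaseEnergy α - (9 / 2 * creaseEnergy α * d) / thetaMin α ^ 3 := by
    unfold bigM; field_simp; ring
  rw [e]
  have h5 : (9 / 2 * creaseEnergy α * d) / thetaMin α ^ 3 ≤ ε / 2 := by
    rw [div_le_iff₀ (by positivity)]
    have h6 : creaseEnergy α * d ≤ 2 * C * d :=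
      mul_le_mul_of_nonneg_right (by linarith [h2b.2]) hd0.le
    have h7 : ε / 2 * (θ ^ 3 / 8) ≤ ε / 2 * thetaMin α ^ 3 := by gcongr
    linarith
  linarith [h2a.1]

lemma abs_abs_sub_le_potential {θ ρ x : ℝ} (hθ : 0 < θ) (hρ : 0 < ρ) :
    |(|x| - θ)| ≤ (ρ + (x ^ 2 - θ ^ 2) ^ 2 / ρ) / θ := by
  have h1 : |(|x| - θ)| * θ ≤ |x ^ 2 - θ ^ 2| := by
    rw [← sq_abs x, show |x| ^ 2 - θ ^ 2 = (|x| - θ) * (|x| + θ) by ring, abs_mul]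
    refine mul_le_mul_of_nonneg_left ?_ (abs_nonneg _)
    exact (by linarith [abs_nonneg x] : θ ≤ |x| + θ).trans (le_abs_self _)
  rw [le_div_iff₀ hθ]
  refine h1.trans ?_
  set z := |x ^ 2 - θ ^ 2| with hz
  have hz2 : (x ^ 2 - θ ^ 2) ^ 2 = z ^ 2 := by rw [hz, sq_abs]
  rw [hz2, ← sub_nonneg, show ρ + z ^ 2 / ρ - z = ((z - ρ) ^ 2 + z * ρ) / ρ by field_simp; ring]
  have : 0 ≤ z := abs_nonneg _
  positivity

lemma integral_abs_abs_sub_le {u : L1I} {w : ℝ → ℝ} (hw : AbsolutelyContinuousOnInterval w 0 1)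
    (huw : u =ᵐ[muI] w) {θ ρ : ℝ} (θ' : ℝ) (hθ : 0 < θ) (hρ : 0 < ρ) :
    ∫ t, |(|u t| - θ')| ∂muI
      ≤ |θ - θ'| + ρ / θ + 1 / (ρ * θ) * ∫ t, (w t ^ 2 - θ ^ 2) ^ 2 ∂muI := by
  have hpot : Integrable (fun t => (w t ^ 2 - θ ^ 2) ^ 2) muI :=
    (integrable_muI_iff _).2 (intervalIntegrable_potential hw _)
  have h1 : ∫ t, |(|u t| - θ')| ∂muI ≤
      ∫ t, ((|θ - θ'| + ρ / θ) + 1 / (ρ * θ) * (w t ^ 2 - θ ^ 2) ^ 2) ∂muI := by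
    refine integral_mono_ae (((L1.integrable_coeFn u).abs.sub (integrable_const _)).abs)
      ((integrable_const _).add (hpot.const_mul _)) ?_
    filter_upwards [huw] with t ht
    rw [ht]
    have h2 := abs_sub_le |w t| θ θ'
    have h3 := abs_abs_sub_le_potential (x := w t) hθ hρ
    have e : (ρ + (w t ^ 2 - θ ^ 2) ^ 2 / ρ) / θ
        = ρ / θ + 1 / (ρ * θ) * (w t ^ 2 - θ ^ 2) ^ 2 := by field_simp
    linarith
  rw [integral_add (integrable_const _) (hpot.const_mul _), integral_const_mul] at h1
  simpa using h1

/-- Functions with bounded Modica–Mortola energy are close to step functions, with no more jumps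
than the energy allows, uniformly in the parameter near `β`. -/
theorem modicaMortola_lower {β : ℝ} (hβ : β ∈ Ico (0 : ℝ) 4) {R : ℝ → ℝ → Prop} (hR : R 1 1)
    (hR' : R 1 (-1) ∨ ∀ x y, R x y → x = y) {ε : ℝ} (hε : 0 < ε) (K : ℝ) :
    ∃ n₀ : ℕ, ∃ η > 0, ∀ n ≥ n₀, ∀ α ∈ Ico (0 : ℝ) 4, |α - β| < η → ∀ u : L1I,
      modicaMortola R n α u < K → ∃ m : ℕ, R 1 ((-1) ^ m) ∧ m * (creaseEnergy β - ε) ≤ K ∧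
        ∃ y ∈ stepSet (thetaMin β) m, dist u y ≤ ε := by
  have hθ := thetaMin_pos hβ.2
  have hC := creaseEnergy_pos hβ
  obtain ⟨δ, hδ, hδθ, η₁, hη₁, hseg⟩ := exists_creaseEnergy_sub_le_modica hβ
    (ε := min ε (creaseEnergy β / 2)) (lt_min hε (by positivity))
  set c := creaseEnergy β - min ε (creaseEnergy β / 2) with hcdef
  have hc : 0 < c := by
    have := min_le_right ε (creaseEnergy β / 2)
    rw [hcdef]; linarith
  have hcε : creaseEnergy β - ε ≤ c := by
    have := min_le_left ε (creaseEnergy β / 2)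
    rw [hcdef]; linarith
  set D := 1 + 2 * thetaMin β / δ with hD
  have hD0 : 0 < D := by positivity
  set ρ := ε / (6 * D) with hρdef
  have hρ : 0 < ρ := by positivity
  have hDρ : D * (3 * ρ) = ε / 2 := by rw [hρdef]; field_simp; norm_num
  set ρ' := ρ * thetaMin β / 2 with hρ'def
  have hρ' : 0 < ρ' := by positivity
  obtain ⟨η₂, hη₂, hth⟩ := exists_thetaMin_near β (ε := min ρ (thetaMin β / 2))
    (lt_min hρ (by positivity))
  obtain ⟨n₀, hn₀⟩ := exists_nat_gt (|K| / (ρ' * ρ'))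
  rw [div_lt_iff₀ (by positivity)] at hn₀
  refine ⟨n₀ + 1, min η₁ η₂, lt_min hη₁ hη₂, fun n hn α hα hαβ u hu => ?_⟩
  have hn0 : 0 < n := by omega
  have hn' : (0 : ℝ) < n := by exact_mod_cast hn0
  rw [lt_min_iff] at hαβ
  have hθα := thetaMin_pos hα.2
  have hth1 := (hth α hαβ.2).trans (min_le_left _ _)
  have hth2 := (hth α hαβ.2).trans (min_le_right _ _)
  have hhalf : thetaMin β / 2 ≤ thetaMin α := by linarith [(abs_le.1 hth2).1]
  have hmem : MemW12Bdry R u := by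
    by_contra hcon
    rw [modicaMortola, if_neg hcon] at hu
    exact not_top_lt hu
  obtain ⟨w, hw, huw, hwd, hw', hRw⟩ := hmem.exists_absolutelyContinuous
  rw [modicaMortola_eq hmem hw hw' huw hwd, EReal.coe_lt_coe_iff] at hu
  have hlam := lam_pos hn0 hα
  have hMα := bigM_pos hα
  set A := lam n α / thetaMin α ^ 4 with hA
  have hA2 : A = 2 * n := lam_div hα
  set B := bigM α ^ 2 / (lam n α * thetaMin α ^ 2) with hB
  have hA0 : 0 < A := by positivity
  have hB0 : 0 < B := by positivity
  set κ := bigM α / thetaMin α ^ 3 with hκ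
  have hκ0 : 0 ≤ κ := by positivity
  have hκ2 : κ ^ 2 = A * B := by rw [hκ, hA, hB]; field_simp
  set E := mmEnergy A B (thetaMin α) w 0 1 with hE
  set F : ℝ → ℝ := fun t => mmEnergy A B (thetaMin α) w 0 t with hF
  have hE0 : 0 ≤ E := mmEnergy_nonneg hA0.le hB0.le _ _ zero_le_one
  have hFsub : ∀ {a b : ℝ}, 0 ≤ a → a ≤ b → b ≤ 1 →
      F b - F a = mmEnergy A B (thetaMin α) w a b := fun ha hab hb => by
    have := mmEnergy_add hw hw' A B (thetaMin α) le_rfl ha hab hb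
    simp only [hF]; linarith
  have hFE : F 1 = E := rfl
  have hF0 : F 0 = 0 := intervalIntegral.integral_same
  have htrans : ∀ a ∈ Ioo (0 : ℝ) 1, ∀ b ∈ Ioo (0 : ℝ) 1, a < b → |(|w a| - thetaMin β)| < δ →
      |(|w b| - thetaMin β)| < δ → w a * w b < 0 → c ≤ F b - F a := by
    intro a ha b hb hab hwa hwb hneg
    rw [hFsub ha.1.le hab.le hb.2.le]
    exact (hseg α hα hαβ.1 _ _ hwa hwb hneg).trans
      (le_mmEnergy hw hw' hA0 hκ0 hκ2 _ ha.1.le hab.le hb.2.le)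
  have htotal : ∀ a ∈ Ioo (0 : ℝ) 1, ∀ b ∈ Ioo (0 : ℝ) 1, a ≤ b → F b - F a ≤ E := by
    intro a ha b hb _
    have h1 := hFsub hb.1.le hb.2.le le_rfl
    have h2 := mmEnergy_nonneg hA0.le hB0.le (thetaMin α) w hb.2.le
    have h3 : 0 ≤ F a := mmEnergy_nonneg hA0.le hB0.le (thetaMin α) w ha.1.le
    linarith
  have hwrap : R 1 (-1) ∨ ∀ a ∈ Ioo (0 : ℝ) 1, ∀ b ∈ Ioo (0 : ℝ) 1, a ≤ b →
      |(|w a| - thetaMin β)| < δ → |(|w b| - thetaMin β)| < δ → w a * w b < 0 →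
      F b - F a + c ≤ E := by
    refine hR'.imp_right fun hper a ha b hb hab hwa hwb hneg => ?_
    have h1 := le_mmEnergy hw hw' hA0 hκ0 hκ2 (thetaMin α) le_rfl ha.1.le ha.2.le
    have h2 := le_mmEnergy hw hw' hA0 hκ0 hκ2 (thetaMin α) hb.1.le hb.2.le le_rfl
    rw [← hFsub le_rfl ha.1.le ha.2.le, hF0] at h1
    rw [← hFsub hb.1.le hb.2.le le_rfl, hFE, ← hper _ _ hRw] at h2
    have h3 := hseg α hα hαβ.1 _ _ hwb hwa (by rwa [mul_comm])
    set Φ : ℝ → ℝ := fun x => thetaMin α ^ 2 * x - x ^ 3 / 3 with hΦ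
    have h4 : |Φ (w a) - Φ (w b)| ≤ |Φ (w a) - Φ (w 0)| + |Φ (w 0) - Φ (w b)| := abs_sub_le _ _ _
    have h5 := mul_le_mul_of_nonneg_left h4 (by positivity : 0 ≤ 2 * κ)
    simp only [hΦ] at h5
    linarith
  obtain ⟨m, hRm, hmE, y, hy, hdy⟩ := exists_mem_stepSet_of_transitions (E := E) (R := R) (F := F)
    hδ hδθ hc hE0 hR huw htrans htotal hwrap (half_pos hε)
  refine ⟨m, hRm, ?_, y, hy, hdy.trans ?_⟩
  · have : (m : ℝ) * (creaseEnergy β - ε) ≤ m * c := by gcongr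
    linarith
  have hint : ∫ t, |(|u t| - thetaMin β)| ∂muI ≤ 3 * ρ := by
    have h1 := integral_abs_abs_sub_le hw huw (thetaMin β) hθα hρ'
    have h2 : A * ∫ t, (w t ^ 2 - thetaMin α ^ 2) ^ 2 ∂muI ≤ |K| := by
      rw [integral_muI_eq_intervalIntegral, ← intervalIntegral.integral_const_mul]
      refine le_trans ?_ (hu.le.trans (le_abs_self K))
      refine intervalIntegral.integral_mono_on zero_le_one
        ((intervalIntegrable_potential hw _).const_mul _)
        (intervalIntegrable_mmDensity hw hw' A B _ le_rfl zero_le_one le_rfl) fun t _ => ?_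
      have : 0 ≤ B * deriv w t ^ 2 := by positivity
      linarith
    set P := ∫ t, (w t ^ 2 - thetaMin α ^ 2) ^ 2 ∂muI with hP
    have hP0 : 0 ≤ P := integral_nonneg fun t => sq_nonneg _
    have h3 : ρ' / thetaMin α ≤ ρ := by
      rw [div_le_iff₀ hθα, hρ'def]
      have := mul_le_mul_of_nonneg_left hhalf hρ.le
      linarith
    have h4 : P ≤ ρ' * ρ' := by
      have h5 : (n₀ : ℝ) * (ρ' * ρ') ≤ n * (ρ' * ρ') := by
        have : (n₀ : ℝ) ≤ n := by exact_mod_cast (by omega : n₀ ≤ n)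
        gcongr
      rw [hA2] at h2
      have h6 : n * P ≤ n * (ρ' * ρ') := by
        have := mul_nonneg hn'.le hP0
        linarith
      exact le_of_mul_le_mul_left h6 hn'
    have h7 : 1 / (ρ' * thetaMin α) * P ≤ ρ' / thetaMin α := by
      calc 1 / (ρ' * thetaMin α) * P ≤ 1 / (ρ' * thetaMin α) * (ρ' * ρ') := by gcongr
        _ = ρ' / thetaMin α := by field_simp
    linarith
  calc D * ∫ t, |(|u t| - thetaMin β)| ∂muI + ε / 2 ≤ D * (3 * ρ) + ε / 2 := by gcongr
    _ = ε := by rw [hDρ]; ring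

/-! ### Almost optimal profiles -/

/-- A transition `Q` from `-1` to `1`, which is constant outside of `[-T, T]`, with derivative `Q'`
except possibly at `± T`. -/
structure IsProfile (Q Q' : ℝ → ℝ) (T : ℝ) : Prop where
  pos : 0 < T
  eq_one : ∀ s, T ≤ s → Q s = 1
  eq_neg_one : ∀ s, s ≤ -T → Q s = -1
  abs_le_one : ∀ s, |Q s| ≤ 1
  hasDerivAt : ∀ s, s ≠ T → s ≠ -T → HasDerivAt Q (Q' s) s
  lipschitz : ∃ K, LipschitzWith K Q
  integrable : Integrable fun s => (Q s ^ 2 - 1) ^ 2 + Q' s ^ 2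

lemma hasDerivAt_tanh (x : ℝ) : HasDerivAt Real.tanh (1 - Real.tanh x ^ 2) x := by
  have h : Real.tanh = fun x => Real.sinh x / Real.cosh x :=
    funext fun x => Real.tanh_eq_sinh_div_cosh x
  have hc := (Real.cosh_pos x).ne'
  rw [h]
  refine ((Real.hasDerivAt_sinh x).div (Real.hasDerivAt_cosh x) hc).congr_deriv ?_
  field_simp

lemma abs_tanh_lt_one (x : ℝ) : |Real.tanh x| < 1 :=
  abs_lt.2 ⟨Real.neg_one_lt_tanh x, Real.tanh_lt_one x⟩

lemma tanh_sq_le_one (x : ℝ) : Real.tanh x ^ 2 ≤ 1 :=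
  (sq_le_one_iff_abs_le_one _).2 (abs_tanh_lt_one x).le

lemma lipschitzWith_tanh : LipschitzWith 1 Real.tanh := by
  refine lipschitzWith_of_nnnorm_deriv_le (fun x => (hasDerivAt_tanh x).differentiableAt) fun x => ?_
  rw [(hasDerivAt_tanh x).deriv, ← NNReal.coe_le_coe, coe_nnnorm, Real.norm_eq_abs, NNReal.coe_one,
    abs_le]
  constructor <;> linarith [tanh_sq_le_one x, sq_nonneg (Real.tanh x)]

lemma strictMono_tanh : StrictMono Real.tanh := by
  refine strictMono_of_deriv_pos fun x => ?_
  rw [(hasDerivAt_tanh x).deriv]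
  have := (sq_lt_one_iff_abs_lt_one (Real.tanh x)).2 (abs_tanh_lt_one x)
  linarith

lemma intervalIntegral_tanh_profile (T : ℝ) :
    ∫ s in (-T)..T, (1 - Real.tanh s ^ 2) ^ 2 = 2 * (Real.tanh T - Real.tanh T ^ 3 / 3) := by
  have hcont : Continuous Real.tanh := lipschitzWith_tanh.continuous
  have hi : IntervalIntegrable (fun s => (1 - Real.tanh s ^ 2) ^ 2) volume (-T) T :=
    Continuous.intervalIntegrable (by fun_prop) _ _
  rw [intervalIntegral.integral_eq_sub_of_hasDerivAt
    (f := fun s => Real.tanh s - Real.tanh s ^ 3 / 3) (fun s _ => ?_) hi]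
  · rw [Real.tanh_neg]; ring
  · refine ((hasDerivAt_tanh s).sub (((hasDerivAt_tanh s).pow 3).div_const 3)).congr_deriv ?_
    push_cast; ring

/-- The optimal profile `tanh`, slightly stretched and then cut off, has almost the optimal energy
`8 / 3`. -/
lemma exists_isProfile {ε : ℝ} (hε : 0 < ε) :
    ∃ Q Q' T, IsProfile Q Q' T ∧ ∫ s, ((Q s ^ 2 - 1) ^ 2 + Q' s ^ 2) ≤ 8 / 3 + ε := by
  set r := 1 + ε / 6 with hr
  have hr1 : 1 < r := by rw [hr]; linarith
  have hr0 : 0 < r := by linarith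
  set T := Real.artanh (1 / r) with hT
  have hmem : 1 / r ∈ Ioo (0 : ℝ) 1 := ⟨by positivity, (div_lt_one hr0).2 hr1⟩
  have hT0 : 0 < T := Real.artanh_pos hmem
  have htanhT : Real.tanh T = 1 / r := Real.tanh_artanh ⟨by linarith [hmem.1], hmem.2⟩
  have hcont : Continuous Real.tanh := lipschitzWith_tanh.continuous
  set Q : ℝ → ℝ := fun s => r * Real.tanh (max (-T) (min T s)) with hQ
  set Q' : ℝ → ℝ := fun s => if s ∈ Ioo (-T) T then r * (1 - Real.tanh s ^ 2) else 0 with hQ'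
  have hone : ∀ s, T ≤ s → Q s = 1 := fun s hs => by
    simp only [hQ]
    rw [min_eq_left hs, max_eq_right (by linarith), htanhT]; field_simp
  have hneg : ∀ s, s ≤ -T → Q s = -1 := fun s hs => by
    simp only [hQ]
    rw [min_eq_right (by linarith), max_eq_left hs, Real.tanh_neg, htanhT]; field_simp
  have hin : ∀ s ∈ Ioo (-T) T, Q s = r * Real.tanh s := fun s hs => by
    simp only [hQ]
    rw [min_eq_right hs.2.le, max_eq_right hs.1.le]
  have hclamp : ∀ s, max (-T) (min T s) ∈ Icc (-T) T := fun s =>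
    ⟨le_max_left _ _, max_le (by linarith) (min_le_left _ _)⟩
  have habs : ∀ s, |Q s| ≤ 1 := fun s => by
    obtain ⟨h1, h2⟩ := hclamp s
    have h3 := strictMono_tanh.monotone h1
    have h4 := strictMono_tanh.monotone h2
    rw [Real.tanh_neg, htanhT] at h3
    rw [htanhT] at h4
    simp only [hQ]
    rw [abs_mul, abs_of_pos hr0, mul_comm, ← le_div_iff₀ hr0, abs_le]
    exact ⟨h3, h4⟩
  have hderiv : ∀ s, s ≠ T → s ≠ -T → HasDerivAt Q (Q' s) s := by
    intro s h1 h2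
    rcases lt_or_gt_of_ne h1 with h1 | h1
    · rcases lt_or_gt_of_ne h2 with h2 | h2
      · have : Q' s = 0 := if_neg fun h => by linarith [h.1]
        rw [this]
        refine (hasDerivAt_const s (-1 : ℝ)).congr_of_eventuallyEq ?_
        filter_upwards [Iio_mem_nhds h2] with x hx using hneg x (le_of_lt hx)
      · have : Q' s = r * (1 - Real.tanh s ^ 2) := if_pos ⟨h2, h1⟩
        rw [this]
        refine ((hasDerivAt_tanh s).const_mul r).congr_of_eventuallyEq ?_
        filter_upwards [Ioo_mem_nhds h2 h1] with x hx using hin x hx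
    · have : Q' s = 0 := if_neg fun h => by linarith [h.2]
      rw [this]
      refine (hasDerivAt_const s (1 : ℝ)).congr_of_eventuallyEq ?_
      filter_upwards [Ioi_mem_nhds h1] with x hx using hone x (le_of_lt hx)
  have hlip : ∃ K, LipschitzWith K Q := by
    have h1 : LipschitzWith 1 fun s : ℝ => max (-T) (min T s) :=
      (LipschitzWith.id.const_min T).const_max (-T)
    exact ⟨_, (LipschitzWith.comp (lipschitzWith_smul r) (lipschitzWith_tanh.comp h1))⟩
  set g : ℝ → ℝ := fun s => ((r * Real.tanh s) ^ 2 - 1) ^ 2 + (r * (1 - Real.tanh s ^ 2)) ^ 2 with hg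
  have hgc : Continuous g := by
    simp only [hg]; fun_prop
  have he : (fun s => (Q s ^ 2 - 1) ^ 2 + Q' s ^ 2) = (Ioo (-T) T).indicator g := by
    funext s
    by_cases hs : s ∈ Ioo (-T) T
    · rw [indicator_of_mem hs, hin s hs]
      simp only [hQ', hg]
      rw [if_pos hs]
    · rw [indicator_of_notMem hs]
      have h1 : Q' s = 0 := if_neg hs
      have h2 : Q s ^ 2 = 1 := by
        rw [mem_Ioo, not_and_or, not_lt, not_lt] at hs
        rcases hs with hs | hs
        · rw [hneg s hs]; norm_num
        · rw [hone s hs]; norm_num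
      rw [h1, h2]; norm_num
  have hgi : IntegrableOn g (Ioo (-T) T) :=
    (hgc.integrableOn_Icc (a := -T) (b := T)).mono_set Ioo_subset_Icc_self
  refine ⟨Q, Q', T, ⟨hT0, hone, hneg, habs, hderiv, hlip, ?_⟩, ?_⟩
  · rw [he]; exact hgi.integrable_indicator measurableSet_Ioo
  · rw [he, integral_indicator measurableSet_Ioo, ← integral_Ioc_eq_integral_Ioo,
      ← intervalIntegral.integral_of_le (by linarith)]
    have hle : ∫ s in (-T)..T, g s ≤ ∫ s in (-T)..T, 2 * r ^ 2 * (1 - Real.tanh s ^ 2) ^ 2 := by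
      refine intervalIntegral.integral_mono_on (by linarith) (hgc.intervalIntegrable _ _)
        (Continuous.intervalIntegrable (by fun_prop) _ _) fun s hs => ?_
      have hx : (r * Real.tanh s) ^ 2 ≤ 1 := by
        rw [sq_le_one_iff_abs_le_one]
        have h3 := strictMono_tanh.monotone hs.1
        have h4 := strictMono_tanh.monotone hs.2
        rw [Real.tanh_neg, htanhT] at h3
        rw [htanhT] at h4
        rw [abs_mul, abs_of_pos hr0, mul_comm, ← le_div_iff₀ hr0, abs_le]
        exact ⟨h3, h4⟩
      have h1 : (1 - (r * Real.tanh s) ^ 2) ^ 2 ≤ (r * (1 - Real.tanh s ^ 2)) ^ 2 := by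
        refine pow_le_pow_left₀ (by linarith) ?_ 2
        have : 0 ≤ (r - 1) * (1 + r * Real.tanh s ^ 2) :=
          mul_nonneg (by linarith) (by positivity)
        linarith
      simp only [hg]
      linarith
    refine hle.trans ?_
    rw [intervalIntegral.integral_const_mul, intervalIntegral_tanh_profile, htanhT]
    have e : 2 * r ^ 2 * (2 * (1 / r - (1 / r) ^ 3 / 3)) = 4 * r - 4 / 3 * (1 / r) := by
      field_simp
      ring
    rw [e]
    have h1 : 2 - r ≤ 1 / r := by
      rw [le_div_iff₀ hr0]
      nlinarith [sq_nonneg (r - 1)]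
    linarith

/-! ### Upper bound for the Modica–Mortola functionals -/

/-- The product of profiles at the points `p 0, …, p (m - 1)`, at scale `1 / ν`. -/
noncomputable def multiProfile (Q : ℝ → ℝ) (ν s : ℝ) (m : ℕ) (p : ℕ → ℝ) (t : ℝ) : ℝ :=
  s * ∏ j ∈ Finset.range m, -Q (ν * (t - p j))

lemma eventually_prod_eq_sign {S : Finset ℕ} {q : ℕ → ℝ → ℝ} {t : ℝ}
    (h : ∀ l ∈ S, ∃ c : ℝ, (c = 1 ∨ c = -1) ∧ ∀ᶠ x in 𝓝 t, q l x = c) :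
    ∃ c : ℝ, (c = 1 ∨ c = -1) ∧ ∀ᶠ x in 𝓝 t, ∏ l ∈ S, q l x = c := by
  choose! c hc hq using h
  refine ⟨∏ l ∈ S, c l, prod_eq_one_or_neg_one hc, ?_⟩
  filter_upwards [(Filter.eventually_all_finset S).2 hq] with x hx
  exact Finset.prod_congr rfl hx

/-- If the transition layers do not overlap, a product of profiles is, up to the sign, locally a
single profile or the constant `1`. -/
lemma multiProfile_hasDerivAt {Q Q' : ℝ → ℝ} {T : ℝ} (hQ : IsProfile Q Q' T) {ν s : ℝ}
    (hs : s = 1 ∨ s = -1) {m : ℕ} {p : ℕ → ℝ}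
    (hsep : ∀ i j, i < j → j < m → ν * p i + 2 * T ≤ ν * p j) {t : ℝ}
    (ht : ∀ j < m, ν * (t - p j) ≠ T ∧ ν * (t - p j) ≠ -T) :
    ∃ W', HasDerivAt (multiProfile Q ν s m p) W' t ∧
      ((multiProfile Q ν s m p t ^ 2 = 1 ∧ W' = 0) ∨ ∃ j < m,
        multiProfile Q ν s m p t ^ 2 = Q (ν * (t - p j)) ^ 2 ∧
        W' ^ 2 = ν ^ 2 * Q' (ν * (t - p j)) ^ 2) := by
  have hlin : ∀ j, Continuous fun x : ℝ => ν * (x - p j) := fun j => by fun_prop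
  have hconst : ∀ j < m, ¬ (-T < ν * (t - p j) ∧ ν * (t - p j) < T) →
      ∃ c : ℝ, (c = 1 ∨ c = -1) ∧ ∀ᶠ x in 𝓝 t, -Q (ν * (x - p j)) = c := by
    intro j hj hout
    rw [not_and_or, not_lt, not_lt] at hout
    rcases hout with h | h
    · refine ⟨1, Or.inl rfl, ?_⟩
      filter_upwards [(hlin j).continuousAt.eventually
        (Iio_mem_nhds (lt_of_le_of_ne h (ht j hj).2))] with x hx
      rw [hQ.eq_neg_one _ (le_of_lt hx), neg_neg]
    · refine ⟨-1, Or.inr rfl, ?_⟩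
      filter_upwards [(hlin j).continuousAt.eventually
        (Ioi_mem_nhds (lt_of_le_of_ne h (ht j hj).1.symm))] with x hx
      rw [hQ.eq_one _ (le_of_lt hx)]
  have hsq : ∀ {c : ℝ}, c = 1 ∨ c = -1 → c ^ 2 = 1 := by rintro c (rfl | rfl) <;> norm_num
  by_cases hex : ∃ j < m, -T < ν * (t - p j) ∧ ν * (t - p j) < T
  · obtain ⟨j, hj, h1, h2⟩ := hex
    obtain ⟨c, hc, hev⟩ := eventually_prod_eq_sign (S := (Finset.range m).erase j)
      (q := fun l x => -Q (ν * (x - p l))) (t := t) fun l hl => by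
        rw [Finset.mem_erase, Finset.mem_range] at hl
        refine hconst l hl.2 ?_
        rintro ⟨h3, h4⟩
        rcases lt_or_gt_of_ne hl.1 with h | h
        · have := hsep l j h hj; linarith
        · have := hsep j l h hl.2; linarith
    have hW : ∀ᶠ x in 𝓝 t, multiProfile Q ν s m p x = -(s * c) * Q (ν * (x - p j)) := by
      filter_upwards [hev] with x hx
      rw [multiProfile, ← Finset.mul_prod_erase _ _ (Finset.mem_range.2 hj), hx]
      ring
    have hd : HasDerivAt (fun x => -(s * c) * Q (ν * (x - p j)))
        (-(s * c) * (Q' (ν * (t - p j)) * (ν * 1))) t :=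
      ((hQ.hasDerivAt _ (ht j hj).1 (ht j hj).2).comp t
        (((hasDerivAt_id t).sub_const (p j)).const_mul ν)).const_mul _
    refine ⟨_, hd.congr_of_eventuallyEq hW, Or.inr ⟨j, hj, ?_, ?_⟩⟩
    · rw [hW.self_of_nhds]
      linear_combination Q (ν * (t - p j)) ^ 2 * (c ^ 2 * hsq hs + hsq hc)
    · linear_combination Q' (ν * (t - p j)) ^ 2 * ν ^ 2 * (c ^ 2 * hsq hs + hsq hc)
  · push Not at hex
    obtain ⟨c, hc, hev⟩ := eventually_prod_eq_sign (S := Finset.range m)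
      (q := fun l x => -Q (ν * (x - p l))) (t := t) fun l hl =>
        hconst l (Finset.mem_range.1 hl) fun h =>
          absurd h.2 (not_lt.2 (hex l (Finset.mem_range.1 hl) h.1))
    have hW : ∀ᶠ x in 𝓝 t, multiProfile Q ν s m p x = s * c := by
      filter_upwards [hev] with x hx
      rw [multiProfile, hx]
    refine ⟨0, (hasDerivAt_const t (s * c)).congr_of_eventuallyEq hW, Or.inl ⟨?_, rfl⟩⟩
    rw [hW.self_of_nhds]
    linear_combination c ^ 2 * hsq hs + hsq hc

lemma absolutelyContinuous_multiProfile {Q Q' : ℝ → ℝ} {T : ℝ} (hQ : IsProfile Q Q' T) (θ ν s : ℝ)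
    (m : ℕ) (p : ℕ → ℝ) :
    AbsolutelyContinuousOnInterval (fun t => θ * multiProfile Q ν s m p t) 0 1 := by
  obtain ⟨K, hK⟩ := hQ.lipschitz
  have hfac : ∀ j, AbsolutelyContinuousOnInterval (fun t => -Q (ν * (t - p j))) 0 1 := by
    intro j
    have h1 : LipschitzWith (1 + 0) fun t : ℝ => t - p j :=
      LipschitzWith.id.sub (LipschitzWith.const (p j))
    exact (hK.comp ((lipschitzWith_smul ν).comp h1)).neg.lipschitzOnWith.absolutelyContinuousOnInterval
  have hprod : AbsolutelyContinuousOnInterval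
      (fun t => ∏ j ∈ Finset.range m, -Q (ν * (t - p j))) 0 1 := by
    induction m with
    | zero =>
      simp only [Finset.range_zero, Finset.prod_empty]
      exact (LipschitzWith.const (1 : ℝ)).lipschitzOnWith.absolutelyContinuousOnInterval
    | succ m ih =>
      simp only [Finset.prod_range_succ]
      exact ih.mul (hfac m)
  exact (hprod.const_mul s).const_mul θ

lemma integral_comp_affine {f : ℝ → ℝ} {ν : ℝ} (hν : 0 < ν) (x : ℝ) :
    ∫ t, f (ν * (t - x)) = ν⁻¹ * ∫ t, f t := by
  rw [integral_sub_right_eq_self (fun t => f (ν * t)) x, Measure.integral_comp_mul_left,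
    abs_of_pos (inv_pos.2 hν), smul_eq_mul]

lemma integrable_comp_affine {f : ℝ → ℝ} (hf : Integrable f) {ν : ℝ} (hν : ν ≠ 0) (x : ℝ) :
    Integrable fun t => f (ν * (t - x)) :=
  (hf.comp_mul_left' hν).comp_sub_right x

/-- The energy of a product of profiles is at most the sum of the energies of the factors. The
hypothesis on `B` is the balance of the two terms of the energy at the scale `1 / ν`. -/
lemma mmEnergy_multiProfile_le {Q Q' : ℝ → ℝ} {T : ℝ} (hQ : IsProfile Q Q' T) {A B θ ν s : ℝ}
    (hA : 0 < A) (hB : 0 < B) (hν : 0 < ν) (hθ : 0 < θ) (hbal : B * θ ^ 2 * ν ^ 2 = A * θ ^ 4)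
    (hs : s = 1 ∨ s = -1) {m : ℕ} {p : ℕ → ℝ}
    (hsep : ∀ i j, i < j → j < m → ν * p i + 2 * T ≤ ν * p j) :
    MemLp (deriv fun t => θ * multiProfile Q ν s m p t) 2 muI ∧
      mmEnergy A B θ (fun t => θ * multiProfile Q ν s m p t) 0 1
        ≤ m * (A * θ ^ 4 * (ν⁻¹ * ∫ s, ((Q s ^ 2 - 1) ^ 2 + Q' s ^ 2))) := by
  set W : ℝ → ℝ := multiProfile Q ν s m p with hW
  set e : ℝ → ℝ := fun s => (Q s ^ 2 - 1) ^ 2 + Q' s ^ 2 with he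
  have he0 : ∀ s, 0 ≤ e s := fun s => by simp only [he]; positivity
  set S : ℝ → ℝ := fun t => ∑ j ∈ Finset.range m, A * θ ^ 4 * e (ν * (t - p j)) with hS
  have hSint : ∀ j ∈ Finset.range m, Integrable fun t => A * θ ^ 4 * e (ν * (t - p j)) := fun j _ =>
    (integrable_comp_affine hQ.integrable hν.ne' (p j)).const_mul _
  have hSi : Integrable S := integrable_finsetSum _ hSint
  have hS0 : ∀ t, 0 ≤ S t := fun t => Finset.sum_nonneg fun j _ =>
    mul_nonneg (by positivity) (he0 _)
  have hbound : ∀ᵐ t, A * ((θ * W t) ^ 2 - θ ^ 2) ^ 2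
      + B * deriv (fun t => θ * W t) t ^ 2 ≤ S t := by
    have hne : ∀ᵐ t : ℝ, ∀ j < m, ν * (t - p j) ≠ T ∧ ν * (t - p j) ≠ -T := by
      rw [ae_all_iff]
      intro j
      filter_upwards [Measure.ae_ne volume (p j + T / ν), Measure.ae_ne volume (p j - T / ν)]
        with t h1 h2 _
      refine ⟨fun h => h1 ?_, fun h => h2 ?_⟩
      · rw [← h]; field_simp; ring
      · rw [show T = -(ν * (t - p j)) by linarith]; field_simp; ring
    filter_upwards [hne] with t ht
    obtain ⟨W', hW', hcase⟩ := multiProfile_hasDerivAt hQ hs hsep ht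
    rw [(hW'.const_mul θ).deriv]
    rcases hcase with ⟨h1, h2⟩ | ⟨j, hj, h1, h2⟩
    · have : A * ((θ * W t) ^ 2 - θ ^ 2) ^ 2 + B * (θ * W') ^ 2 = 0 := by
        rw [mul_pow, hW, h1, h2]; ring
      rw [this]; exact hS0 t
    · have h3 : A * ((θ * W t) ^ 2 - θ ^ 2) ^ 2 + B * (θ * W') ^ 2
          = A * θ ^ 4 * e (ν * (t - p j)) := by
        rw [mul_pow, hW, h1, mul_pow, h2]
        simp only [he]
        linear_combination Q' (ν * (t - p j)) ^ 2 * hbal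
      rw [h3]
      exact Finset.single_le_sum (f := fun j => A * θ ^ 4 * e (ν * (t - p j)))
        (fun j _ => mul_nonneg (by positivity) (he0 _)) (Finset.mem_range.2 hj)
  have hmem : MemLp (deriv fun t => θ * W t) 2 muI := by
    rw [memLp_two_iff_integrable_sq (measurable_deriv _).aestronglyMeasurable]
    refine Integrable.mono' (hSi.restrict.div_const B)
      ((measurable_deriv _).pow_const 2).aestronglyMeasurable ?_
    filter_upwards [ae_restrict_of_ae hbound] with t ht
    rw [Real.norm_eq_abs, abs_of_nonneg (sq_nonneg _), le_div_iff₀ hB]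
    have : 0 ≤ A * ((θ * W t) ^ 2 - θ ^ 2) ^ 2 := by positivity
    linarith
  refine ⟨hmem, ?_⟩
  have hac := absolutelyContinuous_multiProfile hQ θ ν s m p
  have h1 : mmEnergy A B θ (fun t => θ * W t) 0 1 ≤ ∫ t in (0 : ℝ)..1, S t :=
    intervalIntegral.integral_mono_ae zero_le_one
      (intervalIntegrable_mmDensity hac hmem A B θ le_rfl zero_le_one le_rfl)
      hSi.intervalIntegrable hbound
  have h2 : ∫ t in (0 : ℝ)..1, S t ≤ ∫ t, S t := by
    rw [intervalIntegral.integral_of_le zero_le_one]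
    exact setIntegral_le_integral hSi (Eventually.of_forall hS0)
  have h3 : ∫ t, S t = m * (A * θ ^ 4 * (ν⁻¹ * ∫ s, e s)) := by
    simp only [hS]
    rw [integral_finsetSum _ hSint, Finset.sum_congr rfl fun j _ => by
      rw [integral_const_mul, integral_comp_affine hν]]
    simp
  exact h1.trans (h2.trans h3.le)

lemma abs_multiProfile_le {Q Q' : ℝ → ℝ} {T : ℝ} (hQ : IsProfile Q Q' T) {ν s : ℝ}
    (hs : s = 1 ∨ s = -1) (m : ℕ) (p : ℕ → ℝ) (t : ℝ) : |multiProfile Q ν s m p t| ≤ 1 := by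
  have hs1 : |s| = 1 := by rcases hs with rfl | rfl <;> simp
  rw [multiProfile, abs_mul, hs1, one_mul, Finset.abs_prod]
  exact Finset.prod_le_one (fun _ _ => abs_nonneg _) fun j _ => by
    rw [abs_neg]; exact hQ.abs_le_one _

lemma multiProfile_of_far {Q Q' : ℝ → ℝ} {T : ℝ} (hQ : IsProfile Q Q' T) {ν s : ℝ} (hν : 0 < ν)
    {m : ℕ} {p : ℕ → ℝ} {t : ℝ} (hfar : ∀ j < m, t < p j - T / ν ∨ p j + T / ν < t) :
    multiProfile Q ν s m p t = stepFn s m p t := by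
  have hT : 0 < T / ν := div_pos hQ.pos hν
  rw [multiProfile, stepFn]
  congr 1
  refine Finset.prod_congr rfl fun j hj => ?_
  rcases hfar j (Finset.mem_range.1 hj) with h | h
  · have h1 : ν * (T / ν) < ν * (p j - t) := mul_lt_mul_of_pos_left (by linarith) hν
    rw [mul_div_cancel₀ _ hν.ne'] at h1
    rw [if_pos (by linarith), hQ.eq_neg_one _ (by linarith), neg_neg]
  · have h1 : ν * (T / ν) < ν * (t - p j) := mul_lt_mul_of_pos_left (by linarith) hν
    rw [mul_div_cancel₀ _ hν.ne'] at h1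
    rw [if_neg (by linarith), hQ.eq_one _ h1.le]

/-- The scale of the transition layers: at `1 / ν` with `ν = λ_{n,α} / M_α` the two terms of the
energy are balanced, and `ν` is of order `n`, uniformly in the parameter near `β`. -/
lemma exists_le_lam_div_bigM {β : ℝ} (hβ : β ∈ Ico (0 : ℝ) 4) :
    ∃ κ > 0, ∃ η > 0, ∀ α ∈ Ico (0 : ℝ) 4, |α - β| < η → ∀ n : ℕ, κ * n ≤ lam n α / bigM α := by
  have hθ := thetaMin_pos hβ.2
  have hC := creaseEnergy_pos hβ
  have hM := bigM_pos hβ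
  obtain ⟨η₁, hη₁, hth⟩ := exists_thetaMin_near β (half_pos hθ)
  obtain ⟨η₂, hη₂, hcr⟩ := exists_creaseEnergy_near hβ hC
  refine ⟨(thetaMin β / 2) ^ 4 / bigM β, by positivity, min η₁ η₂, lt_min hη₁ hη₂,
    fun α hα hαβ n => ?_⟩
  rw [lt_min_iff] at hαβ
  have h1 : thetaMin β / 2 ≤ thetaMin α := by linarith [(abs_le.1 (hth α hαβ.1)).1]
  have h2 : bigM α ≤ 2 * bigM β := by
    unfold bigM; linarith [(abs_le.1 (hcr α hα hαβ.2)).2]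
  have h3 : (thetaMin β / 2) ^ 4 ≤ thetaMin α ^ 4 := pow_le_pow_left₀ (by positivity) h1 4
  have hn : (0 : ℝ) ≤ n := Nat.cast_nonneg n
  rw [le_div_iff₀ (bigM_pos hα), div_mul_eq_mul_div, div_mul_eq_mul_div, div_le_iff₀ hM, lam]
  calc (thetaMin β / 2) ^ 4 * n * bigM α ≤ thetaMin α ^ 4 * n * (2 * bigM β) := by
        gcongr
        exact (bigM_pos hα).le
    _ = 2 * n * thetaMin α ^ 4 * bigM β := by ring

lemma multiProfile_of_le {Q Q' : ℝ → ℝ} {T : ℝ} (hQ : IsProfile Q Q' T) {ν : ℝ} (s : ℝ)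
    {m : ℕ} {p : ℕ → ℝ} {t : ℝ} (h : ∀ j < m, ν * (t - p j) ≤ -T) :
    multiProfile Q ν s m p t = s := by
  rw [multiProfile, Finset.prod_eq_one, mul_one]
  intro j hj
  rw [hQ.eq_neg_one _ (h j (Finset.mem_range.1 hj)), neg_neg]

lemma multiProfile_of_ge {Q Q' : ℝ → ℝ} {T : ℝ} (hQ : IsProfile Q Q' T) {ν : ℝ} (s : ℝ)
    {m : ℕ} {p : ℕ → ℝ} {t : ℝ} (h : ∀ j < m, T ≤ ν * (t - p j)) :
    multiProfile Q ν s m p t = s * (-1) ^ m := by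
  rw [multiProfile, Finset.prod_congr rfl (g := fun _ => (-1 : ℝ)), Finset.prod_const,
    Finset.card_range]
  intro j hj
  rw [hQ.eq_one _ (h j (Finset.mem_range.1 hj))]

/-- Step functions are approximated by products of almost optimal profiles, at a scale of order
`1 / n`, uniformly in the parameter near `β`. -/
theorem modicaMortola_upper {β : ℝ} (hβ : β ∈ Ico (0 : ℝ) 4) {R : ℝ → ℝ → Prop}
    (hR : ∀ c x y, R x y → R (c * x) (c * y)) {m : ℕ} (hm : R 1 ((-1) ^ m)) {y : L1I}
    (hy : y ∈ stepSet (thetaMin β) m) {ε : ℝ} (hε : 0 < ε) :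
    ∃ n₀ : ℕ, ∃ η > 0, ∀ n ≥ n₀, ∀ α ∈ Ico (0 : ℝ) 4, |α - β| < η → ∃ u : L1I,
      dist u y ≤ ε ∧ modicaMortola R n α u ≤ ((m * creaseEnergy β + ε : ℝ) : EReal) := by
  obtain ⟨s, p, hs, hp, hp', hys⟩ := hy
  have hC := creaseEnergy_pos hβ
  have hM := bigM_pos hβ
  have hpi := Real.pi_pos
  obtain ⟨Q, Q', T, hQ, hQE⟩ := exists_isProfile (ε := ε / (4 * (m + 1) * bigM β)) (by positivity)
  have hT := hQ.pos
  obtain ⟨κ, hκ, η₁, hη₁, hscale⟩ := exists_le_lam_div_bigM hβ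
  obtain ⟨η₂, hη₂, hth⟩ := exists_thetaMin_near β (half_pos hε)
  obtain ⟨η₃, hη₃, hcr⟩ := exists_creaseEnergy_near hβ
    (ε := min (creaseEnergy β) (ε / (2 * (m + 1)))) (lt_min hC (by positivity))
  obtain ⟨n₁, hsep⟩ := exists_jumps_separated hp hp' (2 * T / κ)
  obtain ⟨n₂, hn₂⟩ := exists_nat_gt (m * (2 * (T / κ) * Real.pi) / (ε / 2))
  rw [div_lt_iff₀ (by positivity)] at hn₂
  refine ⟨n₁ + n₂ + 1, min η₁ (min η₂ η₃), lt_min hη₁ (lt_min hη₂ hη₃), fun n hn α hα hαβ => ?_⟩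
  rw [lt_min_iff, lt_min_iff] at hαβ
  obtain ⟨hα1, hα2, hα3⟩ := hαβ
  have hn0 : 0 < n := by omega
  have hn' : (0 : ℝ) < n := by exact_mod_cast hn0
  obtain ⟨hsep1, hsep2⟩ := hsep n (by omega)
  have hθ := thetaMin_pos hα.2
  have hMα := bigM_pos hα
  have hlam := lam_pos hn0 hα
  have hνn := hscale α hα hα1 n
  set ν := lam n α / bigM α with hνdef
  have hν : 0 < ν := div_pos hlam hMα
  -- A distance of `2 * T / κ` sites is at least the width `2 * T / ν` of a layer.
  have hwide : ∀ {d : ℝ}, 2 * T / κ ≤ n * d → 2 * T ≤ ν * d := by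
    intro d hd
    have hd0 : 0 ≤ d := nonneg_of_mul_nonneg_right ((by positivity : 0 ≤ 2 * T / κ).trans hd) hn'
    have h1 : κ * (2 * T / κ) ≤ κ * (n * d) := mul_le_mul_of_nonneg_left hd hκ.le
    rw [mul_div_cancel₀ _ hκ.ne'] at h1
    have h2 := mul_le_mul_of_nonneg_right hνn hd0
    linarith
  have hsepν : ∀ i j, i < j → j < m → ν * p i + 2 * T ≤ ν * p j := by
    intro i j hij hj
    have := hwide (d := p j - p i) (by linarith [hsep2 i j hij hj])
    linarith
  set w : ℝ → ℝ := fun t => thetaMin α * multiProfile Q ν s m p t with hw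
  have hwac : AbsolutelyContinuousOnInterval w 0 1 :=
    absolutelyContinuous_multiProfile hQ (thetaMin α) ν s m p
  have hbal : bigM α ^ 2 / (lam n α * thetaMin α ^ 2) * thetaMin α ^ 2 * ν ^ 2
      = lam n α / thetaMin α ^ 4 * thetaMin α ^ 4 := by
    rw [hνdef]; field_simp
  obtain ⟨hw', hE⟩ := mmEnergy_multiProfile_le hQ (A := lam n α / thetaMin α ^ 4)
    (B := bigM α ^ 2 / (lam n α * thetaMin α ^ 2)) (by positivity) (by positivity) hν hθ hbal hs
    hsepν
  have hwle : ∀ t, |w t| ≤ Real.pi / 2 := fun t => by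
    rw [hw, abs_mul, abs_of_pos hθ]
    calc thetaMin α * |multiProfile Q ν s m p t| ≤ thetaMin α * 1 :=
          mul_le_mul_of_nonneg_left (abs_multiProfile_le hQ hs m p t) hθ.le
      _ ≤ Real.pi / 2 := by linarith [thetaMin_le hα.1]
  have hint : Integrable w muI := by
    refine (integrable_muI_iff w).2 ?_
    exact hwac.continuousOn.intervalIntegrable
  have huw := hint.coeFn_toL1
  refine ⟨hint.toL1 _, ?_, ?_⟩
  · have h := dist_le_of_near_jumps (u := hint.toL1 _) (y := y) (e := ε / 2) (D := Real.pi)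
      (r := T / ν) (m := m) (p := p) (by positivity) (by
        filter_upwards [huw, hys] with t h1 h2
        rw [h1, h2]
        have hnn : ∀ j, 0 ≤ (Icc (p j - T / ν) (p j + T / ν)).indicator
            (fun _ => Real.pi) t := fun j => indicator_nonneg (fun _ _ => hpi.le) _
        by_cases hfar : ∀ j < m, t < p j - T / ν ∨ p j + T / ν < t
        · have h3 : w t = thetaMin α * stepFn s m p t := by
            rw [hw, ← multiProfile_of_far hQ hν hfar]
          rw [h3, ← sub_mul, abs_mul, abs_stepFn hs, mul_one]
          exact le_add_of_le_of_nonneg (hth α hα2) (Finset.sum_nonneg fun j _ => hnn j)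
        · push Not at hfar
          obtain ⟨j, hj, h4⟩ := hfar
          have h5 := Finset.single_le_sum (f := fun j => (Icc (p j - T / ν)
            (p j + T / ν)).indicator (fun _ => Real.pi) t)
            (fun j _ => hnn j) (Finset.mem_range.2 hj)
          rw [indicator_of_mem (show t ∈ Icc (p j - T / ν) (p j + T / ν) from h4)] at h5
          have h7 : |thetaMin β * stepFn s m p t| ≤ Real.pi / 2 := by
            rw [abs_mul, abs_stepFn hs, mul_one, abs_of_pos (thetaMin_pos hβ.2)]
            exact thetaMin_le hβ.1
          have h8 := abs_sub (w t) (thetaMin β * stepFn s m p t)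
          linarith [hwle t]) hpi.le
    have h9 : T / ν ≤ T / κ / n := by
      rw [div_div]
      exact div_le_div_of_nonneg_left hT.le (by positivity) hνn
    have h10 : m * (2 * (T / ν) * Real.pi) ≤ ε / 2 := by
      have h11 : m * (2 * (T / ν) * Real.pi) ≤ m * (2 * (T / κ / n) * Real.pi) := by gcongr
      have e : m * (2 * (T / κ / n) * Real.pi) = m * (2 * (T / κ) * Real.pi) / n := by ring
      refine h11.trans ?_
      rw [e, div_le_iff₀ hn']
      have h12 : (n₂ : ℝ) ≤ n := by exact_mod_cast (by omega : n₂ ≤ n)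
      have h13 : (n₂ : ℝ) * (ε / 2) ≤ n * (ε / 2) := by gcongr
      linarith
    linarith
  · have hbd : R (w 0) (w 1) := by
      have h0 : w 0 = thetaMin α * s * 1 := by
        simp only [hw]
        rw [multiProfile_of_le hQ, mul_one]
        intro j hj
        have := hwide (hsep1 j hj).1
        linarith
      have h1 : w 1 = thetaMin α * s * (-1) ^ m := by
        simp only [hw]
        rw [multiProfile_of_ge hQ, mul_assoc]
        intro j hj
        have := hwide (d := 1 - p j) (by linarith [(hsep1 j hj).2])
        linarith
      rw [h0, h1]
      exact hR _ _ _ hm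
    obtain ⟨hmem, hd⟩ := memW12Bdry_of_absolutelyContinuous hwac hw' huw hbd
    rw [modicaMortola_eq hmem hwac hw' huw hd]
    refine EReal.coe_le_coe_iff.2 (hE.trans ?_)
    set J := ∫ s, ((Q s ^ 2 - 1) ^ 2 + Q' s ^ 2) with hJ
    have e : lam n α / thetaMin α ^ 4 * thetaMin α ^ 4 * (ν⁻¹ * J) = bigM α * J := by
      rw [hνdef]; field_simp
    rw [e]
    have hcα := (abs_le.1 (hcr α hα hα3)).2
    have h1 : bigM α ≤ 2 * bigM β := by
      unfold bigM; linarith [min_le_left (creaseEnergy β) (ε / (2 * (m + 1)))]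
    have h2 : creaseEnergy α ≤ creaseEnergy β + ε / (2 * (m + 1)) := by
      linarith [min_le_right (creaseEnergy β) (ε / (2 * (m + 1)))]
    have h3 : bigM α * J ≤ creaseEnergy β + ε / (m + 1) := by
      have h4 : bigM α * J ≤ bigM α * (8 / 3 + ε / (4 * (m + 1) * bigM β)) := by gcongr
      have h5 : bigM α * (ε / (4 * (m + 1) * bigM β))
          ≤ 2 * bigM β * (ε / (4 * (m + 1) * bigM β)) := by gcongr
      have h6 : 2 * bigM β * (ε / (4 * (m + 1) * bigM β)) = ε / (2 * (m + 1)) := by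
        field_simp; ring
      have h7 : bigM α * (8 / 3) = creaseEnergy α := by unfold bigM; ring
      have h8 : ε / (m + 1) = ε / (2 * (m + 1)) + ε / (2 * (m + 1)) := by field_simp; ring
      rw [mul_add] at h4
      linarith
    have h9 : m * (bigM α * J) ≤ m * (creaseEnergy β + ε / (m + 1)) := by gcongr
    have h10 : (m : ℝ) * (ε / (m + 1)) ≤ ε := by
      rw [mul_div_assoc', div_le_iff₀ (by positivity)]
      linarith
    linarith

/-! ### Uniform equivalence -/

/-- Both families `Γ`-converge to `limitEnergy` as soon as the boundary condition is invariant under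
scaling and admits a well on both sides, and either allows an odd number of sign changes or implies
periodicity. -/
theorem uniformlyEquivalentOn {R : ℝ → ℝ → Prop} (hR : R 1 1)
    (hR' : R 1 (-1) ∨ ∀ x y, R x y → x = y) (hscale : ∀ c x y, R x y → R (c * x) (c * y)) :
    UniformlyEquivalentOn (Ico (0 : ℝ) 4) (chainEnergy R) (modicaMortola R) := by
  intro β hβ a ha hlim ψ hψ
  have hev : ∀ {P : ℕ → ℝ → Prop}, (∃ n₀ : ℕ, ∃ η > 0, ∀ n ≥ n₀, ∀ α ∈ Ico (0 : ℝ) 4,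
      |α - β| < η → P n α) → ∀ᶠ k in atTop, P (ψ k) (a (ψ k)) := by
    rintro P ⟨n₀, η, hη, h⟩
    filter_upwards [hψ.tendsto_atTop.eventually_ge_atTop n₀,
      hψ.tendsto_atTop.eventually (Metric.tendsto_nhds.1 hlim η hη)] with k h1 h2
    exact h _ h1 _ (ha _) (by rwa [Real.dist_eq] at h2)
  have hC := creaseEnergy_pos hβ
  refine ⟨id, strictMono_id, limitEnergy R (thetaMin β) (creaseEnergy β), ?_, ?_,
    isNontrivial_limitEnergy hR (thetaMin_pos hβ.2) hC⟩
  · exact gammaTendsto_limitEnergy hC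
      (fun ε hε K => hev (chainEnergy_lower hβ hR hR' hε K))
      (fun m hm y hy ε hε => hev (chainEnergy_upper hβ hscale hm hy hε))
  · exact gammaTendsto_limitEnergy hC
      (fun ε hε K => hev (modicaMortola_lower hβ hR hR' hε K))
      (fun m hm y hy ε hε => hev (modicaMortola_upper hβ hscale hm hy hε))

end FrustratedChain


theorem corollary4p7 :
    FrustratedChain.UniformlyEquivalentOn (Set.Ico (0 : ℝ) 4)
      (FrustratedChain.chainEnergy FrustratedChain.AbsPeriodic)
      (FrustratedChain.modicaMortola FrustratedChain.AbsPeriodic) ∧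
    FrustratedChain.UniformlyEquivalentOn (Set.Ico (0 : ℝ) 4)
      (FrustratedChain.chainEnergy FrustratedChain.Periodic)
      (FrustratedChain.modicaMortola FrustratedChain.Periodic) := by
  refine ⟨FrustratedChain.uniformlyEquivalentOn rfl (Or.inl ?_) fun c x y h => ?_,
    FrustratedChain.uniformlyEquivalentOn rfl (Or.inr fun _ _ h => h) fun c x y h => ?_⟩
  · simp [FrustratedChain.AbsPeriodic]
  · rw [FrustratedChain.AbsPeriodic] at h ⊢
    rw [abs_mul, abs_mul, h]
  · rw [FrustratedChain.Periodic] at h ⊢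
    rw [h]
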